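/- Let $\beta$ be a Pisot number (a real algebraic integer $>1$ all of whose other conjugates have modulus $<1$), let $T_\beta(x)=\beta x-\lfloor\beta x\rfloor$, and let $0=s_0<s_1<\dots<s_N=1$ be the elements of the finite set $\{0\}\cup\{T_\beta^n(1):n\ge 0\}$. The prototiles are the marked intervals $\tau_i=[s_{i-1},s_i]\times\{i\}$, $1\le i\le N$; a tile is a translate of a prototile. The $\beta$-substitution $\psi_\beta$ sends $i$ to the word $i_1\cdots i_n$ of the prototiles that $T_\beta(x)$ passes through successively as $x$ increases from $s_{i-1}$ to $s_i$; $\Psi_\beta$ sends $\tau_i+t$ to the set of tiles that subdivide the interval $\beta[s_{i-1},s_i]+\beta t$ in the pattern of $\psi_\beta(i)$, and a set of tiles to the union of the images of its elements. Let $\Omega$ be the set of tilings of $\mathbb R$ by such tiles all of whose finite connected patches occur in some $\Psi_\beta^n(\tau)$, $\tau$ a tile. If $\beta\notin\mathbb N$, then $\Omega_{\psi_\beta}:=\Omega$, on which $\Psi_\beta$ is bijective; if $\beta\in\mathbb N$, then $\Omega$ is a circle, $\Omega_{\psi_\beta}:=\varprojlim(\Omega,\Psi_\beta)$ is a solenoid,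 and $\Psi_\beta$ also denotes its shift homeomorphism. For a point $T$ of the solenoid let $T$ also denote its first coordinate, a tiling. *Strong regional proximality.* For a tiling $T$ let $B_R[T]$ be the set of its tiles that meet $[-R,R]$. For $\beta\notin\mathbb N$, $T\sim_{srp}T'$ means: for every $R>0$ there are $S,S'\in\Omega_{\psi_\beta}$ and $t\in\mathbb R$ with $B_R[T]=B_R[S]$, $B_R[T']=B_R[S']$ and $B_R[S-t]=B_R[S'-t]$. For $\beta\in\mathbb N$ it means: for all $R>0$ and $n\in\mathbb N$ there are $S,S'\in\Omega_{\psi_\beta}$ and $t\in\mathbb R$ such that these three equalities hold for the tilings $\Psi_\beta^{-j}(T),\Psi_\beta^{-j}(T'),\Psi_\beta^{-j}(S),\Psi_\beta^{-j}(S')$ and the translation by $\beta^{-j}t$, for all $0\le j\le n$. *Strands.* Let $A$ be the $N\times N$ matrix whose $(j,i)$ entry is the number of occurrences of $j$ in $\psi_\beta(i)$, let $p$ be the minimal polynomial of $\beta$ and let $pq$ be the characteristic polynomial of $A$. Let $V=\ker p(A)$ (the Pisot subspace), $W=\ker q(A)$, and let $\pi_V:\mathbb R^N=V\oplus W\to V$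 be the projection. A lift $\tilde T:\mathbb R\to\mathbb R^N$ of $T$ is a continuous map which on each tile $[c,d]$ of type $i$ of $T$ has the form $\tilde T(x)=a+\frac{x-c}{d-c}e_i$ with $a\in\mathbb Z^N$. Let $\tilde f$ be the map of the grid $\bigcup_{a\in\mathbb Z^N,\,i}(a+[0,1]e_i)$ that equals $A$ on $\mathbb Z^N$ and maps the edge $a+[0,1]e_i$ to the path that starts at $Aa$ and follows the edges in the order of the word $\psi_\beta(i)$, with speed such that $\tilde\Psi_\beta(\tilde T)(t):=\tilde f(\tilde T(t/\beta))$ is a lift of $\Psi_\beta(T)$ for each lift $\tilde T$ of $T$. A strand corresponding to $T$ is a map $\gamma=x+\pi_V\circ\tilde T$ with $x\in V$, and $\Psi_\beta(\gamma):=Ax+\pi_V\circ\tilde\Psi_\beta(\tilde T)$ is then a strand corresponding to $\Psi_\beta(T)$; $\Psi_\beta$ is bijective from the strands corresponding to $T$ to those corresponding to $\Psi_\beta(T)$. Let $t_*(T)=\sup\{t\le 0:\tau_1+t\in T\}$ and, for $i\in\mathbb Z$, $a_i(\gamma)=\Psi_\beta^i(\gamma)\bigl(t_*(\Psi_\beta^i(T))\bigr)$.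 *Global shadowing.* $T\sim_{gs}T'$ means that there are strands $\gamma,\gamma'$ corresponding to $T,T'$ such that $|a_i(\gamma)-a_i(\gamma')|$, $i\in\mathbb Z$, is bounded, and such that for each $i\in\mathbb Z$ there are $x_i\in V$ and lifts $\tilde T_i,\tilde T_i'$ of $\Psi_\beta^i(T),\Psi_\beta^i(T')$ with $\Psi_\beta^i(\gamma)=x_i+\pi_V\circ\tilde T_i$ and $\Psi_\beta^i(\gamma')=x_i+\pi_V\circ\tilde T_i'$. **Theorem.** For every Pisot number $\beta$, the relations $\sim_{srp}$ and $\sim_{gs}$ on $\Omega_{\psi_\beta}$ are the same. Moreover, if $\beta$ is an algebraic unit, then $T\sim_{srp}T'$ if and only if there are lifts $\tilde T,\tilde T'$ of $T,T'$ such that the strands $\gamma=\pi_V\circ\tilde T$, $\gamma'=\pi_V\circ\tilde T'$ satisfy: $|a_i(\gamma)-a_i(\gamma')|$, $i\in\mathbb Z$, is bounded. -/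

import Mathlib

noncomputable section

namespace BetaTiling

/-- `β` is a Pisot number: a real algebraic integer `β > 1` all of whose other Galois conjugates
have modulus less than `1`. -/
def IsPisot (β : ℝ) : Prop :=
  1 < β ∧ IsIntegral ℤ β ∧
    ∀ z : ℂ, Polynomial.aeval z (minpoly ℤ β) = 0 → z ≠ (β : ℂ) → ‖z‖ < 1

/-! ### The `β`-transformation and the prototiles -/

/-- The `β`-transformation `x ↦ β x - ⌊β x⌋`. -/
def betaMap (β x : ℝ) : ℝ := β * x - (⌊β * x⌋ : ℝ)

/-- The endpoints of the prototiles: `0` and the orbit of `1` (which contains `1`). -/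
def vertexSet (β : ℝ) : Set ℝ := {0} ∪ {x | ∃ n : ℕ, x = (betaMap β)^[n] 1}

/-- The number of prototiles. The vertex set is finite if `β` is Pisot. -/
def numTiles (β : ℝ) : ℕ := (vertexSet β).ncard - 1

/-- The vertices `0 = s 0 < s 1 < ⋯ < s N = 1`, where `N = numTiles β`, in increasing order:
`vtx β j` is the vertex that has exactly `j` vertices to its left. -/
def vtx (β : ℝ) (j : ℕ) : ℝ :=
  sInf {x | x ∈ vertexSet β ∧ (vertexSet β ∩ Set.Iio x).ncard = j}

/-- The length of the prototile `[s i, s (i+1)]`. -/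
def len (β : ℝ) (i : ℕ) : ℝ := vtx β (i + 1) - vtx β i

/-- A tile: the translate by `shift` of the prototile of type `type`, which is the interval
`[s i, s (i+1)]` marked with `i` (the types are numbered from `0`). -/
@[ext] structure Tile (β : ℝ) where
  /-- the type of the tile -/
  type : Fin (numTiles β)
  /-- the amount by which the prototile is translated -/
  shift : ℝ

/-- The initial vertex of a tile. -/
def Tile.min {β : ℝ} (τ : Tile β) : ℝ := vtx β τ.type + τ.shift

/-- The terminal vertex of a tile. -/
def Tile.max {β : ℝ} (τ : Tile β) : ℝ := vtx β (τ.type + 1) + τ.shift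

/-- The support of a tile. -/
def Tile.support {β : ℝ} (τ : Tile β) : Set ℝ := Set.Icc τ.min τ.max

/-! ### The substitution -/

/-- The translates `[s j, s (j+1)] + k`, `k ∈ ℤ`, tile the line, and `β s i`, `β s (i+1)` are
among their endpoints. As `x` increases from `s i` to `s (i+1)`, the point `β x` (which is
`betaMap β x` modulo `1`) passes successively through those of them that lie in
`[β s i, β s (i+1)]`. `offsets β i j` is the set of the `k` for which `[s j, s (j+1)] + k` is one
of these intervals; the substitution word of `i` lists the types `j` from left to right. -/
def offsets (β : ℝ) (i j : Fin (numTiles β)) : Set ℤ :=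
  {k | β * vtx β i ≤ vtx β j + k ∧ vtx β (j + 1) + k ≤ β * vtx β (i + 1)}

/-- The tile substitution on tiles: the support is inflated by `β` and subdivided according to
the substitution word. -/
def substTile {β : ℝ} (τ : Tile β) : Set (Tile β) :=
  {σ | ∃ k ∈ offsets β τ.type σ.type, σ.shift = β * τ.shift + (k : ℝ)}

/-- The tile substitution `Ψ` on collections of tiles. -/
def subst {β : ℝ} (P : Set (Tile β)) : Set (Tile β) := ⋃ τ ∈ P, substTile τ

/-- Distinct tiles of the collection have supports with disjoint interiors. -/
def NonOverlapping {β : ℝ} (P : Set (Tile β)) : Prop :=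
  ∀ τ ∈ P, ∀ σ ∈ P, τ ≠ σ → Disjoint (interior τ.support) (interior σ.support)

/-- A patch: a finite non-overlapping collection of tiles whose union of supports is connected. -/
def IsPatch {β : ℝ} (P : Set (Tile β)) : Prop :=
  P.Finite ∧ NonOverlapping P ∧ IsPreconnected (⋃ τ ∈ P, τ.support)

/-- A patch is allowed if it occurs in some iterate of the substitution on a single tile. -/
def IsAllowed {β : ℝ} (P : Set (Tile β)) : Prop :=
  ∃ (τ : Tile β) (n : ℕ), P ⊆ subst^[n] {τ}

/-- A tiling of the line. -/
def IsTiling {β : ℝ} (T : Set (Tile β)) : Prop :=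
  NonOverlapping T ∧ (⋃ τ ∈ T, τ.support) = Set.univ

/-- The tiling space: all tilings all of whose patches are allowed. (For `β ∈ ℕ` this is the
circle of translates of the tiling by unit intervals with integer endpoints.) -/
def tilingSpace (β : ℝ) : Set (Set (Tile β)) :=
  {T | IsTiling T ∧ ∀ P ⊆ T, IsPatch P → IsAllowed P}

/-- The translate `T - t`. -/
def translate {β : ℝ} (T : Set (Tile β)) (t : ℝ) : Set (Tile β) :=
  (fun τ : Tile β => (⟨τ.type, τ.shift - t⟩ : Tile β)) '' T

/-- `B_r[T]`, the set of tiles of `T` whose support meets `[-r, r]`. -/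
def centralPatch {β : ℝ} (r : ℝ) (T : Set (Tile β)) : Set (Tile β) :=
  {τ | τ ∈ T ∧ (τ.support ∩ Set.Icc (-r) r).Nonempty}

/-- A (two-sided) orbit of `Ψ` in the tiling space. If `β ∉ ℕ`, then `Ψ` is a bijection of the
tiling space, and `U i` is `Ψ^i (U 0)`. If `β ∈ ℕ`, then `Ψ` is a `β`-fold covering of the circle,
and the sequences `U 0, U (-1), U (-2), …` of the orbits are the points of its inverse limit, the
`β`-adic solenoid, which takes the place of the tiling space. -/
def IsOrbit (β : ℝ) (U : ℤ → Set (Tile β)) : Prop :=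
  ∀ i, U i ∈ tilingSpace β ∧ subst (U i) = U (i + 1)

/-! ### Strong regional proximality -/

/-- Strong regional proximality of tilings. -/
def StronglyRegionallyProximal (β : ℝ) (T T' : Set (Tile β)) : Prop :=
  ∀ R : ℝ, 0 < R → ∃ S ∈ tilingSpace β, ∃ S' ∈ tilingSpace β, ∃ t : ℝ,
    centralPatch R T = centralPatch R S ∧
    centralPatch R T' = centralPatch R S' ∧
    centralPatch R (translate S t) = centralPatch R (translate S' t)

/-- Strong regional proximality on the inverse limit of `Ψ` on the tiling space: agreement on a
large window means agreement on a large window in many of the coordinates. The translation by `t`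
acts on the coordinate with index `-j` as the translation by `t / β ^ j`. -/
def SolenoidStronglyRegionallyProximal (β : ℝ) (U U' : ℤ → Set (Tile β)) : Prop :=
  ∀ (R : ℝ) (n : ℕ), 0 < R → ∃ S S' : ℤ → Set (Tile β), IsOrbit β S ∧ IsOrbit β S' ∧ ∃ t : ℝ,
    ∀ j : ℕ, j ≤ n →
      centralPatch R (U (-j)) = centralPatch R (S (-j)) ∧
      centralPatch R (U' (-j)) = centralPatch R (S' (-j)) ∧
      centralPatch R (translate (S (-j)) (t / β ^ j)) =
        centralPatch R (translate (S' (-j)) (t / β ^ j))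

/-! ### The Pisot subspace -/

/-- The abelianization of the substitution as a matrix acting on column vectors: the entry
`(j, i)` is the number of occurrences of the letter `j` in the substitution word of `i`. -/
def substMatrix (β : ℝ) : Matrix (Fin (numTiles β)) (Fin (numTiles β)) ℝ :=
  Matrix.of fun j i => ((offsets β i j).ncard : ℝ)

/-- The minimal polynomial of `β`, with coefficients regarded as real numbers. -/
def minPoly (β : ℝ) : Polynomial ℝ := (minpoly ℤ β).map (Int.castRingHom ℝ)

/-- The cofactor `q` in the factorization of the characteristic polynomial of the substitution
matrix as the minimal polynomial of `β` times `q`. -/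
def coPoly (β : ℝ) : Polynomial ℝ := (substMatrix β).charpoly /ₘ minPoly β

/-- The Pisot subspace `V`. If `s₁ p + s₂ q = 1`, where `p q` is the characteristic polynomial
of `A`, then the kernels of `s₁(A) p(A)` and of `p(A)` are the same. -/
def pisotSubspace (β : ℝ) : Submodule ℝ (Fin (numTiles β) → ℝ) :=
  LinearMap.ker (Polynomial.aeval (substMatrix β) (minPoly β)).mulVecLin

/-- The complementary invariant subspace `W`, the kernel of `s₂(A) q(A)`, that is, of `q(A)`. -/
def complSubspace (β : ℝ) : Submodule ℝ (Fin (numTiles β) → ℝ) :=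
  LinearMap.ker (Polynomial.aeval (substMatrix β) (coPoly β)).mulVecLin

open Classical in
/-- The projection `π_V` onto the Pisot subspace `V` along `W`. (If `β` is Pisot, the two subspaces
are complementary.) -/
def pisotProj (β : ℝ) : (Fin (numTiles β) → ℝ) →ₗ[ℝ] (Fin (numTiles β) → ℝ) :=
  if h : IsCompl (pisotSubspace β) (complSubspace β) then Submodule.projection _ _ h else 0

/-! ### Lifts to the universal abelian cover of the rose -/

/-- A lift of the tiling `T`, regarded as a map of the line into the rose (the wedge of the
prototiles with all endpoints identified), to the universal abelian cover of the rose, which is the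
grid of the unit edges parallel to the coordinate axes and with endpoints in `ℤ^N`: on each tile of
`T` of type `i` the lift runs, at constant speed, along an edge in the direction `e i`. (The tiles
are closed intervals that cover the line, so a lift is continuous.) -/
def IsLift {β : ℝ} (T : Set (Tile β)) (f : ℝ → Fin (numTiles β) → ℝ) : Prop :=
  ∀ τ ∈ T, ∃ a : Fin (numTiles β) → ℤ, ∀ x ∈ τ.support,
    f x = (fun j => (a j : ℝ)) + Pi.single τ.type ((x - τ.min) / len β τ.type)

/-- The path in the grid that starts at `0` and follows the substitution word of `i`, at time
`u ∈ [0,1]`: with `y` the point that divides `[β s i, β s (i+1)]` in the ratio `u : (1 - u)`, the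
`j`-th coordinate is the sum, over the intervals `[s j, s (j+1)] + k` of type `j` in the
subdivision of `[β s i, β s (i+1)]`, of the fraction of the interval to the left of `y`. -/
def wordPath (β : ℝ) (i : Fin (numTiles β)) (u : ℝ) : Fin (numTiles β) → ℝ := fun j =>
  ∑ᶠ k ∈ offsets β i j,
    max 0 (min 1 ((β * (vtx β i + u * len β i) - (vtx β j + (k : ℝ))) / len β j))

/-- The lift to the grid, fixing `0`, of the map of the rose that is induced by `Ψ`: the point
`a + u e i` of the grid (`a ∈ ℤ^N`, `0 ≤ u ≤ 1`) goes to `A a + wordPath β i u`. At a point of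
the grid, at most one coordinate has a non-zero fractional part. -/
def liftMap (β : ℝ) (v : Fin (numTiles β) → ℝ) : Fin (numTiles β) → ℝ :=
  (substMatrix β).mulVec (fun j => (⌊v j⌋ : ℝ)) + ∑ i, wordPath β i (Int.fract (v i))

/-- The map induced by `Ψ` on lifts of tilings. -/
def liftSubst (β : ℝ) (f : ℝ → Fin (numTiles β) → ℝ) : ℝ → Fin (numTiles β) → ℝ :=
  fun t => liftMap β (f (t / β))

/-! ### Strands and global shadowing -/

/-- `t_*(T)`, the largest non-positive initial vertex of a tile of the first type in `T`. -/
def tStar {β : ℝ} (T : Set (Tile β)) : ℝ :=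
  sSup {t | t ≤ 0 ∧ ∃ τ ∈ T, (τ.type : ℕ) = 0 ∧ τ.shift = t}

/-- The function `γ` is the strand `x + π_V ∘ f`. -/
def IsStrandOf (β : ℝ) (x : Fin (numTiles β) → ℝ) (f : ℝ → Fin (numTiles β) → ℝ)
    (γ : ℝ → Fin (numTiles β) → ℝ) : Prop :=
  ∀ t, γ t = x + pisotProj β (f t)

/-- `γ` is a strand corresponding to `T`, and `γ'` is its image under `Ψ`, a strand corresponding
to `Ψ(T)`: the image of `x + π_V ∘ f` is `A x + π_V ∘ Ψ(f)`. -/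
def StrandStep {β : ℝ} (T : Set (Tile β)) (γ γ' : ℝ → Fin (numTiles β) → ℝ) : Prop :=
  ∃ x ∈ pisotSubspace β, ∃ f, IsLift T f ∧ IsStrandOf β x f γ ∧
    IsStrandOf β ((substMatrix β).mulVec x) (liftSubst β f) γ'

/-- `γ` is a two-sided `Ψ`-orbit of strands over the orbit `U` of tilings:
`γ i` is `Ψ^i (γ 0)`, a strand corresponding to `U i`. -/
def IsStrandOrbit {β : ℝ} (U : ℤ → Set (Tile β)) (γ : ℤ → ℝ → Fin (numTiles β) → ℝ) : Prop :=
  ∀ i, StrandStep (U i) (γ i) (γ (i + 1))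

/-- The initial vertices `a_i = Ψ^i(γ)(t_*(Ψ^i(T)))` of two orbits of strands stay within a bounded
distance of each other, `i ∈ ℤ`. -/
def BoundedDistance {β : ℝ} (U U' : ℤ → Set (Tile β))
    (γ γ' : ℤ → ℝ → Fin (numTiles β) → ℝ) : Prop :=
  ∃ B : ℝ, ∀ i, ‖γ i (tStar (U i)) - γ' i (tStar (U' i))‖ ≤ B

/-- Global shadowing, for (orbits of) points `U 0`, `U' 0`: there are strands of the two points
that stay within a bounded distance under all iterates of `Ψ` and such that, for each `i ∈ ℤ`, the
`i`-th iterates are translates, by one and the same `x ∈ V`, of projections of lifts. -/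
def OrbitGloballyShadows {β : ℝ} (U U' : ℤ → Set (Tile β)) : Prop :=
  ∃ γ γ' : ℤ → ℝ → Fin (numTiles β) → ℝ, IsStrandOrbit U γ ∧ IsStrandOrbit U' γ' ∧
    (∀ i, ∃ x ∈ pisotSubspace β, ∃ f f', IsLift (U i) f ∧ IsLift (U' i) f' ∧
      IsStrandOf β x f (γ i) ∧ IsStrandOf β x f' (γ' i)) ∧
    BoundedDistance U U' γ γ'

/-- Global shadowing of tilings. -/
def GloballyShadows (β : ℝ) (T T' : Set (Tile β)) : Prop :=
  ∃ U U' : ℤ → Set (Tile β), IsOrbit β U ∧ IsOrbit β U' ∧ U 0 = T ∧ U' 0 = T' ∧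
    OrbitGloballyShadows U U'

/-- The variant of global shadowing in which only the strands of `T` and `T'` themselves, and not
those of their preimages under the iterates of `Ψ`, are required to be projections of lifts up to
a common translation. The common translation can be taken to be `0` here. -/
def WeaklyGloballyShadows (β : ℝ) (T T' : Set (Tile β)) : Prop :=
  ∃ U U' : ℤ → Set (Tile β), IsOrbit β U ∧ IsOrbit β U' ∧ U 0 = T ∧ U' 0 = T' ∧
    ∃ γ γ' : ℤ → ℝ → Fin (numTiles β) → ℝ, IsStrandOrbit U γ ∧ IsStrandOrbit U' γ' ∧
      (∃ f f', IsLift T f ∧ IsLift T' f' ∧ IsStrandOf β 0 f (γ 0) ∧ IsStrandOf β 0 f' (γ' 0)) ∧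
      BoundedDistance U U' γ γ'

end BetaTiling

end

/-!
Both relations are equivalent to one arithmetic condition on the orbits `U`, `U'` of the two
tilings: the differences `tStar (U i) - tStar (U' i)`, `i ∈ ℤ`, of the initial vertices of tiles
of the first type all lie in one *finite* subset `F` of the ring `ℤ[β]`.

*Finiteness.* The Pisot property enters through `BddConj`: the numbers `P(β)`, `P ∈ ℤ[X]`, of
bounded modulus such that `P` is bounded at the other conjugates of `β` form a finite set
(`finite_bddConj`). The shifts of the tiles of an allowed patch differ by numbers of this kind,
which gives the finiteness of the vertex set and finite local complexity.

*From `F` to proximality* (`stronglyRegionallyProximal_of_finite`). Let `A` be the set of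
positions of tiles of the first type in the patches `Ψⁿ(τ)`, where `τ` is the first prototile, and
`D = A - A`. By the pigeonhole principle and the self-similarity of `D`, every element of `ℤ[β]`
is, up to multiplication by a power of `β`, of the form `d - β ^ k * e` with `d, e ∈ D` and `k` as
large as desired (`isReturnDifference`). Hence patches of two tilings whose vertices differ by an
element of `ℤ[β]` extend to tilings whose images under some `Ψ^K` share a tile. As there are only
finitely many patches of a given size up to translation, `K` is uniform for differences in `F`,
and applying this at the time `-K` shows that the tilings at time `0` are proximal.

*From proximality to `F`.* The central patches of proximal tilings occur in two tilings that share
a patch somewhere, so the positions of their tiles differ by numbers with bounded conjugates,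
which lie in a finite set that depends only on `β`
(`exists_finite_of_stronglyRegionallyProximal`). To have this along the whole orbit, proximality
is transported backwards: for `β ∉ ℕ` the map `Ψ` is bijective on the tiling space with uniformly
continuous inverse, since the starts of runs of consecutive tiles are visible in the image
(`exists_recognizability`, `exists_orbit`, `stronglyRegionallyProximal_orbit`).

*Global shadowing* (`orbitGloballyShadows_iff`). The lengths of the prototiles form a left
eigenvector of the substitution matrix for the simple eigenvalue `β`. Along a lift the total
length is the position plus a constant, which the substitution multiplies by `β`. Boundedness for
positive `i` therefore forces the constants of two shadowing strands to agree, and the vertices of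
the strands differ by projections of integer vectors with total length
`tStar (U i) - tStar (U' i)`. The projections of integer vectors to the Pisot subspace form a
discrete set, in bijection with `ℤ[β]` through the total length (`pisotProj_castVec_eq`, `exists_totalLen_eq`), so bounded
means finitely many values. Conversely, lifts with equal constants are corrected to orbits of
strands by one and the same sequence of vectors (`exists_strandOrbits`). If `β` is a unit,
multiplication by `β` is bijective on `ℤ[β]`, so it suffices that the strands at time `0` are
projections of lifts (`exists_finite_of_weak`).

For `β ∈ ℕ` all tiles are unit intervals, and both relations are equality (`solenoid_iff`).
-/

noncomputable section

open Polynomial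

namespace BetaTiling

/-! ### Elements of `ℤ[β]` with bounded conjugates -/

/-- The ring `ℤ[β]`. -/
abbrev betaRing (β : ℝ) : Subalgebra ℤ ℝ := Algebra.adjoin ℤ {β}

/-- `x` is an element of `ℤ[β]` all of whose conjugates, other than `x` itself, are bounded by `C`.
The conjugates of `x = P(β)` are taken to be the numbers `P(z)`, where `z` is a conjugate of `β`. -/
def BddConj (β C x : ℝ) : Prop :=
  ∃ P : ℤ[X], aeval β P = x ∧
    ∀ z : ℂ, aeval z (minpoly ℤ β) = 0 → z ≠ (β : ℂ) → ‖aeval z P‖ ≤ C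

variable {β : ℝ}

lemma IsPisot.one_lt (hβ : IsPisot β) : 1 < β := hβ.1

lemma IsPisot.pos (hβ : IsPisot β) : 0 < β := zero_lt_one.trans hβ.1

lemma finite_conjugates (hβ : IsPisot β) :
    {z : ℂ | aeval z (minpoly ℤ β) = 0 ∧ z ≠ (β : ℂ)}.Finite := by
  refine ((minpoly ℤ β).rootSet_finite ℂ).subset fun z hz => ?_
  rw [mem_rootSet']
  refine ⟨?_, hz.1⟩
  rw [Ne, Polynomial.map_eq_zero_iff (algebraMap ℤ ℂ).injective_int]
  exact minpoly.ne_zero hβ.2.1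

/-- The conjugates of a Pisot number are uniformly smaller than `1`. -/
lemma exists_conjugate_bound (hβ : IsPisot β) :
    ∃ ρ : ℝ, 0 ≤ ρ ∧ ρ < 1 ∧
      ∀ z : ℂ, aeval z (minpoly ℤ β) = 0 → z ≠ (β : ℂ) → ‖z‖ ≤ ρ := by
  rcases Set.eq_empty_or_nonempty {z : ℂ | aeval z (minpoly ℤ β) = 0 ∧ z ≠ (β : ℂ)} with h | h
  · refine ⟨0, le_rfl, zero_lt_one, fun z h1 h2 => ?_⟩
    have : z ∈ ({z : ℂ | aeval z (minpoly ℤ β) = 0 ∧ z ≠ (β : ℂ)}) := ⟨h1, h2⟩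
    simp [h] at this
  · obtain ⟨w, hw, hmax⟩ := Set.exists_max_image _ (fun z : ℂ => ‖z‖) (finite_conjugates hβ) h
    exact ⟨‖w‖, norm_nonneg _, hβ.2.2 w hw.1 hw.2, fun z h1 h2 => hmax z ⟨h1, h2⟩⟩

lemma mem_betaRing_iff {x : ℝ} : x ∈ betaRing β ↔ ∃ P : ℤ[X], aeval β P = x := by
  rw [betaRing, Algebra.adjoin_singleton_eq_range_aeval]
  rfl

lemma pow_mem_betaRing (k : ℕ) : β ^ k ∈ betaRing β := mem_betaRing_iff.2 ⟨X ^ k, by simp⟩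

lemma BddConj.mem {C x : ℝ} (h : BddConj β C x) : x ∈ betaRing β := by
  obtain ⟨P, hP, -⟩ := h
  exact mem_betaRing_iff.2 ⟨P, hP⟩

lemma exists_bddConj (hβ : IsPisot β) {x : ℝ} (hx : x ∈ betaRing β) :
    ∃ C, 0 ≤ C ∧ BddConj β C x := by
  obtain ⟨P, hP⟩ := mem_betaRing_iff.1 hx
  obtain ⟨C, hC⟩ := ((finite_conjugates hβ).image fun z : ℂ => ‖aeval z P‖).bddAbove
  refine ⟨max C 0, le_max_right _ _, P, hP, fun z h1 h2 => ?_⟩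
  exact (hC ⟨z, ⟨h1, h2⟩, rfl⟩).trans (le_max_left _ _)

lemma BddConj.mono {C C' x : ℝ} (h : BddConj β C x) (hC : C ≤ C') : BddConj β C' x := by
  obtain ⟨P, hP, hb⟩ := h
  exact ⟨P, hP, fun z h1 h2 => (hb z h1 h2).trans hC⟩

lemma BddConj.add {C C' x y : ℝ} (h : BddConj β C x) (h' : BddConj β C' y) :
    BddConj β (C + C') (x + y) := by
  obtain ⟨P, hP, hb⟩ := h
  obtain ⟨Q, hQ, hb'⟩ := h'
  refine ⟨P + Q, by simp [hP, hQ], fun z h1 h2 => ?_⟩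
  rw [map_add]
  exact (norm_add_le _ _).trans (add_le_add (hb z h1 h2) (hb' z h1 h2))

lemma BddConj.neg {C x : ℝ} (h : BddConj β C x) : BddConj β C (-x) := by
  obtain ⟨P, hP, hb⟩ := h
  refine ⟨-P, by simp [hP], fun z h1 h2 => ?_⟩
  rw [map_neg, norm_neg]
  exact hb z h1 h2

lemma BddConj.sub {C C' x y : ℝ} (h : BddConj β C x) (h' : BddConj β C' y) :
    BddConj β (C + C') (x - y) := by
  rw [sub_eq_add_neg]
  exact h.add h'.neg

lemma bddConj_intCast (k : ℤ) : BddConj β |(k : ℝ)| k := by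
  refine ⟨Polynomial.C k, by simp, fun z _ _ => ?_⟩
  simp

lemma BddConj.mul_left {C ρ x : ℝ}
    (hρ0 : 0 ≤ ρ) (hρ : ∀ z : ℂ, aeval z (minpoly ℤ β) = 0 → z ≠ (β : ℂ) → ‖z‖ ≤ ρ)
    (h : BddConj β C x) : BddConj β (ρ * C) (β * x) := by
  obtain ⟨P, hP, hb⟩ := h
  refine ⟨X * P, by simp [hP], fun z h1 h2 => ?_⟩
  rw [map_mul, aeval_X, norm_mul]
  exact mul_le_mul (hρ z h1 h2) (hb z h1 h2) (norm_nonneg _) hρ0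

lemma BddConj.pow_mul_left {C ρ x : ℝ}
    (hρ0 : 0 ≤ ρ) (hρ : ∀ z : ℂ, aeval z (minpoly ℤ β) = 0 → z ≠ (β : ℂ) → ‖z‖ ≤ ρ)
    (h : BddConj β C x) (k : ℕ) : BddConj β (ρ ^ k * C) (β ^ k * x) := by
  induction k with
  | zero => simpa using h
  | succ k ih =>
    have := ih.mul_left hρ0 hρ
    rwa [← mul_assoc, ← mul_assoc, ← pow_succ', ← pow_succ'] at this

/-- The conjugates of `β ^ k * x` tend to `0`. -/
lemma exists_bddConj_one (hβ : IsPisot β) {x : ℝ} (hx : x ∈ betaRing β) :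
    ∃ k₀ : ℕ, ∀ k ≥ k₀, BddConj β 1 (β ^ k * x) := by
  obtain ⟨C, hC0, hC⟩ := exists_bddConj hβ hx
  obtain ⟨ρ, hρ0, hρ1, hρ⟩ := exists_conjugate_bound hβ
  have ht : Filter.Tendsto (fun k : ℕ => ρ ^ k * C) Filter.atTop (nhds (0 * C)) :=
    (tendsto_pow_atTop_nhds_zero_of_lt_one hρ0 hρ1).mul_const C
  rw [zero_mul] at ht
  obtain ⟨k₀, hk₀⟩ := Filter.eventually_atTop.1 (ht.eventually_le_const zero_lt_one)
  exact ⟨k₀, fun k hk => (hC.pow_mul_left hρ0 hρ k).mono (hk₀ k hk)⟩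

/-- There are only finitely many elements of `ℤ[β]` in a bounded interval whose conjugates are
bounded. -/
lemma finite_bddConj (hβ : IsPisot β) (B C : ℝ) : {x : ℝ | |x| ≤ B ∧ BddConj β C x}.Finite := by
  have hint : IsIntegral ℚ β := hβ.2.1.tower_top
  let K := IntermediateField.adjoin ℚ {β}
  have : FiniteDimensional ℚ K := IntermediateField.adjoin.finiteDimensional hint
  have : NumberField K := ⟨⟩
  refine ((NumberField.Embeddings.finite_of_norm_le K ℂ (max B C)).image
    (algebraMap K ℝ)).subset ?_
  rintro x ⟨hxB, P, rfl, hP⟩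
  let g : K := IntermediateField.AdjoinSimple.gen ℚ β
  have hg : algebraMap K ℝ g = β := IntermediateField.AdjoinSimple.algebraMap_gen ℚ β
  have hgint : IsIntegral ℤ g := by
    rw [← isIntegral_algebraMap_iff (algebraMap K ℝ).injective, hg]
    exact hβ.2.1
  have haev : ∀ Q : ℤ[X], algebraMap K ℝ (aeval g Q) = aeval β Q := fun Q => by
    rw [← aeval_algebraMap_apply, hg]
  refine ⟨aeval g P, ⟨?_, fun φ => ?_⟩, haev P⟩
  · exact IsIntegral.of_mem_of_fg _ hgint.fg_adjoin_singleton _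
      (by rw [Algebra.adjoin_singleton_eq_range_aeval]; exact ⟨P, rfl⟩)
  · have hφ : ∀ Q : ℤ[X], φ (aeval g Q) = aeval (φ g) Q := fun Q => by
      rw [aeval_def, hom_eval₂, aeval_def]
      congr 1
      exact RingHom.ext_int _ _
    rw [hφ]
    by_cases h : φ g = (β : ℂ)
    · rw [h]
      have : aeval (β : ℂ) P = ((aeval β P : ℝ) : ℂ) := by
        have := aeval_algebraMap_apply ℂ β P
        simpa using this
      rw [this, Complex.norm_real]
      exact hxB.trans (le_max_left _ _)
    · refine (hP _ ?_ h).trans (le_max_right _ _)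
      have h0 : aeval g (minpoly ℤ β) = 0 := by
        apply (algebraMap K ℝ).injective
        rw [haev, minpoly.aeval, map_zero]
      rw [← hφ, h0, map_zero]

/-! ### The vertices -/

lemma betaMap_nonneg (x : ℝ) : 0 ≤ betaMap β x := Int.fract_nonneg (β * x)

lemma betaMap_lt_one (x : ℝ) : betaMap β x < 1 := Int.fract_lt_one (β * x)

lemma betaMap_zero : betaMap β 0 = 0 := by simp [betaMap]

lemma zero_mem_vertexSet : (0 : ℝ) ∈ vertexSet β := Or.inl rfl

lemma one_mem_vertexSet : (1 : ℝ) ∈ vertexSet β := Or.inr ⟨0, rfl⟩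

lemma betaMap_mem_vertexSet {x : ℝ} (hx : x ∈ vertexSet β) : betaMap β x ∈ vertexSet β := by
  rcases hx with hx | ⟨n, rfl⟩
  · rw [Set.mem_singleton_iff.1 hx, betaMap_zero]
    exact zero_mem_vertexSet
  · exact Or.inr ⟨n + 1, by rw [Function.iterate_succ_apply']⟩

lemma mem_Icc_of_mem_vertexSet {x : ℝ} (hx : x ∈ vertexSet β) : x ∈ Set.Icc (0 : ℝ) 1 := by
  rcases hx with hx | ⟨n, rfl⟩
  · rw [Set.mem_singleton_iff.1 hx]
    simp
  · cases n with
    | zero => simp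
    | succ n =>
      rw [Function.iterate_succ_apply']
      exact ⟨betaMap_nonneg _, (betaMap_lt_one _).le⟩

lemma mul_floor_bounds (hβ : IsPisot β) {x : ℝ} (hx : x ∈ vertexSet β) :
    |((⌊β * x⌋ : ℤ) : ℝ)| ≤ β := by
  have h := mem_Icc_of_mem_vertexSet hx
  have h0 : 0 ≤ β * x := mul_nonneg hβ.pos.le h.1
  have h1 : (0 : ℝ) ≤ (⌊β * x⌋ : ℤ) := by exact_mod_cast Int.floor_nonneg.2 h0
  rw [abs_of_nonneg h1]
  exact (Int.floor_le _).trans (by nlinarith [h.2, hβ.pos])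

lemma exists_bddConj_vertexSet (hβ : IsPisot β) :
    ∃ C, 0 ≤ C ∧ ∀ x ∈ vertexSet β, BddConj β C x := by
  obtain ⟨ρ, hρ0, hρ1, hρ⟩ := exists_conjugate_bound hβ
  have hpos := hβ.pos
  have h1ρ : 0 < 1 - ρ := by linarith
  set C := (β + 1) / (1 - ρ) with hCdef
  have hC : (1 - ρ) * C = β + 1 := by rw [hCdef]; field_simp
  have hC0 : 0 ≤ C := by positivity
  have hC1 : 1 ≤ C := by nlinarith
  refine ⟨C, hC0, ?_⟩
  rintro x (hx | ⟨n, rfl⟩)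
  · rw [Set.mem_singleton_iff.1 hx]
    have := bddConj_intCast (β := β) 0
    simp only [Int.cast_zero, abs_zero] at this
    exact this.mono hC0
  · induction n with
    | zero =>
      have := bddConj_intCast (β := β) 1
      simp only [Int.cast_one, abs_one] at this
      exact this.mono hC1
    | succ n ih =>
      rw [Function.iterate_succ_apply']
      refine ((ih.mul_left hρ0 hρ).sub (bddConj_intCast _)).mono ?_
      have := mul_floor_bounds hβ (x := (betaMap β)^[n] 1) (Or.inr ⟨n, rfl⟩)
      nlinarith

lemma finite_vertexSet (hβ : IsPisot β) : (vertexSet β).Finite := by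
  obtain ⟨C, -, hC⟩ := exists_bddConj_vertexSet hβ
  refine (finite_bddConj hβ 1 C).subset fun x hx => ⟨?_, hC x hx⟩
  have := mem_Icc_of_mem_vertexSet hx
  rw [abs_of_nonneg this.1]
  exact this.2

lemma two_le_ncard_vertexSet (hβ : IsPisot β) : 2 ≤ (vertexSet β).ncard := by
  rw [← Set.ncard_pair (zero_ne_one (α := ℝ))]
  refine Set.ncard_le_ncard ?_ (finite_vertexSet hβ)
  rintro x (rfl | rfl)
  · exact zero_mem_vertexSet
  · exact one_mem_vertexSet

lemma numTiles_pos (hβ : IsPisot β) : 0 < numTiles β := by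
  have := two_le_ncard_vertexSet hβ
  unfold numTiles
  omega

lemma ncard_vertexSet (hβ : IsPisot β) : (vertexSet β).ncard = numTiles β + 1 := by
  have := two_le_ncard_vertexSet hβ
  unfold numTiles
  omega

/-- `vtx β` enumerates the vertices in increasing order. -/
lemma vtx_spec (hβ : IsPisot β) :
    (∀ i j, i < j → j ≤ numTiles β → vtx β i < vtx β j) ∧
      (∀ x, x ∈ vertexSet β ↔ ∃ j ≤ numTiles β, vtx β j = x) := by
  classical
  have hfin := finite_vertexSet hβ
  set S := hfin.toFinset with hS
  have hcard : S.card = numTiles β + 1 := by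
    rw [← ncard_vertexSet hβ, Set.ncard_eq_toFinset_card _ hfin]
  set e := S.orderEmbOfFin hcard with he
  have hmem : ∀ j, e j ∈ vertexSet β := fun j => by
    have := S.orderEmbOfFin_mem hcard j
    exact hfin.mem_toFinset.1 this
  have hsurj : ∀ x ∈ vertexSet β, ∃ j, e j = x := fun x hx => by
    have h1 : Set.range e = S := S.range_orderEmbOfFin hcard
    have : x ∈ Set.range e := by rw [h1]; simpa [hS] using hx
    exact this
  have hcount : ∀ j, (vertexSet β ∩ Set.Iio (e j)).ncard = (j : ℕ) := fun j => by
    have : vertexSet β ∩ Set.Iio (e j) = e '' (Set.Iio j) := by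
      ext x
      constructor
      · rintro ⟨hx, hlt⟩
        obtain ⟨i, rfl⟩ := hsurj x hx
        exact ⟨i, e.lt_iff_lt.1 hlt, rfl⟩
      · rintro ⟨i, hi, rfl⟩
        exact ⟨hmem i, e.lt_iff_lt.2 hi⟩
    rw [this, Set.ncard_image_of_injective _ e.injective, Set.ncard_eq_toFinset_card']
    simp
  have hv : ∀ (j : ℕ) (hj : j < numTiles β + 1), vtx β j = e ⟨j, hj⟩ := fun j hj => by
    have : {x | x ∈ vertexSet β ∧ (vertexSet β ∩ Set.Iio x).ncard = j} = {e ⟨j, hj⟩} := by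
      ext x
      constructor
      · rintro ⟨hx, hc⟩
        obtain ⟨i, rfl⟩ := hsurj x hx
        rw [hcount] at hc
        exact congrArg e (Fin.ext hc)
      · rintro rfl
        exact ⟨hmem _, hcount _⟩
    rw [vtx, this, csInf_singleton]
  refine ⟨fun i j hij hj => ?_, fun x => ⟨fun hx => ?_, ?_⟩⟩
  · rw [hv i (by omega), hv j (by omega)]
    exact e.lt_iff_lt.2 hij
  · obtain ⟨j, rfl⟩ := hsurj x hx
    exact ⟨j, by omega, hv _ j.2⟩
  · rintro ⟨j, hj, rfl⟩
    rw [hv j (by omega)]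
    exact hmem _

lemma vtx_lt_vtx (hβ : IsPisot β) {i j : ℕ} (hij : i < j) (hj : j ≤ numTiles β) :
    vtx β i < vtx β j := (vtx_spec hβ).1 i j hij hj

lemma vtx_le_vtx (hβ : IsPisot β) {i j : ℕ} (hij : i ≤ j) (hj : j ≤ numTiles β) :
    vtx β i ≤ vtx β j := by
  rcases hij.eq_or_lt with rfl | h
  · exact le_rfl
  · exact (vtx_lt_vtx hβ h hj).le

lemma vtx_lt_vtx_iff (hβ : IsPisot β) {i j : ℕ} (hi : i ≤ numTiles β) (hj : j ≤ numTiles β) :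
    vtx β i < vtx β j ↔ i < j :=
  ⟨fun h => by
    by_contra hlt
    exact absurd (vtx_le_vtx hβ (not_lt.1 hlt) hi) (not_le.2 h), fun h => vtx_lt_vtx hβ h hj⟩

lemma vtx_mem (hβ : IsPisot β) {j : ℕ} (hj : j ≤ numTiles β) : vtx β j ∈ vertexSet β :=
  ((vtx_spec hβ).2 _).2 ⟨j, hj, rfl⟩

lemma vtx_zero (hβ : IsPisot β) : vtx β 0 = 0 := by
  obtain ⟨j, hj, h⟩ := ((vtx_spec hβ).2 0).1 zero_mem_vertexSet
  have h1 := vtx_le_vtx hβ (Nat.zero_le j) hj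
  have h2 := (mem_Icc_of_mem_vertexSet (vtx_mem hβ (Nat.zero_le _))).1
  linarith

lemma vtx_numTiles (hβ : IsPisot β) : vtx β (numTiles β) = 1 := by
  obtain ⟨j, hj, h⟩ := ((vtx_spec hβ).2 1).1 one_mem_vertexSet
  have h1 := vtx_le_vtx hβ hj le_rfl
  have h2 := (mem_Icc_of_mem_vertexSet (vtx_mem hβ le_rfl)).2
  linarith

lemma vtx_nonneg (hβ : IsPisot β) {j : ℕ} (hj : j ≤ numTiles β) : 0 ≤ vtx β j :=
  (mem_Icc_of_mem_vertexSet (vtx_mem hβ hj)).1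

lemma vtx_le_one (hβ : IsPisot β) {j : ℕ} (hj : j ≤ numTiles β) : vtx β j ≤ 1 :=
  (mem_Icc_of_mem_vertexSet (vtx_mem hβ hj)).2

lemma vtx_pos (hβ : IsPisot β) {j : ℕ} (h0 : 0 < j) (hj : j ≤ numTiles β) : 0 < vtx β j := by
  simpa [vtx_zero hβ] using vtx_lt_vtx hβ h0 hj

lemma vtx_lt_one (hβ : IsPisot β) {j : ℕ} (hj : j < numTiles β) : vtx β j < 1 := by
  simpa [vtx_numTiles hβ] using vtx_lt_vtx hβ hj le_rfl

lemma len_pos (hβ : IsPisot β) (i : Fin (numTiles β)) : 0 < len β i :=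
  sub_pos.2 (vtx_lt_vtx hβ (Nat.lt_succ_self _) i.2)

lemma len_le_one (hβ : IsPisot β) (i : Fin (numTiles β)) : len β i ≤ 1 := by
  have h1 := vtx_le_one hβ (j := (i : ℕ) + 1) i.2
  have h2 := vtx_nonneg hβ (j := (i : ℕ)) i.2.le
  unfold len
  linarith

lemma exists_len_bound (hβ : IsPisot β) :
    ∃ δ, 0 < δ ∧ δ ≤ 1 ∧ ∀ i : Fin (numTiles β), δ ≤ len β i := by
  have : Nonempty (Fin (numTiles β)) := ⟨⟨0, numTiles_pos hβ⟩⟩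
  obtain ⟨i, hi⟩ := Finite.exists_min fun i : Fin (numTiles β) => len β i
  exact ⟨len β i, len_pos hβ i, len_le_one hβ i, hi⟩

/-- The intervals between the vertices partition `[0, 1)`. -/
lemma exists_vtx_interval (hβ : IsPisot β) {x : ℝ} (h0 : 0 ≤ x) (h1 : x < 1) :
    ∃ j : Fin (numTiles β), vtx β j ≤ x ∧ x < vtx β (j + 1) := by
  classical
  have hex : ∃ j, j ≤ numTiles β ∧ x < vtx β j := ⟨_, le_rfl, by rwa [vtx_numTiles hβ]⟩
  have hspec := Nat.find_spec hex
  have hpos : Nat.find hex ≠ 0 := fun h => by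
    rw [h, vtx_zero hβ] at hspec
    linarith [hspec.2]
  obtain ⟨j, hj⟩ := Nat.exists_eq_succ_of_ne_zero hpos
  rw [hj] at hspec
  have hmin := Nat.find_min hex (m := j) (by omega)
  refine ⟨⟨j, hspec.1⟩, ?_, hspec.2⟩
  by_contra h
  exact hmin ⟨by have := hspec.1; omega, not_le.1 h⟩

/-- No translate of a vertex by an integer lies strictly between two successive vertices. -/
lemma vertex_add_int_le_or (hβ : IsPisot β) {v : ℝ} (hv : v ∈ vertexSet β) (m k : ℤ)
    (j : Fin (numTiles β)) : v + m ≤ vtx β j + k ∨ vtx β (j + 1) + k ≤ v + m := by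
  have hj0 := vtx_nonneg hβ (j := (j : ℕ)) j.2.le
  have hj1 := vtx_le_one hβ (j := (j : ℕ) + 1) j.2
  have hv01 := mem_Icc_of_mem_vertexSet hv
  rcases lt_trichotomy m k with h | h | h
  · left
    have : (m : ℝ) + 1 ≤ k := by exact_mod_cast h
    linarith [hv01.2]
  · subst h
    obtain ⟨i, hi, rfl⟩ := ((vtx_spec hβ).2 v).1 hv
    rcases le_or_gt i j with h | h
    · left
      have := vtx_le_vtx hβ h j.2.le
      linarith
    · right
      have := vtx_le_vtx hβ (show (j : ℕ) + 1 ≤ i from h) hi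
      linarith
  · right
    have : (k : ℝ) + 1 ≤ m := by exact_mod_cast h
    linarith [hv01.1]

/-! ### Half-open supports and the substitution -/

/-- The support of a tile without its terminal vertex. -/
def Tile.ico (τ : Tile β) : Set ℝ := Set.Ico τ.min τ.max

lemma Tile.mem_ico {τ : Tile β} {y : ℝ} : y ∈ τ.ico ↔ τ.min ≤ y ∧ y < τ.max := Iff.rfl

lemma Tile.mem_support {τ : Tile β} {y : ℝ} : y ∈ τ.support ↔ τ.min ≤ y ∧ y ≤ τ.max := Iff.rfl

lemma Tile.max_eq (τ : Tile β) : τ.max = τ.min + len β τ.type := by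
  unfold Tile.max Tile.min len
  ring

lemma Tile.min_lt_max (hβ : IsPisot β) (τ : Tile β) : τ.min < τ.max := by
  have := len_pos hβ τ.type
  rw [τ.max_eq]
  linarith

lemma Tile.max_le_min_add_one (hβ : IsPisot β) (τ : Tile β) : τ.max ≤ τ.min + 1 := by
  have := len_le_one hβ τ.type
  rw [τ.max_eq]
  linarith

lemma Tile.min_mem_ico (hβ : IsPisot β) (τ : Tile β) : τ.min ∈ τ.ico :=
  ⟨le_rfl, τ.min_lt_max hβ⟩

lemma Tile.shift_le_min (hβ : IsPisot β) (τ : Tile β) : τ.shift ≤ τ.min := by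
  have := vtx_nonneg hβ τ.type.2.le
  unfold Tile.min
  linarith

lemma Tile.max_le_shift_add_one (hβ : IsPisot β) (τ : Tile β) : τ.max ≤ τ.shift + 1 := by
  have := vtx_le_one hβ (j := (τ.type : ℕ) + 1) τ.type.2
  unfold Tile.max
  linarith

/-- The prototile of the first type, translated by `x`. -/
def firstTile (hβ : IsPisot β) (x : ℝ) : Tile β := ⟨⟨0, numTiles_pos hβ⟩, x⟩

lemma firstTile_min (hβ : IsPisot β) (x : ℝ) : (firstTile hβ x).min = x := by
  simp [firstTile, Tile.min, vtx_zero hβ]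

lemma eq_firstTile (hβ : IsPisot β) {τ : Tile β} (h : (τ.type : ℕ) = 0) :
    τ = firstTile hβ τ.shift := by
  ext
  · simp [firstTile, h]
  · rfl

/-- Two tiles that differ by an integer translation, up to their types, are equal or disjoint. -/
lemma eq_of_mem_ico_of_int (hβ : IsPisot β) {σ σ' : Tile β} {k : ℤ}
    (hk : σ'.shift = σ.shift + k) {y : ℝ} (h : y ∈ σ.ico) (h' : y ∈ σ'.ico) : σ = σ' := by
  obtain ⟨h1, h2⟩ := h
  obtain ⟨h1', h2'⟩ := h'
  unfold Tile.min at h1 h1'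
  unfold Tile.max at h2 h2'
  rw [hk] at h1' h2'
  have e1 : vtx β σ.type + (0 : ℤ) = vtx β σ'.type + (k : ℝ) := by
    have a := vertex_add_int_le_or hβ (vtx_mem hβ σ.type.2.le) 0 k σ'.type
    have b := vertex_add_int_le_or hβ (vtx_mem hβ σ'.type.2.le) k 0 σ.type
    push_cast at a b ⊢
    rcases a with a | a <;> rcases b with b | b <;> linarith
  have hk0 : k = 0 := by
    have a1 := vtx_lt_one hβ σ.type.2
    have a2 := vtx_nonneg hβ σ.type.2.le
    have b1 := vtx_lt_one hβ σ'.type.2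
    have b2 := vtx_nonneg hβ σ'.type.2.le
    push_cast at e1
    have c1 : (k : ℝ) < 1 := by linarith
    have c2 : (-1 : ℝ) < k := by linarith
    have c1' : k < 1 := by exact_mod_cast c1
    have c2' : -1 < k := by exact_mod_cast c2
    omega
  subst hk0
  push_cast at e1
  simp only [add_zero] at e1
  ext
  · rcases lt_trichotomy (σ.type : ℕ) σ'.type with h | h | h
    · have := vtx_lt_vtx hβ h σ'.type.2.le
      linarith
    · exact h
    · have := vtx_lt_vtx hβ h σ.type.2.le
      linarith
  · simp [hk]

/-- The translates of the prototiles by `c + ℤ` cover the line. -/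
lemma exists_int_tile (hβ : IsPisot β) (c y : ℝ) :
    ∃ (σ : Tile β) (k : ℤ), σ.shift = c + k ∧ y ∈ σ.ico := by
  obtain ⟨j, h1, h2⟩ := exists_vtx_interval hβ (Int.fract_nonneg (y - c)) (Int.fract_lt_one _)
  refine ⟨⟨j, c + ⌊y - c⌋⟩, ⌊y - c⌋, rfl, ?_, ?_⟩
  · have := Int.floor_add_fract (y - c)
    simp only [Tile.min]
    linarith
  · have := Int.floor_add_fract (y - c)
    simp only [Tile.max]
    linarith

lemma substTile_bounds {τ σ : Tile β} (h : σ ∈ substTile τ) :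
    β * τ.min ≤ σ.min ∧ σ.max ≤ β * τ.max := by
  obtain ⟨k, ⟨h1, h2⟩, h3⟩ := h
  unfold Tile.min Tile.max
  rw [h3]
  constructor <;> linarith

/-- Around any point of the inflated support of `τ` there is a tile of the substitution of `τ`. -/
lemma exists_mem_substTile (hβ : IsPisot β) {τ : Tile β} {y : ℝ} (h1 : β * τ.min ≤ y)
    (h2 : y < β * τ.max) : ∃ σ ∈ substTile τ, y ∈ σ.ico := by
  obtain ⟨σ, k, hk, hy⟩ := exists_int_tile hβ (β * τ.shift) y
  refine ⟨σ, ⟨k, ⟨?_, ?_⟩, hk⟩, hy⟩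
  · have a := vertex_add_int_le_or hβ (betaMap_mem_vertexSet (vtx_mem hβ τ.type.2.le))
      ⌊β * vtx β τ.type⌋ k σ.type
    obtain ⟨-, hy2⟩ := hy
    unfold Tile.max at hy2
    unfold Tile.min at h1
    simp only [betaMap, sub_add_cancel] at a
    rcases a with a | a
    · exact a
    · rw [hk] at hy2
      linarith
  · have a := vertex_add_int_le_or hβ
      (betaMap_mem_vertexSet (vtx_mem hβ (j := (τ.type : ℕ) + 1) τ.type.2))
      ⌊β * vtx β (τ.type + 1)⌋ k σ.type
    obtain ⟨hy1, -⟩ := hy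
    unfold Tile.min at hy1
    unfold Tile.max at h2
    simp only [betaMap, sub_add_cancel] at a
    rcases a with a | a
    · rw [hk] at hy1
      linarith
    · exact a

/-- The half-open supports of distinct tiles of the collection are disjoint. -/
def Packed (P : Set (Tile β)) : Prop :=
  ∀ τ ∈ P, ∀ σ ∈ P, ∀ y, y ∈ τ.ico → y ∈ σ.ico → τ = σ

lemma Packed.mono {P Q : Set (Tile β)} (h : Packed Q) (hPQ : P ⊆ Q) : Packed P :=
  fun τ hτ σ hσ => h τ (hPQ hτ) σ (hPQ hσ)

lemma packed_singleton (τ : Tile β) : Packed {τ} := by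
  rintro σ rfl ρ rfl _ _ _
  rfl

lemma Packed.max_le_min (hβ : IsPisot β) {P : Set (Tile β)} (h : Packed P) {τ σ : Tile β}
    (hτ : τ ∈ P) (hσ : σ ∈ P) (hlt : τ.min < σ.min) : τ.max ≤ σ.min := by
  by_contra hc
  have := h τ hτ σ hσ σ.min ⟨hlt.le, not_le.1 hc⟩ (σ.min_mem_ico hβ)
  rw [this] at hlt
  exact lt_irrefl _ hlt

lemma packed_iff {P : Set (Tile β)} : Packed P ↔ NonOverlapping P := by
  constructor
  · intro h τ hτ σ hσ hne
    rw [Set.disjoint_left]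
    intro y h1 h2
    rw [Tile.support, interior_Icc] at h1 h2
    exact hne (h τ hτ σ hσ y ⟨h1.1.le, h1.2⟩ ⟨h2.1.le, h2.2⟩)
  · intro h τ hτ σ hσ y h1 h2
    by_contra hne
    have hd := h τ hτ σ hσ hne
    rw [Tile.support, Tile.support, interior_Icc, interior_Icc, Set.disjoint_left] at hd
    obtain ⟨z, hz1, hz2⟩ := exists_between (lt_min h1.2 h2.2)
    exact hd ⟨h1.1.trans_lt hz1, hz2.trans_le (min_le_left _ _)⟩
      ⟨h2.1.trans_lt hz1, hz2.trans_le (min_le_right _ _)⟩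

lemma mem_subst {P : Set (Tile β)} {σ : Tile β} : σ ∈ subst P ↔ ∃ τ ∈ P, σ ∈ substTile τ := by
  simp [subst]

lemma subst_singleton (τ : Tile β) : subst {τ} = substTile τ := by simp [subst]

lemma subst_mono {P Q : Set (Tile β)} (h : P ⊆ Q) : subst P ⊆ subst Q :=
  Set.biUnion_subset_biUnion_left h

lemma iterate_subst_mono (n : ℕ) {P Q : Set (Tile β)} (h : P ⊆ Q) :
    subst^[n] P ⊆ subst^[n] Q := by
  induction n with
  | zero => exact h
  | succ n ih =>
    rw [Function.iterate_succ_apply', Function.iterate_succ_apply']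
    exact subst_mono ih

lemma mem_iterate_subst {n : ℕ} {P : Set (Tile β)} {σ : Tile β} :
    σ ∈ subst^[n] P ↔ ∃ τ ∈ P, σ ∈ subst^[n] {τ} := by
  induction n generalizing σ with
  | zero => simp
  | succ n ih =>
    simp only [Function.iterate_succ_apply', mem_subst]
    constructor
    · rintro ⟨ρ, hρ, hσ⟩
      obtain ⟨τ, hτ, h⟩ := ih.1 hρ
      exact ⟨τ, hτ, ρ, h, hσ⟩
    · rintro ⟨τ, hτ, ρ, h, hσ⟩
      exact ⟨ρ, ih.2 ⟨τ, hτ, h⟩, hσ⟩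

lemma mem_iterate_subst_add {m n : ℕ} {P : Set (Tile β)} {σ : Tile β} :
    σ ∈ subst^[m + n] P ↔ ∃ τ ∈ subst^[n] P, σ ∈ subst^[m] {τ} := by
  rw [Function.iterate_add_apply, mem_iterate_subst]

lemma Packed.subst (hβ : IsPisot β) {P : Set (Tile β)} (h : Packed P) :
    Packed (subst P) := by
  intro σ hσ σ' hσ' y hy hy'
  obtain ⟨τ, hτ, hστ⟩ := mem_subst.1 hσ
  obtain ⟨τ', hτ', hστ'⟩ := mem_subst.1 hσ'
  have b := substTile_bounds hστ
  have b' := substTile_bounds hστ'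
  have hpos := hβ.pos
  have e : τ = τ' := by
    refine h τ hτ τ' hτ' (y / β) ⟨?_, ?_⟩ ⟨?_, ?_⟩
    · rw [le_div_iff₀ hpos]; linarith [hy.1]
    · rw [div_lt_iff₀ hpos]; linarith [hy.2]
    · rw [le_div_iff₀ hpos]; linarith [hy'.1]
    · rw [div_lt_iff₀ hpos]; linarith [hy'.2]
  subst e
  obtain ⟨k, -, hk⟩ := hστ
  obtain ⟨k', -, hk'⟩ := hστ'
  refine eq_of_mem_ico_of_int hβ (k := k' - k) ?_ hy hy'
  push_cast
  rw [hk, hk']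
  ring

lemma Packed.iterate_subst (hβ : IsPisot β) {P : Set (Tile β)} (h : Packed P) (n : ℕ) :
    Packed (BetaTiling.subst^[n] P) := by
  induction n with
  | zero => exact h
  | succ n ih =>
    rw [Function.iterate_succ_apply']
    exact ih.subst hβ

lemma iterate_subst_bounds (hβ : IsPisot β) {n : ℕ} {τ σ : Tile β} (h : σ ∈ subst^[n] {τ}) :
    β ^ n * τ.min ≤ σ.min ∧ σ.max ≤ β ^ n * τ.max := by
  induction n generalizing σ with
  | zero =>
    rw [Function.iterate_zero, id, Set.mem_singleton_iff] at h
    simp [h]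
  | succ n ih =>
    rw [Function.iterate_succ_apply', mem_subst] at h
    obtain ⟨ρ, hρ, hσ⟩ := h
    obtain ⟨h1, h2⟩ := ih hρ
    obtain ⟨h3, h4⟩ := substTile_bounds hσ
    have hpos := hβ.pos
    rw [pow_succ', mul_assoc, mul_assoc]
    exact ⟨(mul_le_mul_of_nonneg_left h1 hpos.le).trans h3,
      h4.trans (mul_le_mul_of_nonneg_left h2 hpos.le)⟩

lemma exists_mem_iterate_subst (hβ : IsPisot β) {n : ℕ} {τ : Tile β} {y : ℝ}
    (h1 : β ^ n * τ.min ≤ y) (h2 : y < β ^ n * τ.max) : ∃ σ ∈ subst^[n] {τ}, y ∈ σ.ico := by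
  induction n generalizing y with
  | zero => exact ⟨τ, rfl, by simpa using h1, by simpa using h2⟩
  | succ n ih =>
    have hpos := hβ.pos
    rw [pow_succ', mul_assoc] at h1 h2
    obtain ⟨ρ, hρ, h3, h4⟩ := ih (y := y / β) (by rw [le_div_iff₀ hpos]; linarith)
      (by rw [div_lt_iff₀ hpos]; linarith)
    rw [le_div_iff₀ hpos, mul_comm] at h3
    rw [div_lt_iff₀ hpos, mul_comm] at h4
    obtain ⟨σ, hσ, hy⟩ := exists_mem_substTile hβ h3 h4
    refine ⟨σ, ?_, hy⟩
    rw [Function.iterate_succ_apply', mem_subst]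
    exact ⟨ρ, hρ, hσ⟩

/-! ### Translations -/

lemma mem_translate {T : Set (Tile β)} {t : ℝ} {τ : Tile β} :
    τ ∈ translate T t ↔ (⟨τ.type, τ.shift + t⟩ : Tile β) ∈ T := by
  constructor
  · rintro ⟨σ, hσ, rfl⟩
    simpa using hσ
  · intro h
    exact ⟨_, h, by simp⟩

lemma translate_zero (T : Set (Tile β)) : translate T 0 = T := by
  ext τ
  simp [mem_translate]

lemma translate_translate (T : Set (Tile β)) (s t : ℝ) :
    translate (translate T s) t = translate T (t + s) := by
  ext τ
  simp [mem_translate, add_assoc]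

lemma translate_mono {T T' : Set (Tile β)} (h : T ⊆ T') (t : ℝ) :
    translate T t ⊆ translate T' t := Set.image_mono h

lemma mem_substTile_add {τ σ : Tile β} {t : ℝ} :
    σ ∈ substTile ⟨τ.type, τ.shift + t⟩ ↔ (⟨σ.type, σ.shift - β * t⟩ : Tile β) ∈ substTile τ := by
  constructor
  · rintro ⟨k, hk, h⟩
    exact ⟨k, hk, by simp only at h ⊢; rw [h]; ring⟩
  · rintro ⟨k, hk, h⟩
    exact ⟨k, hk, by simp only at h ⊢; linarith⟩

lemma subst_translate (T : Set (Tile β)) (t : ℝ) :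
    subst (translate T t) = translate (subst T) (β * t) := by
  ext σ
  rw [mem_translate, mem_subst, mem_subst]
  constructor
  · rintro ⟨τ, hτ, hσ⟩
    rw [mem_translate] at hτ
    refine ⟨_, hτ, ?_⟩
    rw [mem_substTile_add]
    simpa using hσ
  · rintro ⟨τ, hτ, hσ⟩
    refine ⟨⟨τ.type, τ.shift - t⟩, ?_, ?_⟩
    · rw [mem_translate]
      simpa using hτ
    · have := mem_substTile_add (τ := τ) (σ := σ) (t := -t)
      rw [← sub_eq_add_neg] at this
      rw [this]
      simpa using hσ

lemma iterate_subst_translate (T : Set (Tile β)) (t : ℝ) (n : ℕ) :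
    subst^[n] (translate T t) = translate (subst^[n] T) (β ^ n * t) := by
  induction n with
  | zero => simp
  | succ n ih =>
    rw [Function.iterate_succ_apply', Function.iterate_succ_apply', ih, subst_translate, pow_succ',
      mul_assoc]

lemma mem_iterate_subst_shift {n : ℕ} {i : Fin (numTiles β)} {x t : ℝ} {σ : Tile β}
    (h : σ ∈ subst^[n] {(⟨i, x⟩ : Tile β)}) :
    (⟨σ.type, σ.shift + β ^ n * t⟩ : Tile β) ∈ subst^[n] {(⟨i, x + t⟩ : Tile β)} := by
  have : ({⟨i, x + t⟩} : Set (Tile β)) = translate {⟨i, x⟩} (-t) := by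
    simp [translate]
  rw [this, iterate_subst_translate, mem_translate]
  simpa using h

/-- The shifts of the tiles of `Ψ^n(τ)` differ from `β ^ n` times that of `τ` by elements of `ℤ[β]`
with uniformly bounded conjugates. -/
lemma exists_bddConj_shift (hβ : IsPisot β) : ∃ C, 0 ≤ C ∧ ∀ (n : ℕ) (τ σ : Tile β),
    σ ∈ subst^[n] {τ} → BddConj β C (σ.shift - β ^ n * τ.shift) := by
  obtain ⟨ρ, hρ0, hρ1, hρ⟩ := exists_conjugate_bound hβ
  have hpos := hβ.pos
  have h1ρ : 0 < 1 - ρ := by linarith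
  set C := (β + 1) / (1 - ρ) with hCdef
  have hC : (1 - ρ) * C = β + 1 := by rw [hCdef]; field_simp
  have hC0 : 0 ≤ C := by positivity
  refine ⟨C, hC0, fun n => ?_⟩
  induction n with
  | zero =>
    intro τ σ h
    rw [Function.iterate_zero, id, Set.mem_singleton_iff] at h
    have := bddConj_intCast (β := β) 0
    simp only [Int.cast_zero, abs_zero] at this
    simpa [h] using this.mono hC0
  | succ n ih =>
    intro τ σ h
    rw [Function.iterate_succ_apply', mem_subst] at h
    obtain ⟨π, hπ, k, ⟨hk1, hk2⟩, hk⟩ := h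
    have e : σ.shift - β ^ (n + 1) * τ.shift = β * (π.shift - β ^ n * τ.shift) + k := by
      rw [hk]; ring
    rw [e]
    refine (((ih τ π hπ).mul_left hρ0 hρ).add (bddConj_intCast k)).mono ?_
    have a1 := vtx_nonneg hβ (j := π.type) π.type.2.le
    have a2 := vtx_le_one hβ (j := (π.type : ℕ) + 1) π.type.2
    have b1 := vtx_nonneg hβ (j := (σ.type : ℕ) + 1) σ.type.2
    have b2 := vtx_lt_one hβ (j := (σ.type : ℕ)) σ.type.2
    have c1 : (-1 : ℝ) < k := by nlinarith
    have c1' : (0 : ℝ) ≤ k := by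
      have : -1 < k := by exact_mod_cast c1
      have : 0 ≤ k := by omega
      exact_mod_cast this
    rw [abs_of_nonneg c1']
    nlinarith

/-! ### Runs of tiles -/

/-- A tile that is not of the first type is preceded by the tile of the previous type and with the
same shift. -/
def HasRuns (P : Set (Tile β)) : Prop :=
  ∀ σ ∈ P, ∀ σ' ∈ P, σ.max = σ'.min → (σ'.type : ℕ) ≠ 0 →
    σ'.shift = σ.shift ∧ (σ'.type : ℕ) = σ.type + 1

lemma HasRuns.mono {P Q : Set (Tile β)} (h : HasRuns Q) (hPQ : P ⊆ Q) : HasRuns P :=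
  fun τ hτ σ hσ => h τ (hPQ hτ) σ (hPQ hσ)

lemma run_of_int (hβ : IsPisot β) {σ σ' : Tile β} {k : ℤ} (hk : σ'.shift = σ.shift + k)
    (h : σ.max = σ'.min) (h0 : (σ'.type : ℕ) ≠ 0) :
    σ'.shift = σ.shift ∧ (σ'.type : ℕ) = σ.type + 1 := by
  unfold Tile.max Tile.min at h
  rw [hk] at h
  have a1 := vtx_pos hβ (Nat.succ_pos (σ.type : ℕ)) σ.type.2
  have a2 := vtx_le_one hβ (j := (σ.type : ℕ) + 1) σ.type.2
  have b1 := vtx_pos hβ (Nat.pos_of_ne_zero h0) σ'.type.2.le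
  have b2 := vtx_lt_one hβ (j := (σ'.type : ℕ)) σ'.type.2
  simp only [Nat.succ_eq_add_one] at a1
  have c1 : (k : ℝ) < 1 := by linarith
  have c2 : (-1 : ℝ) < k := by linarith
  have hk0 : k = 0 := by
    have c1' : k < 1 := by exact_mod_cast c1
    have c2' : -1 < k := by exact_mod_cast c2
    omega
  subst hk0
  refine ⟨by simp [hk], ?_⟩
  push_cast at h
  have hv : vtx β (σ'.type) = vtx β (σ.type + 1) := by linarith
  rcases lt_trichotomy (σ'.type : ℕ) (σ.type + 1) with h | h | h
  · have := vtx_lt_vtx hβ h σ.type.2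
    linarith
  · exact h
  · have := vtx_lt_vtx hβ h σ'.type.2.le
    linarith

lemma HasRuns.subst (hβ : IsPisot β) {P : Set (Tile β)} (hP : Packed P) (h : HasRuns P) :
    HasRuns (subst P) := by
  intro σ hσ σ' hσ' hadj h0
  obtain ⟨τ, hτ, hστ⟩ := mem_subst.1 hσ
  obtain ⟨τ', hτ', hστ'⟩ := mem_subst.1 hσ'
  have b := substTile_bounds hστ
  have b' := substTile_bounds hστ'
  have hpos := hβ.pos
  have m := σ.min_lt_max hβ
  have m' := σ'.min_lt_max hβ
  obtain ⟨k, hkk, hk⟩ := hστ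
  obtain ⟨k', hkk', hk'⟩ := hστ'
  have key : τ'.shift = τ.shift → σ'.shift = σ.shift ∧ (σ'.type : ℕ) = σ.type + 1 := fun e =>
    run_of_int hβ (k := k' - k) (by push_cast; rw [hk, hk', e]; ring) hadj h0
  have hlt : β * τ.min < β * τ'.max := by linarith
  have hlt' : τ.min < τ'.max := lt_of_mul_lt_mul_left hlt hpos.le
  rcases lt_trichotomy τ.min τ'.min with hc | hc | hc
  · have h1 := hP.max_le_min hβ hτ hτ' hc
    have h2 : β * τ.max ≤ β * τ'.min := mul_le_mul_of_nonneg_left h1 hpos.le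
    have h3 : τ.max = τ'.min := by
      refine le_antisymm h1 (le_of_mul_le_mul_left ?_ hpos)
      linarith
    by_cases ht : (τ'.type : ℕ) = 0
    · -- the first child of a tile of the first type is of the first type
      exfalso
      have e1 : σ'.min = β * τ'.min := by linarith
      unfold Tile.min at e1
      rw [hk', ht, vtx_zero hβ] at e1
      have e2 : vtx β σ'.type = -(k' : ℝ) := by linarith
      have c1 := vtx_pos hβ (Nat.pos_of_ne_zero h0) σ'.type.2.le
      have c2 := vtx_lt_one hβ σ'.type.2
      rw [e2] at c1 c2
      have c1' : 0 < -k' := by exact_mod_cast c1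
      have c2' : -k' < 1 := by exact_mod_cast c2
      omega
    · exact key (h τ hτ τ' hτ' h3 ht).1
  · have := hP τ hτ τ' hτ' τ.min (τ.min_mem_ico hβ) (by rw [hc]; exact τ'.min_mem_ico hβ)
    exact key (by rw [this])
  · exact absurd (hP.max_le_min hβ hτ' hτ hc) (not_le.2 hlt')

lemma hasRuns_iterate_subst (hβ : IsPisot β) (τ : Tile β) (n : ℕ) : HasRuns (subst^[n] {τ}) := by
  induction n with
  | zero =>
    rintro σ rfl σ' rfl h
    exact absurd h (Tile.min_lt_max hβ _).ne'
  | succ n ih =>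
    rw [Function.iterate_succ_apply']
    exact ih.subst hβ ((packed_singleton τ).iterate_subst hβ n)

/-- In a collection of tiles that covers `[a, σ.min)`, the tile `σ` has a predecessor. -/
lemma exists_pred (hβ : IsPisot β) {P : Set (Tile β)} (hP : Packed P) {σ : Tile β} (hσ : σ ∈ P)
    {a : ℝ} (ha : a < σ.min) (hcov : ∀ y, a ≤ y → y < σ.min → ∃ ρ ∈ P, y ∈ ρ.ico) :
    ∃ ρ ∈ P, ρ.max = σ.min := by
  obtain ⟨δ, hδ0, -, hδ⟩ := exists_len_bound hβ
  have hle : ∀ ρ ∈ P, ∀ y, y < σ.min → y ∈ ρ.ico → ρ.max ≤ σ.min := fun ρ hρ y hy hyρ =>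
    hP.max_le_min hβ hρ hσ (hyρ.1.trans_lt hy)
  obtain ⟨ρ, hρ, hy⟩ := hcov (max a (σ.min - δ)) (le_max_left _ _)
    (max_lt ha (by linarith))
  have h1 := hle ρ hρ _ (max_lt ha (by linarith)) hy
  rcases h1.eq_or_lt with h1 | h1
  · exact ⟨ρ, hρ, h1⟩
  · have h2 : a ≤ ρ.max := (le_max_left _ _).trans hy.2.le
    obtain ⟨ρ', hρ', hy'⟩ := hcov ρ.max h2 h1
    have h3 := hle ρ' hρ' _ h1 hy'
    have h4 : ρ.max ≤ ρ'.min := by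
      rcases lt_trichotomy ρ.min ρ'.min with hc | hc | hc
      · exact hP.max_le_min hβ hρ hρ' hc
      · have := hP ρ hρ ρ' hρ' ρ.min (ρ.min_mem_ico hβ) (by rw [hc]; exact ρ'.min_mem_ico hβ)
        rw [← this] at hy'
        exact absurd hy'.2 (lt_irrefl _)
      · have := hP.max_le_min hβ hρ' hρ hc
        exact absurd hy'.2 (not_lt.2 (this.trans (ρ.min_lt_max hβ).le))
    have h5 := hδ ρ'.type
    rw [ρ'.max_eq] at h3
    have h6 : σ.min - δ ≤ max a (σ.min - δ) := le_max_right _ _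
    linarith [hy.2]

/-- All the tiles of a run are in the collection, to the left of a tile that is. -/
lemma run_left (hβ : IsPisot β) {P : Set (Tile β)} (hP : Packed P) (hr : HasRuns P) {σ : Tile β}
    (hσ : σ ∈ P) {a : ℝ} (ha : a ≤ σ.shift)
    (hcov : ∀ y, a ≤ y → y < σ.min → ∃ ρ ∈ P, y ∈ ρ.ico) (i : Fin (numTiles β))
    (hi : (i : ℕ) ≤ σ.type) : (⟨i, σ.shift⟩ : Tile β) ∈ P := by
  suffices h : ∀ d : ℕ, ∀ i : Fin (numTiles β), (i : ℕ) + d = σ.type →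
      (⟨i, σ.shift⟩ : Tile β) ∈ P from h (σ.type - i) i (by omega)
  intro d
  induction d with
  | zero =>
    intro i hi
    have : i = σ.type := Fin.ext (by simpa using hi)
    rw [this]
    exact hσ
  | succ d ih =>
    intro i hi
    have hlt : (i : ℕ) + 1 < numTiles β := by have := σ.type.2; omega
    have hmem := ih ⟨i + 1, hlt⟩ (by simp only; omega)
    set σ' : Tile β := ⟨⟨i + 1, hlt⟩, σ.shift⟩ with hσ'
    have h1 : a < σ'.min := by
      have := vtx_pos hβ (Nat.succ_pos (i : ℕ)) hlt.le
      simp only [Nat.succ_eq_add_one] at this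
      simp only [hσ', Tile.min]
      linarith
    have h2 : σ'.min ≤ σ.min := by
      have := vtx_le_vtx hβ (show (i : ℕ) + 1 ≤ σ.type by omega) σ.type.2.le
      simp only [hσ', Tile.min]
      linarith
    obtain ⟨ρ, hρ, hmax⟩ := exists_pred hβ hP hmem h1 fun y hy hy' => hcov y hy (hy'.trans_le h2)
    obtain ⟨e1, e2⟩ := hr ρ hρ σ' hmem hmax (by simp [hσ'])
    have : ρ = ⟨i, σ.shift⟩ := by
      ext
      · simp only [hσ'] at e2
        simp only
        omega
      · exact e1.symm
    rwa [← this]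

/-! ### Primitivity -/

lemma exists_pow_gt (hβ : IsPisot β) (B : ℝ) : ∃ n₀ : ℕ, ∀ n ≥ n₀, B < β ^ n :=
  Filter.eventually_atTop.1 ((tendsto_pow_atTop_atTop_of_one_lt hβ.one_lt).eventually_gt_atTop B)

lemma firstTile_mem_subst (hβ : IsPisot β) (x : ℝ) (n : ℕ) :
    firstTile hβ (β ^ n * x) ∈ subst^[n] {firstTile hβ x} := by
  induction n with
  | zero => simp
  | succ n ih =>
    rw [Function.iterate_succ_apply', mem_subst]
    refine ⟨_, ih, 0, ⟨?_, ?_⟩, ?_⟩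
    · simp [firstTile, vtx_zero hβ]
    · have := vtx_pos hβ Nat.one_pos (numTiles_pos hβ)
      have := hβ.one_lt
      simp only [firstTile, zero_add, Int.cast_zero, add_zero]
      nlinarith
    · simp only [firstTile, Int.cast_zero, add_zero]
      ring

/-- The iterates of the substitution on any tile eventually contain tiles of the first type. -/
lemma exists_firstTile_mem (hβ : IsPisot β) :
    ∃ n₀ : ℕ, ∀ n ≥ n₀, ∀ τ : Tile β, ∃ y, firstTile hβ y ∈ subst^[n] {τ} := by
  obtain ⟨δ, hδ0, -, hδ⟩ := exists_len_bound hβ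
  obtain ⟨n₀, hn₀⟩ := exists_pow_gt hβ (1 / δ)
  refine ⟨n₀, fun n hn τ => ?_⟩
  have h1 := hn₀ n hn
  rw [div_lt_iff₀ hδ0] at h1
  have h2 : 1 < β ^ n * len β τ.type :=
    h1.trans_le (mul_le_mul_of_nonneg_left (hδ _) (pow_pos hβ.pos n).le)
  have h3 : β ^ n * τ.max = β ^ n * τ.min + β ^ n * len β τ.type := by rw [τ.max_eq]; ring
  obtain ⟨σ, hσ, hy⟩ := exists_mem_iterate_subst hβ (n := n) (τ := τ) (y := β ^ n * τ.min + 1)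
    (by linarith) (by linarith)
  refine ⟨σ.shift, run_left hβ ((packed_singleton τ).iterate_subst hβ n)
    (hasRuns_iterate_subst hβ τ n) hσ (a := β ^ n * τ.min) ?_ ?_ _ (Nat.zero_le _)⟩
  · have := hy.2
    have := σ.max_le_shift_add_one hβ
    linarith
  · intro y hy1 hy2
    have := (iterate_subst_bounds hβ hσ).2
    exact exists_mem_iterate_subst hβ hy1 (hy2.trans_le ((σ.min_lt_max hβ).le.trans this))

lemma shift_eq_zero_of_min_lt_one (hβ : IsPisot β) {n : ℕ} {σ : Tile β}
    (hσ : σ ∈ subst^[n] {firstTile hβ 0}) (h : σ.min < 1) : σ.shift = 0 := by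
  induction n generalizing σ with
  | zero =>
    rw [Function.iterate_zero, id, Set.mem_singleton_iff] at hσ
    rw [hσ]
    rfl
  | succ n ih =>
    have h0 := (iterate_subst_bounds hβ hσ).1
    rw [firstTile_min, mul_zero] at h0
    rw [Function.iterate_succ_apply', mem_subst] at hσ
    obtain ⟨τ, hτ, hσ⟩ := hσ
    have h1 := (substTile_bounds hσ).1
    have hτ1 : τ.min < 1 := by
      by_contra hc
      nlinarith [hβ.one_lt, not_lt.1 hc]
    have hs := ih hτ hτ1
    obtain ⟨k, -, hk⟩ := hσ
    rw [hs, mul_zero, zero_add] at hk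
    have a1 := vtx_nonneg hβ σ.type.2.le
    have a2 := vtx_lt_one hβ σ.type.2
    unfold Tile.min at h h0
    rw [hk] at h h0
    have c1 : (k : ℝ) < 1 := by linarith
    have c2 : (-1 : ℝ) < k := by linarith
    have c1' : k < 1 := by exact_mod_cast c1
    have c2' : -1 < k := by exact_mod_cast c2
    have : k = 0 := by omega
    simp [hk, this]

/-- The iterates of the substitution on the first prototile eventually contain all prototiles. -/
lemma exists_prototile_mem (hβ : IsPisot β) :
    ∃ n₀ : ℕ, ∀ n ≥ n₀, ∀ j : Fin (numTiles β),
      (⟨j, 0⟩ : Tile β) ∈ subst^[n] {firstTile hβ 0} := by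
  have hs := vtx_pos hβ Nat.one_pos (numTiles_pos hβ)
  obtain ⟨n₀, hn₀⟩ := exists_pow_gt hβ (1 / vtx β 1)
  refine ⟨n₀, fun n hn j => ?_⟩
  have h1 := hn₀ n hn
  rw [div_lt_iff₀ hs] at h1
  have hj0 := vtx_nonneg hβ j.2.le
  have hj1 := vtx_lt_one hβ j.2
  obtain ⟨σ, hσ, hy⟩ := exists_mem_iterate_subst hβ (n := n) (τ := firstTile hβ 0) (y := vtx β j)
    (by rw [firstTile_min]; simpa using hj0)
    (by simp only [firstTile, Tile.max, zero_add, add_zero]; linarith)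
  have hz := shift_eq_zero_of_min_lt_one hβ hσ (hy.1.trans_lt hj1)
  have : σ = ⟨j, 0⟩ := eq_of_mem_ico_of_int hβ (k := 0) (by simp [hz]) hy
    (by simpa [Tile.min] using Tile.min_mem_ico hβ (⟨j, 0⟩ : Tile β))
  rwa [← this]

/-- The substitution is primitive. -/
lemma exists_primitive (hβ : IsPisot β) :
    ∃ n₀ : ℕ, ∀ n ≥ n₀, ∀ (τ : Tile β) (j : Fin (numTiles β)),
      ∃ y, (⟨j, y⟩ : Tile β) ∈ subst^[n] {τ} := by
  obtain ⟨n₁, hn₁⟩ := exists_firstTile_mem hβ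
  obtain ⟨n₂, hn₂⟩ := exists_prototile_mem hβ
  refine ⟨n₂ + n₁, fun n hn τ j => ?_⟩
  obtain ⟨m, rfl⟩ := Nat.exists_eq_add_of_le (show n₂ ≤ n by omega)
  obtain ⟨y, hy⟩ := hn₁ m (by omega) τ
  refine ⟨0 + β ^ n₂ * y, mem_iterate_subst_add.2 ⟨_, hy, ?_⟩⟩
  have := mem_iterate_subst_shift (t := y) (hn₂ n₂ le_rfl j)
  simpa [firstTile] using this

/-! ### Tilings of the line -/

/-- The half-open supports of the tiles of `P` cover `[a, b)`. -/
def Covers (P : Set (Tile β)) (a b : ℝ) : Prop :=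
  ∀ y, a ≤ y → y < b → ∃ ρ ∈ P, y ∈ ρ.ico

lemma Covers.mono {P Q : Set (Tile β)} {a b : ℝ} (h : Covers P a b) (hPQ : P ⊆ Q) :
    Covers Q a b := fun y h1 h2 =>
  let ⟨ρ, hρ, hy⟩ := h y h1 h2
  ⟨ρ, hPQ hρ, hy⟩

lemma Covers.subst (hβ : IsPisot β) {P : Set (Tile β)} {a b : ℝ} (h : Covers P a b) :
    Covers (subst P) (β * a) (β * b) := by
  intro y h1 h2
  have hpos := hβ.pos
  obtain ⟨ρ, hρ, h3, h4⟩ := h (y / β) (by rw [le_div_iff₀ hpos]; linarith)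
    (by rw [div_lt_iff₀ hpos]; linarith)
  rw [le_div_iff₀ hpos, mul_comm] at h3
  rw [div_lt_iff₀ hpos, mul_comm] at h4
  obtain ⟨σ, hσ, hy⟩ := exists_mem_substTile hβ h3 h4
  exact ⟨σ, mem_subst.2 ⟨ρ, hρ, hσ⟩, hy⟩

lemma Covers.iterate_subst (hβ : IsPisot β) {P : Set (Tile β)} {a b : ℝ} (h : Covers P a b)
    (n : ℕ) : Covers (BetaTiling.subst^[n] P) (β ^ n * a) (β ^ n * b) := by
  induction n with
  | zero => simpa using h
  | succ n ih =>
    rw [Function.iterate_succ_apply', pow_succ', mul_assoc, mul_assoc]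
    exact ih.subst hβ

lemma covers_iterate_subst_singleton (hβ : IsPisot β) (τ : Tile β) (n : ℕ) :
    Covers (subst^[n] {τ}) (β ^ n * τ.min) (β ^ n * τ.max) :=
  fun _ h1 h2 => exists_mem_iterate_subst hβ h1 h2

lemma mem_ico_translate {τ : Tile β} {y t : ℝ} :
    y ∈ (⟨τ.type, τ.shift + t⟩ : Tile β).ico ↔ y - t ∈ τ.ico := by
  simp only [Tile.mem_ico, Tile.min, Tile.max]
  constructor <;> rintro ⟨h1, h2⟩ <;> constructor <;> linarith

lemma Covers.translate {P : Set (Tile β)} {a b : ℝ} (h : Covers P a b) (t : ℝ) :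
    Covers (translate P t) (a - t) (b - t) := by
  intro y h1 h2
  obtain ⟨ρ, hρ, hy⟩ := h (y + t) (by linarith) (by linarith)
  refine ⟨⟨ρ.type, ρ.shift - t⟩, ⟨ρ, hρ, rfl⟩, ?_⟩
  rw [sub_eq_add_neg, mem_ico_translate]
  simpa using hy

lemma Packed.translate {P : Set (Tile β)} (h : Packed P) (t : ℝ) : Packed (translate P t) := by
  rintro _ ⟨τ, hτ, rfl⟩ _ ⟨σ, hσ, rfl⟩ y h1 h2
  simp only [sub_eq_add_neg, mem_ico_translate] at h1 h2
  rw [h τ hτ σ hσ _ h1 h2]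

lemma floor_min_injOn (hβ : IsPisot β) {P : Set (Tile β)} (hP : Packed P) {δ : ℝ} (hδ0 : 0 < δ)
    (hδ : ∀ i : Fin (numTiles β), δ ≤ len β i) : Set.InjOn (fun τ : Tile β => ⌊τ.min / δ⌋) P := by
  have key : ∀ τ ∈ P, ∀ σ ∈ P, τ.min < σ.min → ⌊τ.min / δ⌋ ≠ ⌊σ.min / δ⌋ := by
    intro τ hτ σ hσ hlt he
    have h1 := hP.max_le_min hβ hτ hσ hlt
    have h2 := hδ τ.type
    rw [τ.max_eq] at h1
    have h3 : τ.min / δ + 1 ≤ σ.min / δ := by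
      rw [le_div_iff₀ hδ0, add_mul, div_mul_cancel₀ _ hδ0.ne']
      linarith
    have h4 := Int.lt_floor_add_one (σ.min / δ)
    have h5 := Int.floor_le (τ.min / δ)
    rw [← he] at h4
    linarith
  intro τ hτ σ hσ he
  rcases lt_trichotomy τ.min σ.min with h | h | h
  · exact absurd he (key τ hτ σ hσ h)
  · exact hP τ hτ σ hσ τ.min (τ.min_mem_ico hβ) (by rw [h]; exact σ.min_mem_ico hβ)
  · exact absurd he.symm (key σ hσ τ hτ h)

/-- Packed collections of tiles are locally finite. -/
lemma Packed.finite (hβ : IsPisot β) {P : Set (Tile β)} (hP : Packed P) (a b : ℝ) :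
    {τ | τ ∈ P ∧ a ≤ τ.max ∧ τ.min ≤ b}.Finite := by
  obtain ⟨δ, hδ0, -, hδ⟩ := exists_len_bound hβ
  refine Set.Finite.of_injOn (f := fun τ : Tile β => ⌊τ.min / δ⌋)
    (t := Set.Icc ⌊(a - 1) / δ⌋ ⌊b / δ⌋) ?_
    ((floor_min_injOn hβ hP hδ0 hδ).mono fun τ h => h.1) (Set.finite_Icc _ _)
  rintro τ ⟨-, h1, h2⟩
  have h3 := τ.max_le_min_add_one hβ
  exact ⟨Int.floor_le_floor (div_le_div_of_nonneg_right (by linarith) hδ0.le),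
    Int.floor_le_floor (div_le_div_of_nonneg_right h2 hδ0.le)⟩

/-- In terms of half-open supports, a tiling is a partition of the line. -/
lemma isTiling_iff (hβ : IsPisot β) {T : Set (Tile β)} :
    IsTiling T ↔ Packed T ∧ ∀ y, ∃ ρ ∈ T, y ∈ ρ.ico := by
  constructor
  · rintro ⟨h1, h2⟩
    have hP := packed_iff.2 h1
    refine ⟨hP, fun y => ?_⟩
    -- a point that is only a terminal vertex has tiles without it accumulating from the right
    by_contra hcon
    push Not at hcon
    have hfin := hP.finite hβ y (y + 1)
    have hfin' : (insert (y + 1) (Tile.min '' {τ | (τ ∈ T ∧ y ≤ τ.max ∧ τ.min ≤ y + 1) ∧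
        y < τ.min})).Finite := ((hfin.subset fun τ h => h.1).image _).insert _
    obtain ⟨m, hm, hmin⟩ := Set.exists_min_image _ id hfin' ⟨_, Set.mem_insert _ _⟩
    have hym : y < m := by
      rcases hm with rfl | ⟨τ, hτ, rfl⟩
      · linarith
      · exact hτ.2
    have hm1 : m ≤ y + 1 := hmin _ (Set.mem_insert _ _)
    obtain ⟨z, hz1, hz2⟩ := exists_between hym
    have hz : z ∈ ⋃ τ ∈ T, τ.support := by rw [h2]; trivial
    simp only [Set.mem_iUnion] at hz
    obtain ⟨τ, hτ, hzτ⟩ := hz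
    have h3 : τ.min ≤ y := by
      by_contra hlt
      have := hmin τ.min (Set.mem_insert_of_mem _
        ⟨τ, ⟨⟨hτ, hz1.le.trans hzτ.2, by linarith [hzτ.1]⟩, not_le.1 hlt⟩, rfl⟩)
      simp only [id] at this
      linarith [hzτ.1]
    exact hcon τ hτ ⟨h3, hz1.trans_le hzτ.2⟩
  · rintro ⟨h1, h2⟩
    refine ⟨packed_iff.1 h1, Set.eq_univ_of_forall fun y => ?_⟩
    obtain ⟨ρ, hρ, hy⟩ := h2 y
    exact Set.mem_biUnion hρ ⟨hy.1, hy.2.le⟩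

lemma IsTiling.packed {T : Set (Tile β)} (h : IsTiling T) : Packed T :=
  packed_iff.2 h.1

lemma IsTiling.exists_mem (hβ : IsPisot β) {T : Set (Tile β)} (h : IsTiling T) (y : ℝ) :
    ∃ ρ ∈ T, y ∈ ρ.ico := ((isTiling_iff hβ).1 h).2 y

lemma IsTiling.covers (hβ : IsPisot β) {T : Set (Tile β)} (h : IsTiling T) (a b : ℝ) :
    Covers T a b := fun y _ _ => h.exists_mem hβ y

lemma IsTiling.eq_of_subset (hβ : IsPisot β) {T T' : Set (Tile β)} (h : IsTiling T)
    (h' : IsTiling T') (hsub : T ⊆ T') : T = T' := by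
  refine hsub.antisymm fun τ hτ => ?_
  obtain ⟨ρ, hρ, hy⟩ := h.exists_mem hβ τ.min
  rwa [← h'.packed ρ (hsub hρ) τ hτ _ hy (τ.min_mem_ico hβ)]

/-- A collection of tiles of a packed collection contains all the tiles in the region it covers. -/
lemma centralPatch_subset_of_covers (hβ : IsPisot β) {T Q : Set (Tile β)} (hT : Packed T)
    (hQ : Q ⊆ T) {R R' : ℝ} (hR : R < R') (hcov : Covers Q (-R') R') :
    centralPatch R T ⊆ Q := by
  rintro τ ⟨hτ, y, hy1, hy2⟩
  have hlt := τ.min_lt_max hβ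
  obtain ⟨z, hz, hz1, hz2⟩ : ∃ z ∈ τ.ico, -R' ≤ z ∧ z < R' := by
    refine ⟨max τ.min (-R'), ⟨le_max_left _ _, max_lt hlt ?_⟩, le_max_right _ _, max_lt ?_ ?_⟩
    · linarith [hy1.2, hy2.1]
    · linarith [hy1.1, hy2.2]
    · linarith [hy2.1, hy2.2]
  obtain ⟨ρ, hρ, hzρ⟩ := hcov z hz1 hz2
  rwa [← hT ρ (hQ hρ) τ hτ z hzρ hz]

lemma centralPatch_eq_of_covers (hβ : IsPisot β) {T T' Q : Set (Tile β)} (hT : Packed T)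
    (hT' : Packed T') (hQ : Q ⊆ T) (hQ' : Q ⊆ T') {R R' : ℝ} (hR : R < R')
    (hcov : Covers Q (-R') R') : centralPatch R T = centralPatch R T' := by
  ext τ
  constructor
  · intro h
    exact ⟨hQ' (centralPatch_subset_of_covers hβ hT hQ hR hcov h), h.2⟩
  · intro h
    exact ⟨hQ (centralPatch_subset_of_covers hβ hT' hQ' hR hcov h), h.2⟩

lemma centralPatch_subset (R : ℝ) (T : Set (Tile β)) : centralPatch R T ⊆ T := fun _ h => h.1

lemma mem_centralPatch_of_mem_ico {T : Set (Tile β)} {τ : Tile β} (hτ : τ ∈ T) {y R : ℝ}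
    (hy : y ∈ τ.ico) (h : |y| ≤ R) : τ ∈ centralPatch R T :=
  ⟨hτ, y, ⟨hy.1, hy.2.le⟩, abs_le.1 h⟩

lemma centralPatch_mono {R R' : ℝ} (h : R ≤ R') {T T' : Set (Tile β)} (hT : T ⊆ T') :
    centralPatch R T ⊆ centralPatch R' T' := by
  rintro τ ⟨hτ, y, h1, h2⟩
  exact ⟨hT hτ, y, h1, by linarith [h2.1], by linarith [h2.2]⟩

lemma centralPatch_centralPatch {R R' : ℝ} (h : R ≤ R') (T : Set (Tile β)) :
    centralPatch R (centralPatch R' T) = centralPatch R T := by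
  refine (centralPatch_mono le_rfl (centralPatch_subset _ _)).antisymm ?_
  rintro τ ⟨hτ, y, h1, h2⟩
  exact ⟨⟨hτ, y, h1, by linarith [h2.1], by linarith [h2.2]⟩, y, h1, h2⟩

lemma centralPatch_eq_mono {R R' : ℝ} (h : R ≤ R') {T T' : Set (Tile β)}
    (he : centralPatch R' T = centralPatch R' T') : centralPatch R T = centralPatch R T' := by
  rw [← centralPatch_centralPatch h T, he, centralPatch_centralPatch h]

lemma IsTiling.centralPatch_covers (hβ : IsPisot β) {T : Set (Tile β)} (h : IsTiling T) (R : ℝ) :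
    Covers (centralPatch R T) (-R) R := by
  intro y h1 h2
  obtain ⟨ρ, hρ, hy⟩ := h.exists_mem hβ y
  exact ⟨ρ, mem_centralPatch_of_mem_ico hρ hy (abs_le.2 ⟨h1, h2.le⟩), hy⟩

lemma finite_centralPatch (hβ : IsPisot β) {T : Set (Tile β)} (h : Packed T) (R : ℝ) :
    (centralPatch R T).Finite := by
  refine (h.finite hβ (-R) R).subset ?_
  rintro τ ⟨hτ, y, h1, h2⟩
  exact ⟨hτ, by linarith [h1.2, h2.1], by linarith [h1.1, h2.2]⟩

lemma IsTiling.isPatch_centralPatch (hβ : IsPisot β) {T : Set (Tile β)} (h : IsTiling T) {R : ℝ}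
    (hR : 0 ≤ R) : IsPatch (centralPatch R T) := by
  refine ⟨finite_centralPatch hβ h.packed R,
    packed_iff.1 (h.packed.mono (centralPatch_subset _ _)), ?_⟩
  have e : (⋃ τ ∈ centralPatch R T, τ.support) =
      ⋃ τ ∈ centralPatch R T, (τ.support ∪ Set.Icc (-R) R) := by
    refine Set.Subset.antisymm (Set.biUnion_mono subset_rfl fun τ _ => Set.subset_union_left) ?_
    refine Set.iUnion₂_subset fun τ hτ => Set.union_subset (Set.subset_biUnion_of_mem hτ) ?_
    intro y hy
    obtain ⟨ρ, hρ, hyρ⟩ := h.exists_mem hβ y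
    exact Set.mem_biUnion (mem_centralPatch_of_mem_ico hρ hyρ (abs_le.2 hy)) ⟨hyρ.1, hyρ.2.le⟩
  rw [e, Set.biUnion_eq_iUnion]
  refine isPreconnected_iUnion ⟨0, Set.mem_iInter.2 fun _ => Or.inr ⟨by linarith, hR⟩⟩
    fun τ => isPreconnected_Icc.union' τ.2.2 isPreconnected_Icc

lemma exists_subset_centralPatch {T Q : Set (Tile β)} (hβ : IsPisot β) (hQ : Q.Finite)
    (hQT : Q ⊆ T) : ∃ R₀, 0 < R₀ ∧ ∀ R ≥ R₀, Q ⊆ centralPatch R T := by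
  obtain ⟨B, hB⟩ := (hQ.image fun τ : Tile β => |τ.min|).bddAbove
  refine ⟨max B 1, lt_max_of_lt_right zero_lt_one, fun R hR τ hτ => ?_⟩
  exact mem_centralPatch_of_mem_ico (hQT hτ) (τ.min_mem_ico hβ)
    ((hB ⟨τ, hτ, rfl⟩).trans ((le_max_left _ _).trans hR))

/-! ### The tiling space -/

/-- Every tile occurs in the iterates of the substitution on tiles of the first type. -/
lemma exists_mem_iterate_firstTile (hβ : IsPisot β) :
    ∃ n : ℕ, ∀ τ : Tile β, ∃ y, τ ∈ subst^[n] {firstTile hβ y} := by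
  obtain ⟨n, hn⟩ := exists_prototile_mem hβ
  refine ⟨n, fun τ => ⟨0 + τ.shift / β ^ n, ?_⟩⟩
  have := mem_iterate_subst_shift (t := τ.shift / β ^ n) (hn n le_rfl τ.type)
  rw [mul_div_cancel₀ _ (pow_pos hβ.pos n).ne'] at this
  simpa [firstTile] using this

/-- The finite parts of the tilings in the tiling space occur in arbitrarily high iterates of the
substitution on tiles of the first type. -/
lemma exists_subset_iterate (hβ : IsPisot β) {T : Set (Tile β)} (hT : T ∈ tilingSpace β)
    {Q : Set (Tile β)} (hQ : Q.Finite) (hQT : Q ⊆ T) (n₀ : ℕ) :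
    ∃ m ≥ n₀, ∃ y, Q ⊆ subst^[m] {firstTile hβ y} := by
  obtain ⟨R₀, hR₀, hR⟩ := exists_subset_centralPatch hβ hQ hQT
  set R := max R₀ (β ^ n₀) with hRdef
  have hR1 : R₀ ≤ R := le_max_left _ _
  have hR2 : β ^ n₀ ≤ R := le_max_right _ _
  obtain ⟨τ, n, hn⟩ := hT.2 _ (centralPatch_subset R T)
    (hT.1.isPatch_centralPatch hβ (hR₀.le.trans hR1))
  have hpow : ∀ k : ℕ, 0 < β ^ k := fun k => pow_pos hβ.pos k
  have hle : n₀ ≤ n := by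
    obtain ⟨ρ, hρ, hyρ⟩ := hT.1.centralPatch_covers hβ R (-R) le_rfl (by linarith)
    obtain ⟨ρ', hρ', hyρ'⟩ := hT.1.exists_mem hβ R
    have hρ'' := mem_centralPatch_of_mem_ico hρ' hyρ'
      (show |R| ≤ R by rw [abs_of_pos (by linarith)])
    have b1 := (iterate_subst_bounds hβ (hn hρ)).1
    have b2 := (iterate_subst_bounds hβ (hn hρ'')).2
    have b3 : β ^ n * τ.max ≤ β ^ n * (τ.min + 1) :=
      mul_le_mul_of_nonneg_left (τ.max_le_min_add_one hβ) (hpow n).le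
    have b4 : β ^ n₀ < β ^ n := by
      have := hpow n₀
      linarith [hyρ.1, hyρ'.2]
    exact ((pow_lt_pow_iff_right₀ hβ.one_lt).1 b4).le
  obtain ⟨r, hr⟩ := exists_mem_iterate_firstTile hβ
  obtain ⟨y, hy⟩ := hr τ
  refine ⟨n + r, by omega, y, fun σ hσ => ?_⟩
  exact mem_iterate_subst_add.2 ⟨τ, hy, hn (hR R hR1 hσ)⟩

lemma mem_tilingSpace_of (hβ : IsPisot β) {T : Set (Tile β)} (h1 : Packed T)
    (h2 : ∀ y, ∃ ρ ∈ T, y ∈ ρ.ico)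
    (h3 : ∀ Q ⊆ T, Q.Finite → ∃ (m : ℕ) (τ : Tile β), Q ⊆ subst^[m] {τ}) :
    T ∈ tilingSpace β := by
  refine ⟨(isTiling_iff hβ).2 ⟨h1, h2⟩, fun P hP hpatch => ?_⟩
  obtain ⟨m, τ, h⟩ := h3 P hP hpatch.1
  exact ⟨τ, m, h⟩

lemma subst_mem_tilingSpace (hβ : IsPisot β) {T : Set (Tile β)} (hT : T ∈ tilingSpace β) :
    subst T ∈ tilingSpace β := by
  refine mem_tilingSpace_of hβ (hT.1.packed.subst hβ) (fun y => ?_) fun Q hQ hfin => ?_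
  · refine (hT.1.covers hβ (y / β) (y / β + 1)).subst hβ y ?_ ?_
    · rw [mul_div_cancel₀ _ hβ.pos.ne']
    · rw [mul_add, mul_div_cancel₀ _ hβ.pos.ne']
      linarith [hβ.pos]
  · choose! par hpar using fun σ (hσ : σ ∈ Q) => mem_subst.1 (hQ hσ)
    obtain ⟨m, -, y, hm⟩ := exists_subset_iterate hβ hT (hfin.image par)
      (by rintro _ ⟨σ, hσ, rfl⟩; exact (hpar σ hσ).1) 0
    refine ⟨m + 1, firstTile hβ y, fun σ hσ => ?_⟩
    rw [Function.iterate_succ_apply', mem_subst]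
    exact ⟨par σ, hm ⟨σ, hσ, rfl⟩, (hpar σ hσ).2⟩

lemma iterate_subst_mem_tilingSpace (hβ : IsPisot β) {T : Set (Tile β)} (hT : T ∈ tilingSpace β)
    (n : ℕ) : subst^[n] T ∈ tilingSpace β := by
  induction n with
  | zero => exact hT
  | succ n ih =>
    rw [Function.iterate_succ_apply']
    exact subst_mem_tilingSpace hβ ih

lemma translate_iterate_firstTile (hβ : IsPisot β) (n : ℕ) (y t : ℝ) :
    translate (subst^[n] {firstTile hβ y}) t = subst^[n] {firstTile hβ (y - t / β ^ n)} := by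
  have : ({firstTile hβ (y - t / β ^ n)} : Set (Tile β)) =
      translate {firstTile hβ y} (t / β ^ n) := by
    simp [translate, firstTile]
  rw [this, iterate_subst_translate, mul_div_cancel₀ _ (pow_pos hβ.pos n).ne']

lemma translate_mem_tilingSpace (hβ : IsPisot β) {T : Set (Tile β)} (hT : T ∈ tilingSpace β)
    (t : ℝ) : translate T t ∈ tilingSpace β := by
  refine mem_tilingSpace_of hβ (hT.1.packed.translate t) (fun y => ?_) fun Q hQ hfin => ?_
  · have := (hT.1.covers hβ (y + t) (y + t + 1)).translate t y
    exact this (by linarith) (by linarith)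
  · obtain ⟨m, -, y, hm⟩ := exists_subset_iterate hβ hT (Q := translate Q (-t))
      (hfin.image _) (by
        have := translate_mono hQ (-t)
        rwa [translate_translate, neg_add_cancel, translate_zero] at this) 0
    refine ⟨m, firstTile hβ (y - t / β ^ m), ?_⟩
    have := translate_mono hm t
    rwa [translate_translate, add_neg_cancel, translate_zero, translate_iterate_firstTile] at this

lemma hasRuns_of_mem_tilingSpace (hβ : IsPisot β) {T : Set (Tile β)} (hT : T ∈ tilingSpace β) :
    HasRuns T := by
  intro σ hσ σ' hσ'
  obtain ⟨m, -, y, hm⟩ := exists_subset_iterate hβ hT (Q := {σ, σ'})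
    (by simp) (by rintro τ (rfl | rfl) <;> assumption) 0
  exact hasRuns_iterate_subst hβ _ m σ (hm (by simp)) σ' (hm (by simp))

/-- The shifts of the tiles of a tiling differ by elements of `ℤ[β]` with uniformly bounded
conjugates. -/
lemma exists_bddConj_shift_sub (hβ : IsPisot β) : ∃ C, 0 ≤ C ∧ ∀ T ∈ tilingSpace β,
    ∀ σ ∈ T, ∀ σ' ∈ T, BddConj β C (σ.shift - σ'.shift) := by
  obtain ⟨C, hC0, hC⟩ := exists_bddConj_shift hβ
  refine ⟨C + C, by linarith, fun T hT σ hσ σ' hσ' => ?_⟩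
  obtain ⟨m, -, y, hm⟩ := exists_subset_iterate hβ hT (Q := {σ, σ'})
    (by simp) (by rintro τ (rfl | rfl) <;> assumption) 0
  have := (hC m _ σ (hm (by simp))).sub (hC m _ σ' (hm (by simp)))
  rwa [sub_sub_sub_cancel_right] at this

/-- The tiles of each type are relatively dense. -/
lemma exists_relatively_dense (hβ : IsPisot β) : ∃ C, 1 ≤ C ∧ ∀ T ∈ tilingSpace β,
    ∀ (x : ℝ) (j : Fin (numTiles β)), ∃ τ ∈ T, τ.type = j ∧ x - C ≤ τ.min ∧ τ.max ≤ x + C := by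
  obtain ⟨n₀, hn₀⟩ := exists_primitive hβ
  have hC1 : 1 ≤ β ^ n₀ := one_le_pow₀ hβ.one_lt.le
  refine ⟨β ^ n₀, hC1, fun T hT x j => ?_⟩
  set R := |x| + β ^ n₀ with hR
  obtain ⟨m, hm, y, hsub⟩ := exists_subset_iterate hβ hT
    (finite_centralPatch hβ hT.1.packed R) (centralPatch_subset _ _) n₀
  obtain ⟨σ, hσ, hx⟩ := hT.1.exists_mem hβ x
  have hσ' := hsub (mem_centralPatch_of_mem_ico hσ hx (by linarith))
  obtain ⟨k, rfl⟩ := Nat.exists_eq_add_of_le hm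
  obtain ⟨ρ, hρ, hσρ⟩ := mem_iterate_subst_add.1 hσ'
  obtain ⟨y', hy'⟩ := hn₀ n₀ le_rfl ρ j
  have b1 := iterate_subst_bounds hβ hσρ
  have b2 := iterate_subst_bounds hβ hy'
  have b3 : β ^ n₀ * ρ.max ≤ β ^ n₀ * (ρ.min + 1) :=
    mul_le_mul_of_nonneg_left (ρ.max_le_min_add_one hβ) (by linarith)
  set τ : Tile β := ⟨j, y'⟩ with hτ
  have hlt := τ.min_lt_max hβ
  have h1 : x - β ^ n₀ ≤ τ.min := by linarith [hx.2]
  have h2 : τ.max ≤ x + β ^ n₀ := by linarith [hx.1]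
  refine ⟨τ, ?_, rfl, h1, h2⟩
  obtain ⟨ρ', hρ', hmin⟩ := hT.1.exists_mem hβ τ.min
  have hρ'' := mem_centralPatch_of_mem_ico hρ' hmin (R := R) (by
    rw [abs_le]
    constructor <;> linarith [neg_abs_le x, le_abs_self x])
  have e := (packed_singleton (firstTile hβ y)).iterate_subst hβ (n₀ + k) ρ' (hsub hρ'') τ
    (mem_iterate_subst_add.2 ⟨ρ, hρ, hy'⟩) _ hmin (τ.min_mem_ico hβ)
  rwa [← e]

/-- The number `t_*(T)` is attained and uniformly bounded. -/
lemma exists_tStar_spec (hβ : IsPisot β) : ∃ C, 1 ≤ C ∧ ∀ T ∈ tilingSpace β,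
    firstTile hβ (tStar T) ∈ T ∧ -C ≤ tStar T ∧ tStar T ≤ 0 := by
  obtain ⟨C, hC1, hC⟩ := exists_relatively_dense hβ
  refine ⟨2 * C, by linarith, fun T hT => ?_⟩
  obtain ⟨τ, hτ, hj, h1, h2⟩ := hC T hT (-C) ⟨0, numTiles_pos hβ⟩
  have hτ0 : (τ.type : ℕ) = 0 := by rw [hj]
  have hmin : ∀ σ : Tile β, (σ.type : ℕ) = 0 → σ.min = σ.shift := fun σ h => by
    rw [eq_firstTile hβ h, firstTile_min]
    rfl
  have hlt := τ.min_lt_max hβ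
  have hτmem : τ ∈ {σ | (σ ∈ T ∧ -(2 * C) ≤ σ.max ∧ σ.min ≤ 0) ∧ (σ.type : ℕ) = 0} :=
    ⟨⟨hτ, by linarith, by linarith⟩, hτ0⟩
  obtain ⟨σ, hσ, hmax⟩ := Set.exists_max_image _ (fun σ : Tile β => σ.shift)
    ((hT.1.packed.finite hβ (-(2 * C)) 0).subset fun σ
      (h : σ ∈ {σ | (σ ∈ T ∧ -(2 * C) ≤ σ.max ∧ σ.min ≤ 0) ∧ (σ.type : ℕ) = 0}) => h.1) ⟨τ, hτmem⟩
  have hge : -(2 * C) ≤ σ.shift := by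
    have := hmax τ hτmem
    rw [← hmin τ hτ0] at this
    linarith
  have hgr : IsGreatest {t | t ≤ 0 ∧ ∃ τ ∈ T, (τ.type : ℕ) = 0 ∧ τ.shift = t} σ.shift := by
    refine ⟨⟨?_, σ, hσ.1.1, hσ.2, rfl⟩, ?_⟩
    · rw [← hmin σ hσ.2]
      exact hσ.1.2.2
    · rintro t ⟨ht, ρ, hρ, hρ0, rfl⟩
      by_contra hlt'
      have h3 := hmin ρ hρ0
      have h4 := ρ.min_lt_max hβ
      exact absurd (hmax ρ ⟨⟨hρ, by linarith [not_le.1 hlt'], by linarith⟩, hρ0⟩) hlt'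
  have e : tStar T = σ.shift := hgr.csSup_eq
  rw [e]
  refine ⟨?_, hge, hgr.1.1⟩
  rw [← eq_firstTile hβ hσ.2]
  exact hσ.1.1

/-! ### A tiling in the tiling space -/

/-- The iterates of the substitution on the first prototile contain a tile of the first type in the
interior. -/
lemma exists_interior_firstTile (hβ : IsPisot β) : ∃ (r : ℕ) (y : ℝ), 1 ≤ r ∧ 0 < y ∧
    y + vtx β 1 < β ^ r * vtx β 1 ∧ firstTile hβ y ∈ subst^[r] {firstTile hβ 0} := by
  have hs := vtx_pos hβ Nat.one_pos (numTiles_pos hβ)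
  obtain ⟨n₀, hn₀⟩ := exists_firstTile_mem hβ
  obtain ⟨m₀, hm₀⟩ := exists_pow_gt hβ (4 / vtx β 1)
  have h1 := hm₀ (m₀ + 1) (by omega)
  rw [div_lt_iff₀ hs] at h1
  have hmax : ∀ y, (firstTile hβ y).max = y + vtx β 1 := fun y => by
    simp [firstTile, Tile.max, add_comm]
  obtain ⟨ρ, hρ, hy⟩ := exists_mem_iterate_subst hβ (n := m₀ + 1) (τ := firstTile hβ 0)
    (y := 2) (by rw [firstTile_min]; norm_num) (by rw [hmax]; linarith)
  obtain ⟨y, hy'⟩ := hn₀ n₀ le_rfl ρ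
  have hp : 0 < β ^ n₀ := pow_pos hβ.pos _
  have b := iterate_subst_bounds hβ hy'
  rw [firstTile_min, hmax] at b
  have h2 := ρ.max_le_min_add_one hβ
  refine ⟨n₀ + (m₀ + 1), y, by omega, ?_, ?_, mem_iterate_subst_add.2 ⟨ρ, hρ, hy'⟩⟩
  · have : 0 < β ^ n₀ * ρ.min := mul_pos hp (by linarith [hy.2])
    linarith
  · rw [pow_add, mul_assoc]
    have : β ^ n₀ * ρ.max < β ^ n₀ * (β ^ (m₀ + 1) * vtx β 1) :=
      mul_lt_mul_of_pos_left (by linarith [hy.1]) hp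
    linarith

/-- There is a tiling in the tiling space that contains translates of all the iterates of the
substitution on the first prototile, and that is the image of a tiling in the tiling space. It is
obtained, like a fixed point, from a prototile in the interior of one of its iterates. -/
lemma exists_universal_tiling (hβ : IsPisot β) : ∃ X ∈ tilingSpace β,
    (∀ n : ℕ, ∃ g, subst^[n] {firstTile hβ g} ⊆ X) ∧ ∃ Y ∈ tilingSpace β, subst Y = X := by
  obtain ⟨r, y, hr, hy0, hy1, hy⟩ := exists_interior_firstTile hβ
  have hs := vtx_pos hβ Nat.one_pos (numTiles_pos hβ)
  have hpow : ∀ k : ℕ, 1 ≤ β ^ k := fun k => one_le_pow₀ hβ.one_lt.le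
  have hmax : ∀ y, (firstTile hβ y).max = y + vtx β 1 := fun y => by
    simp [firstTile, Tile.max, add_comm]
  let c : ℕ → ℝ := fun k => y * ∑ i ∈ Finset.range k, (β ^ r) ^ i
  have hc0 : c 0 = 0 := by simp [c]
  have hcs : ∀ k, c (k + 1) = c k + β ^ (r * k) * y := fun k => by
    simp only [c, Finset.sum_range_succ, pow_mul]
    ring
  have hcβ : ∀ k, β ^ r * c k = c (k + 1) - y := fun k => by
    have : ∑ i ∈ Finset.range (k + 1), (β ^ r) ^ i =
        β ^ r * ∑ i ∈ Finset.range k, (β ^ r) ^ i + 1 := by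
      rw [Finset.sum_range_succ', Finset.mul_sum]
      simp [pow_succ']
    simp only [c, this]
    ring
  let P : ℕ → Set (Tile β) := fun k => translate (subst^[r * k] {firstTile hβ 0}) (c k)
  have hPmono : Monotone P := monotone_nat_of_le_succ fun k => by
    intro σ hσ
    simp only [P, mem_translate] at hσ ⊢
    have h := mem_iterate_subst_shift (t := y) hσ
    have e : r * (k + 1) = r * k + r := by ring
    rw [e, mem_iterate_subst_add, hcs]
    refine ⟨firstTile hβ y, hy, ?_⟩
    simpa [firstTile, add_assoc] using h
  have hPpack : ∀ k, Packed (P k) := fun k =>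
    ((packed_singleton _).iterate_subst hβ _).translate _
  have hPcov : ∀ k, Covers (P k) (-(k * y)) (k * (β ^ r * vtx β 1 - vtx β 1 - y)) := by
    intro k
    have h := (covers_iterate_subst_singleton hβ (firstTile hβ 0) (r * k)).translate (c k)
    rw [firstTile_min, hmax] at h
    have h1 : ∀ k : ℕ, k * y ≤ c k := by
      intro k
      induction k with
      | zero => simp [hc0]
      | succ k ih =>
        rw [hcs]
        have := le_mul_of_one_le_left hy0.le (hpow (r * k))
        push_cast
        linarith
    have h2 : ∀ k : ℕ, k * (β ^ r * vtx β 1 - vtx β 1 - y) ≤ β ^ (r * k) * vtx β 1 - c k := by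
      intro k
      induction k with
      | zero => simpa [hc0] using hs.le
      | succ k ih =>
        rw [hcs]
        have h3 : 0 ≤ β ^ r * vtx β 1 - vtx β 1 - y := by linarith
        have := le_mul_of_one_le_left h3 (hpow (r * k))
        have e : β ^ (r * (k + 1)) = β ^ (r * k) * β ^ r := by rw [← pow_add]; ring_nf
        rw [e]
        push_cast
        linarith
    intro z hz1 hz2
    refine h z (by linarith [h1 k]) ?_
    have := h2 k
    rw [zero_add]
    linarith
  let X : Set (Tile β) := ⋃ k, P k
  have hPX : ∀ k, P k ⊆ X := fun k => Set.subset_iUnion P k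
  have hXpack : Packed X := by
    intro σ hσ σ' hσ' z hz hz'
    obtain ⟨k, hk⟩ := Set.mem_iUnion.1 hσ
    obtain ⟨k', hk'⟩ := Set.mem_iUnion.1 hσ'
    exact hPpack (max k k') σ (hPmono (le_max_left _ _) hk) σ' (hPmono (le_max_right _ _) hk')
      z hz hz'
  have hXfin : ∀ Q ⊆ X, Q.Finite → ∃ k, Q ⊆ P k := by
    intro Q hQ hfin
    have hdir : DirectedOn (fun a b : Set (Tile β) => a ⊆ b) (Set.range P) := by
      rintro _ ⟨k, rfl⟩ _ ⟨k', rfl⟩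
      exact ⟨P (max k k'), ⟨_, rfl⟩, hPmono (le_max_left _ _), hPmono (le_max_right _ _)⟩
    choose! f hf using fun σ (hσ : σ ∈ Q) => Set.mem_iUnion.1 (hQ hσ)
    obtain ⟨k, hk⟩ := (hfin.image f).bddAbove
    exact ⟨k, fun σ hσ => hPmono (hk ⟨σ, hσ, rfl⟩) (hf σ hσ)⟩
  have hX : X ∈ tilingSpace β := by
    refine mem_tilingSpace_of hβ hXpack (fun z => ?_) fun Q hQ hfin => ?_
    · have hη : 0 < β ^ r * vtx β 1 - vtx β 1 - y := by linarith
      obtain ⟨k, hk⟩ := exists_nat_gt (max (-z / y) (z / (β ^ r * vtx β 1 - vtx β 1 - y)))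
      have h1 := (le_max_left _ _).trans_lt hk
      have h2 := (le_max_right _ _).trans_lt hk
      rw [div_lt_iff₀ hy0] at h1
      rw [div_lt_iff₀ hη] at h2
      exact (hPcov k).mono (hPX k) z (by linarith) h2
    · obtain ⟨k, hk⟩ := hXfin Q hQ hfin
      refine ⟨r * k, firstTile hβ (0 - c k / β ^ (r * k)), hk.trans ?_⟩
      rw [← translate_iterate_firstTile]
  refine ⟨X, hX, fun n => ⟨0 - c n / β ^ n, ?_⟩, ?_⟩
  · have hle : n ≤ r * n := Nat.le_mul_of_pos_left n hr
    obtain ⟨d, hd⟩ := Nat.exists_eq_add_of_le hle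
    refine Set.Subset.trans ?_ (hPX n)
    rw [← translate_iterate_firstTile]
    refine translate_mono ?_ _
    rw [hd, Function.iterate_add_apply]
    refine iterate_subst_mono n ?_
    rw [Set.singleton_subset_iff]
    simpa using firstTile_mem_subst hβ 0 d
  · have hXr : subst^[r] X = translate X (-y) := by
      refine (iterate_subst_mem_tilingSpace hβ hX r).1.eq_of_subset hβ
        (translate_mem_tilingSpace hβ hX _).1 fun σ hσ => ?_
      obtain ⟨τ, hτ, hσ⟩ := mem_iterate_subst.1 hσ
      obtain ⟨k, hk⟩ := Set.mem_iUnion.1 hτ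
      refine translate_mono (hPX (k + 1)) _ ?_
      have h1 : σ ∈ subst^[r] (P k) := mem_iterate_subst.2 ⟨τ, hk, hσ⟩
      simp only [P] at h1 ⊢
      rw [iterate_subst_translate, hcβ, ← Function.iterate_add_apply] at h1
      rw [translate_translate, show r * (k + 1) = r + r * k by ring,
        show -y + c (k + 1) = c (k + 1) - y by ring]
      exact h1
    refine ⟨translate (subst^[r - 1] X) (y / β), translate_mem_tilingSpace hβ
      (iterate_subst_mem_tilingSpace hβ hX _) _, ?_⟩
    rw [subst_translate, mul_div_cancel₀ _ hβ.pos.ne', ← Function.iterate_succ_apply' subst,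
      Nat.succ_eq_add_one, Nat.sub_add_cancel hr, hXr, translate_translate, add_neg_cancel,
      translate_zero]

/-! ### Return vectors -/

/-- The positions of the tiles of the first type in `Ψ^n` of the first prototile. -/
def positions (hβ : IsPisot β) (n : ℕ) : Set ℝ :=
  {y | firstTile hβ y ∈ subst^[n] {firstTile hβ 0}}

/-- The vectors between two tiles of the first type in the same iterate `Ψ^n` of the first
prototile. -/
def returnVectors (hβ : IsPisot β) : Set ℝ :=
  {d | ∃ n, ∃ y ∈ positions hβ n, ∃ y' ∈ positions hβ n, y - y' = d}

lemma mem_iterate_subst_firstTile_shift (hβ : IsPisot β) {n : ℕ} {y : ℝ} (hy : y ∈ positions hβ n)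
    (g : ℝ) : firstTile hβ (y + β ^ n * g) ∈ subst^[n] {firstTile hβ g} := by
  have := mem_iterate_subst_shift (t := g) hy
  simpa [firstTile] using this

lemma zero_mem_positions (hβ : IsPisot β) (n : ℕ) : (0 : ℝ) ∈ positions hβ n := by
  change firstTile hβ 0 ∈ subst^[n] {firstTile hβ 0}
  simpa using firstTile_mem_subst hβ 0 n

lemma add_mem_positions (hβ : IsPisot β) {m n : ℕ} {y z : ℝ} (hy : y ∈ positions hβ m)
    (hz : z ∈ positions hβ n) : z + β ^ n * y ∈ positions hβ (n + m) :=
  mem_iterate_subst_add.2 ⟨_, hy, mem_iterate_subst_firstTile_shift hβ hz y⟩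

lemma positions_mono (hβ : IsPisot β) {m n : ℕ} (h : m ≤ n) :
    positions hβ m ⊆ positions hβ n := by
  intro y hy
  obtain ⟨d, rfl⟩ := Nat.exists_eq_add_of_le h
  simpa using add_mem_positions hβ (zero_mem_positions hβ d) hy

lemma positions_subset_betaRing (hβ : IsPisot β) {n : ℕ} {y : ℝ} (hy : y ∈ positions hβ n) :
    y ∈ betaRing β := by
  obtain ⟨C, -, hC⟩ := exists_bddConj_shift hβ
  have := (hC n _ _ hy).mem
  simpa [firstTile] using this

lemma returnVectors_subset_betaRing (hβ : IsPisot β) {d : ℝ} (hd : d ∈ returnVectors hβ) :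
    d ∈ betaRing β := by
  obtain ⟨n, y, hy, y', hy', rfl⟩ := hd
  exact sub_mem (positions_subset_betaRing hβ hy) (positions_subset_betaRing hβ hy')

lemma zero_mem_returnVectors (hβ : IsPisot β) : (0 : ℝ) ∈ returnVectors hβ :=
  ⟨0, 0, zero_mem_positions hβ 0, 0, zero_mem_positions hβ 0, sub_zero _⟩

lemma neg_mem_returnVectors (hβ : IsPisot β) {d : ℝ} (hd : d ∈ returnVectors hβ) :
    -d ∈ returnVectors hβ := by
  obtain ⟨n, y, hy, y', hy', rfl⟩ := hd
  exact ⟨n, y', hy', y, hy, by ring⟩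

lemma pow_mul_mem_returnVectors (hβ : IsPisot β) {d : ℝ} (hd : d ∈ returnVectors hβ) (k : ℕ) :
    β ^ k * d ∈ returnVectors hβ := by
  obtain ⟨n, y, hy, y', hy', rfl⟩ := hd
  refine ⟨k + n, _, add_mem_positions hβ hy (zero_mem_positions hβ k), _,
    add_mem_positions hβ hy' (zero_mem_positions hβ k), by ring⟩

/-- A return vector can be followed by any return vector of a sufficiently high level. -/
lemma exists_add_mem_returnVectors (hβ : IsPisot β) {g : ℝ} (hg : g ∈ returnVectors hβ) :
    ∃ m₀ : ℕ, ∀ m ≥ m₀, ∀ g' ∈ returnVectors hβ, g + β ^ m * g' ∈ returnVectors hβ := by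
  obtain ⟨n, y, hy, y', hy', rfl⟩ := hg
  refine ⟨n, ?_⟩
  rintro m hm _ ⟨n', z, hz, z', hz', rfl⟩
  refine ⟨m + n', _, add_mem_positions hβ hz (positions_mono hβ hm hy), _,
    add_mem_positions hβ hz' (positions_mono hβ hm hy'), by ring⟩

/-- After a run of all the prototiles, that is, at distance `1`, a new run begins. -/
lemma one_mem_returnVectors (hβ : IsPisot β) : (1 : ℝ) ∈ returnVectors hβ := by
  obtain ⟨n₁, hn₁⟩ := exists_prototile_mem hβ
  have hs := vtx_pos hβ Nat.one_pos (numTiles_pos hβ)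
  obtain ⟨n₂, hn₂⟩ := exists_pow_gt hβ (1 / vtx β 1)
  set n := max n₁ n₂
  have h1 := hn₂ n (le_max_right _ _)
  rw [div_lt_iff₀ hs] at h1
  have hN := numTiles_pos hβ
  set l : Tile β := ⟨⟨numTiles β - 1, by omega⟩, 0⟩ with hl
  have hlmem : l ∈ subst^[n] {firstTile hβ 0} := hn₁ n (le_max_left _ _) _
  have hlmax : l.max = 1 := by
    simp only [hl, Tile.max, add_zero]
    rw [Nat.sub_add_cancel hN, vtx_numTiles hβ]
  obtain ⟨σ, hσ, hy⟩ := exists_mem_iterate_subst hβ (n := n) (τ := firstTile hβ 0) (y := 1)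
    (by rw [firstTile_min]; simp) (by simp only [firstTile, Tile.max, zero_add, add_zero]; exact h1)
  have hP := (packed_singleton (firstTile hβ 0)).iterate_subst hβ n
  have hmin : σ.min = 1 := by
    refine le_antisymm hy.1 ?_
    have hll := l.min_lt_max hβ
    rcases lt_trichotomy σ.min l.min with h | h | h
    · have := hP.max_le_min hβ hσ hlmem h
      linarith [hy.2]
    · have := hP σ hσ l hlmem σ.min (σ.min_mem_ico hβ) (by rw [h]; exact l.min_mem_ico hβ)
      rw [this, Tile.mem_ico, hlmax] at hy
      exact absurd hy.2 (lt_irrefl _)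
    · rw [← hlmax]
      exact hP.max_le_min hβ hlmem hσ h
  have h0 : (σ.type : ℕ) = 0 := by
    by_contra h0
    have := (hasRuns_iterate_subst hβ _ n l hlmem σ hσ (by rw [hlmax, hmin]) h0).2
    simp only [hl] at this
    have := σ.type.2
    omega
  have e := eq_firstTile hβ h0
  rw [e, firstTile_min] at hmin
  rw [e, hmin] at hσ
  exact ⟨n, 1, hσ, 0, zero_mem_positions hβ n, sub_zero _⟩

/-- The pigeonhole principle for return vectors: among sufficiently many elements of `ℤ[β]` there
are two whose difference is a return vector up to a power of `β`. The points `β ^ k * w i`, moved to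
the right by a common distance, lie in tiles of an iterate of the first prototile, and there are
only finitely many possibilities for their relative positions in these tiles. -/
lemma exists_sub_mem_returnVectors (hβ : IsPisot β) :
    ∃ M : ℕ, ∀ w : ℕ → ℝ, (∀ i, w i ∈ betaRing β) →
      ∃ i j, i < j ∧ j ≤ M ∧ ∃ k : ℕ, β ^ k * (w i - w j) ∈ returnVectors hβ := by
  classical
  obtain ⟨C, -, hC⟩ := exists_bddConj_shift hβ
  have hfin := finite_bddConj hβ 1 (1 + C)
  set t : Finset (Fin (numTiles β) × ℝ) := Finset.univ ×ˢ hfin.toFinset with ht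
  refine ⟨t.card, fun w hw => ?_⟩
  obtain ⟨c, hc⟩ : ∃ c : ℕ, ∀ i ≤ t.card, 0 ≤ w i + c := by
    obtain ⟨B, hB⟩ := ((Set.finite_Iic t.card).image fun i => -w i).bddAbove
    obtain ⟨c, hc⟩ := exists_nat_ge B
    exact ⟨c, fun i hi => by linarith [hB ⟨i, hi, rfl⟩]⟩
  obtain ⟨k, hk⟩ : ∃ k : ℕ, ∀ i ≤ t.card, BddConj β 1 (β ^ k * (w i + c)) := by
    choose f hf using fun i => exists_bddConj_one hβ
      (add_mem (hw i) (natCast_mem (betaRing β) c))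
    obtain ⟨k, hk⟩ := ((Set.finite_Iic t.card).image f).bddAbove
    exact ⟨k, fun i hi => hf i k (hk ⟨i, hi, rfl⟩)⟩
  have hs := vtx_pos hβ Nat.one_pos (numTiles_pos hβ)
  obtain ⟨n, hn⟩ : ∃ n : ℕ, ∀ i ≤ t.card, β ^ k * (w i + c) < β ^ n * vtx β 1 := by
    obtain ⟨B, hB⟩ := ((Set.finite_Iic t.card).image fun i => β ^ k * (w i + c)).bddAbove
    obtain ⟨n, hn⟩ := exists_pow_gt hβ (B / vtx β 1)
    refine ⟨n, fun i hi => (hB ⟨i, hi, rfl⟩).trans_lt ?_⟩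
    have := hn n le_rfl
    rwa [div_lt_iff₀ hs] at this
  have hpk : 0 < β ^ k := pow_pos hβ.pos k
  have hex : ∀ i ≤ t.card, ∃ σ ∈ subst^[n] {firstTile hβ 0}, β ^ k * (w i + c) ∈ σ.ico :=
    fun i hi => exists_mem_iterate_subst hβ
      (by rw [firstTile_min, mul_zero]; exact mul_nonneg hpk.le (hc i hi))
      (by simpa [firstTile, Tile.max] using hn i hi)
  have : Nonempty (Tile β) := ⟨firstTile hβ 0⟩
  choose! σ hσ hσy using hex
  obtain ⟨i, hi, j, hj, hne, he⟩ := Finset.exists_ne_map_eq_of_card_lt_of_maps_to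
    (s := Finset.range (t.card + 1)) (t := t) (by simp)
    (f := fun i => ((σ i).type, β ^ k * (w i + c) - (σ i).shift)) (by
      intro i hi
      have hi' : i ≤ t.card := by simpa [Nat.lt_succ_iff] using hi
      simp only [ht, Finset.coe_product, Finset.coe_univ, Set.Finite.coe_toFinset, Set.mem_prod,
        Set.mem_univ, true_and, Set.mem_ofPred_eq]
      have h1 := (σ i).shift_le_min hβ
      have h2 := (σ i).max_le_shift_add_one hβ
      have h3 := hσy i hi'
      refine ⟨?_, (hk i hi').sub ?_⟩
      · rw [abs_le]
        constructor <;> linarith [h3.1, h3.2]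
      · simpa [firstTile] using hC n _ _ (hσ i hi'))
  -- the difference of the positions of two tiles of the same type is a return vector up to a power
  have key : ∀ i ≤ t.card, ∀ j ≤ t.card,
      ((σ i).type, β ^ k * (w i + c) - (σ i).shift) =
        ((σ j).type, β ^ k * (w j + c) - (σ j).shift) →
      ∃ k : ℕ, β ^ k * (w i - w j) ∈ returnVectors hβ := by
    intro i hi j hj he
    rw [Prod.mk.injEq] at he
    obtain ⟨r, hr⟩ := exists_firstTile_mem hβ
    obtain ⟨a, ha⟩ := hr r le_rfl ⟨(σ i).type, 0⟩
    have h1 := mem_iterate_subst_shift (t := (σ i).shift) ha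
    have h2 := mem_iterate_subst_shift (t := (σ j).shift) ha
    rw [zero_add] at h1 h2
    rw [he.1] at h2
    refine ⟨r + k, r + n, a + β ^ r * (σ i).shift, mem_iterate_subst_add.2 ⟨σ i, hσ i hi, h1⟩,
      a + β ^ r * (σ j).shift, mem_iterate_subst_add.2 ⟨σ j, hσ j hj, h2⟩, ?_⟩
    rw [pow_add]
    linear_combination (-β ^ r) * he.2
  have hi' : i ≤ t.card := by simpa [Nat.lt_succ_iff] using hi
  have hj' : j ≤ t.card := by simpa [Nat.lt_succ_iff] using hj
  rcases lt_or_gt_of_ne hne with h | h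
  · exact ⟨i, j, h, hj', key i hi' j hj' he⟩
  · exact ⟨j, i, h, hi', key j hj' i hi' he.symm⟩

/-- The elements `x` of `ℤ[β]` that are, up to a power of `β`, a difference `d - β ^ k₀ * e` of
return vectors, for all `k₀`. -/
def IsReturnDifference (hβ : IsPisot β) (x : ℝ) : Prop :=
  ∀ k₀ : ℕ, ∃ K : ℕ, ∃ e ∈ returnVectors hβ, β ^ K * x + β ^ (K + k₀) * e ∈ returnVectors hβ

lemma sum_mem_returnVectors (hβ : IsPisot β) {g h : ℝ} (hh : h ∈ returnVectors hβ) {n : ℕ}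
    (hn : ∀ g' ∈ returnVectors hβ, g + β ^ n * g' ∈ returnVectors hβ) (q : ℕ) :
    ∑ l ∈ Finset.range q, (β ^ n) ^ l * g + (β ^ n) ^ q * h ∈ returnVectors hβ := by
  induction q with
  | zero => simpa using hh
  | succ q ih =>
    have := hn _ ih
    convert this using 1
    rw [Finset.sum_range_succ', mul_add, Finset.mul_sum]
    simp only [pow_succ', pow_zero, one_mul, mul_assoc]
    ring

lemma sum_range_sub_sum_range (b g y : ℝ) (i q : ℕ) :
    (b ^ i * y - ∑ l ∈ Finset.range (i + 1), b ^ l * g) -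
        (b ^ (i + 1 + q) * y - ∑ l ∈ Finset.range (i + 1 + q + 1), b ^ l * g) =
      b ^ i * y + b ^ (i + 1) *
        (∑ l ∈ Finset.range q, b ^ l * g + b ^ q * (g - y)) := by
  have e1 : ∑ l ∈ Finset.range (i + 1 + q + 1), b ^ l * g =
      ∑ l ∈ Finset.range (i + 1), b ^ l * g +
        b ^ (i + 1) * ∑ l ∈ Finset.range (q + 1), b ^ l * g := by
    rw [add_assoc (i + 1) q 1, Finset.sum_range_add, Finset.mul_sum]
    congr 1
    refine Finset.sum_congr rfl fun l _ => ?_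
    rw [pow_add]
    ring
  rw [e1, Finset.sum_range_succ _ q, pow_add b (i + 1) q]
  ring

/-- If `g = β ^ K * x + β ^ (K + k₁) * e` and `e` are return vectors, then so are
`h = g - β ^ K * (x + t) = β ^ K * (-t + β ^ k₁ * e)` and, for large `n`, the sums
`g + β ^ n * g + ⋯ + β ^ (n * (q - 1)) * g + β ^ (n * q) * h`. These are, up to powers of `β`, the
remainders in the differences `W i - W j`, `i < j`, where
`W i = β ^ (n * i) * β ^ K * (x + t) - ∑_{l ≤ i} β ^ (n * l) * g`,
one of which is a return vector by the pigeonhole principle. -/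
lemma IsReturnDifference.add (hβ : IsPisot β) {x t : ℝ} (hx : x ∈ betaRing β)
    (h : IsReturnDifference hβ x) (ht : t ∈ returnVectors hβ) :
    IsReturnDifference hβ (x + t) := by
  intro k₀
  obtain ⟨m₁, hm₁⟩ := exists_add_mem_returnVectors hβ (neg_mem_returnVectors hβ ht)
  obtain ⟨k₁, hk₀, hkm⟩ : ∃ k₁, k₀ ≤ k₁ ∧ m₁ ≤ k₁ := ⟨_, le_max_left _ _, le_max_right _ _⟩
  obtain ⟨K, e, he, hg⟩ := h k₁
  have hh : β ^ K * x + β ^ (K + k₁) * e - β ^ K * (x + t) ∈ returnVectors hβ := by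
    have := pow_mul_mem_returnVectors hβ (hm₁ k₁ hkm e he) K
    convert this using 1
    rw [pow_add]
    ring
  generalize β ^ K * x + β ^ (K + k₁) * e = g at hg hh
  obtain ⟨m₂, hm₂⟩ := exists_add_mem_returnVectors hβ hg
  have hE := sum_mem_returnVectors hβ hh (hm₂ (K + k₀ + m₂) (by omega))
  have hy := mul_mem (pow_mem_betaRing K) (add_mem hx (returnVectors_subset_betaRing hβ ht))
  have hgR := returnVectors_subset_betaRing hβ hg
  obtain ⟨M, hM⟩ := exists_sub_mem_returnVectors hβ
  have hW : ∀ i : ℕ, (β ^ (K + k₀ + m₂)) ^ i * (β ^ K * (x + t)) -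
      ∑ l ∈ Finset.range (i + 1), (β ^ (K + k₀ + m₂)) ^ l * g ∈ betaRing β := by
    intro i
    have hb := pow_mem_betaRing (β := β) (K + k₀ + m₂)
    exact sub_mem (mul_mem (pow_mem hb i) hy) (sum_mem fun l _ => mul_mem (pow_mem hb l) hgR)
  obtain ⟨i, j, hij, -, k, hk⟩ := hM _ hW
  obtain ⟨q, rfl⟩ := Nat.exists_eq_add_of_le (Nat.succ_le_of_lt hij)
  rw [Nat.succ_eq_add_one] at hk
  rw [sum_range_sub_sum_range] at hk
  have hEq := hE q
  generalize (∑ l ∈ Finset.range q, (β ^ (K + k₀ + m₂)) ^ l * g +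
    (β ^ (K + k₀ + m₂)) ^ q * (g - β ^ K * (x + t))) = E at hk hEq
  refine ⟨k + (K + k₀ + m₂) * i + K, β ^ m₂ * E, pow_mul_mem_returnVectors hβ hEq _, ?_⟩
  convert hk using 1
  rw [pow_succ]
  simp only [pow_add, pow_mul]
  ring

/-- All elements of `ℤ[β]` are differences of return vectors, up to powers of `β`. -/
lemma isReturnDifference (hβ : IsPisot β) {x : ℝ} (hx : x ∈ betaRing β) :
    IsReturnDifference hβ x := by
  obtain ⟨P, rfl⟩ := mem_betaRing_iff.1 hx
  suffices h : ∀ y ∈ betaRing β, IsReturnDifference hβ y →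
      IsReturnDifference hβ (y + Polynomial.aeval β P) by
    have h0 := h 0 (zero_mem _) fun k₀ => ⟨0, 0, zero_mem_returnVectors hβ, by
      simpa using zero_mem_returnVectors hβ⟩
    rwa [zero_add] at h0
  clear hx
  induction P using Polynomial.induction_on' with
  | add P Q hP hQ =>
    intro y hy h
    rw [map_add, ← add_assoc]
    exact hQ _ (add_mem hy (mem_betaRing_iff.2 ⟨P, rfl⟩)) (hP y hy h)
  | monomial n a =>
    intro y hy h
    have hpow : β ^ n ∈ returnVectors hβ := by
      simpa using pow_mul_mem_returnVectors hβ (one_mem_returnVectors hβ) n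
    have hpowR : β ^ n ∈ betaRing β := returnVectors_subset_betaRing hβ hpow
    rw [Polynomial.aeval_monomial]
    simp only [algebraMap_int_eq, eq_intCast]
    induction a using Int.induction_on with
    | zero => simpa using h
    | succ a ih =>
      have := IsReturnDifference.add hβ
        (add_mem hy (mul_mem (intCast_mem (betaRing β) (a : ℤ)) hpowR)) ih hpow
      convert this using 1
      push_cast
      ring
    | pred a ih =>
      have := IsReturnDifference.add hβ
        (add_mem hy (mul_mem (intCast_mem (betaRing β) (-a : ℤ)) hpowR)) ih
        (neg_mem_returnVectors hβ hpow)
      convert this using 1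
      push_cast
      ring

/-! ### Shadowing implies strong regional proximality -/

lemma iterate_firstTile_subset (hβ : IsPisot β) (m d : ℕ) (y : ℝ) :
    subst^[m] {firstTile hβ y} ⊆ subst^[m + d] {firstTile hβ (y / β ^ d)} := by
  rw [Function.iterate_add_apply]
  refine iterate_subst_mono m (Set.singleton_subset_iff.2 ?_)
  have := firstTile_mem_subst hβ (y / β ^ d) d
  rwa [mul_div_cancel₀ _ (pow_pos hβ.pos d).ne'] at this

lemma exists_tiling_containing_iterate (hβ : IsPisot β) (n : ℕ) (g : ℝ) :
    ∃ S ∈ tilingSpace β, subst^[n] {firstTile hβ g} ⊆ S := by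
  obtain ⟨X, hX, hXn, -⟩ := exists_universal_tiling hβ
  obtain ⟨g₀, hg₀⟩ := hXn n
  refine ⟨translate X (β ^ n * (g₀ - g)), translate_mem_tilingSpace hβ hX _, ?_⟩
  have := translate_mono hg₀ (β ^ n * (g₀ - g))
  rwa [translate_iterate_firstTile, mul_div_cancel_left₀ _ (pow_pos hβ.pos n).ne',
    sub_sub_cancel] at this

/-- Two finite patches with tiles of the first type at a distance in `ℤ[β]` extend to tilings some
iterates of which share a tile. -/
lemma exists_common_tile (hβ : IsPisot β) {T T' Q Q' : Set (Tile β)} (hT : T ∈ tilingSpace β)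
    (hT' : T' ∈ tilingSpace β) (hQ : Q.Finite) (hQ' : Q'.Finite) (hQT : Q ⊆ T) (hQT' : Q' ⊆ T')
    {t t' : ℝ} (ht : firstTile hβ t ∈ Q) (ht' : firstTile hβ t' ∈ Q')
    (htt' : t - t' ∈ betaRing β) :
    ∃ K : ℕ, ∃ S ∈ tilingSpace β, ∃ S' ∈ tilingSpace β, Q ⊆ S ∧ Q' ⊆ S' ∧
      (subst^[K] S ∩ subst^[K] S').Nonempty := by
  obtain ⟨q, -, y, hy⟩ := exists_subset_iterate hβ hT hQ hQT 0
  obtain ⟨q', hqq', y', hy'⟩ := exists_subset_iterate hβ hT' hQ' hQT' q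
  obtain ⟨d, rfl⟩ := Nat.exists_eq_add_of_le hqq'
  replace hy := hy.trans (iterate_firstTile_subset hβ q d y)
  generalize y / β ^ d = y at hy
  clear hqq'
  generalize q + d = q at hy hy'
  obtain ⟨C, -, hC⟩ := exists_bddConj_shift hβ
  have h1 := (hC q _ _ (hy ht)).mem
  have h2 := (hC q _ _ (hy' ht')).mem
  simp only [firstTile] at h1 h2
  have hx : β ^ q * (y - y') ∈ betaRing β := by
    have := sub_mem htt' (sub_mem h1 h2)
    convert this using 1
    ring
  obtain ⟨K, _, ⟨M₁, u, hu, u', hu', rfl⟩, M₂, v, hv, v', hv', hvv'⟩ :=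
    isReturnDifference hβ hx q
  set M := max M₁ M₂
  have hp : β ^ M ≠ 0 := (pow_pos hβ.pos M).ne'
  have hmono : ∀ {a : ℝ}, a ∈ positions hβ M₂ → a ∈ positions hβ (K + (q + M)) := fun h =>
    positions_mono hβ (by have := le_max_right M₁ M₂; omega) h
  -- the patch `Q` occurs around the tile at `u'` and is moved to its actual place
  have place : ∀ (P : Set (Tile β)) (y u v : ℝ), P ⊆ subst^[q] {firstTile hβ y} →
      u ∈ positions hβ M₁ → v ∈ positions hβ M₂ → ∃ S ∈ tilingSpace β, P ⊆ S ∧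
        firstTile hβ (v + β ^ (K + q) * (y - u)) ∈ subst^[K] S := by
    intro P y u v hP hu hv
    obtain ⟨S, hS, hsub⟩ := exists_tiling_containing_iterate hβ (q + M) ((y - u) / β ^ M)
    refine ⟨S, hS, hP.trans (Set.Subset.trans ?_ hsub), ?_⟩
    · rw [Function.iterate_add_apply]
      refine iterate_subst_mono q (Set.singleton_subset_iff.2 ?_)
      have := mem_iterate_subst_firstTile_shift hβ
        (positions_mono hβ (le_max_left M₁ M₂) hu) ((y - u) / β ^ M)
      rwa [mul_div_cancel₀ _ hp, add_sub_cancel] at this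
    · have := mem_iterate_subst_firstTile_shift hβ (hmono hv) ((y - u) / β ^ M)
      rw [← add_assoc, pow_add, mul_assoc, mul_div_cancel₀ _ hp, add_assoc,
        Function.iterate_add_apply] at this
      exact iterate_subst_mono K hsub this
  obtain ⟨S, hS, hQS, hσ⟩ := place Q y u' v' hy hu' hv'
  obtain ⟨S', hS', hQS', hσ'⟩ := place Q' y' u v hy' hu hv
  refine ⟨K, S, hS, S', hS', hQS, hQS', _, hσ, ?_⟩
  convert hσ' using 2
  rw [pow_add] at hvv' ⊢
  linear_combination -hvv'

lemma iterate_subst_inter_nonempty (hβ : IsPisot β) {S S' : Set (Tile β)} {K n : ℕ} (h : K ≤ n)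
    (hne : (subst^[K] S ∩ subst^[K] S').Nonempty) : (subst^[n] S ∩ subst^[n] S').Nonempty := by
  obtain ⟨σ, h1, h2⟩ := hne
  obtain ⟨d, rfl⟩ := Nat.exists_eq_add_of_le h
  obtain ⟨ρ, hρ, -⟩ := exists_mem_iterate_subst hβ (n := d) (τ := σ) le_rfl
    (mul_lt_mul_of_pos_left (σ.min_lt_max hβ) (pow_pos hβ.pos d))
  rw [add_comm K d]
  exact ⟨ρ, mem_iterate_subst_add.2 ⟨σ, h1, hρ⟩, mem_iterate_subst_add.2 ⟨σ, h2, hρ⟩⟩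

/-- Up to translation, there are only finitely many patches of a given size. -/
lemma finite_patches (hβ : IsPisot β) (R : ℝ) :
    {P | ∃ T ∈ tilingSpace β, P = translate (centralPatch R T) (tStar T)}.Finite := by
  obtain ⟨C, -, hC⟩ := exists_bddConj_shift_sub hβ
  obtain ⟨C₀, -, hC₀⟩ := exists_tStar_spec hβ
  have hfin := (Set.finite_univ (α := Fin (numTiles β))).prod
    (finite_bddConj hβ (|R| + 1 + C₀) C)
  refine (hfin.image fun p : Fin (numTiles β) × ℝ => (⟨p.1, p.2⟩ : Tile β)).finite_subsets.subset ?_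
  rintro P ⟨T, hT, rfl⟩ _ ⟨τ, ⟨hτ, z, hz1, hz2⟩, rfl⟩
  obtain ⟨h1, h2, h3⟩ := hC₀ T hT
  refine ⟨(τ.type, τ.shift - tStar T), ⟨trivial, ?_, hC T hT τ hτ _ h1⟩, rfl⟩
  have h4 := τ.shift_le_min hβ
  have h5 := τ.max_le_shift_add_one hβ
  rw [abs_le]
  constructor <;> linarith [le_abs_self R, hz1.1, hz1.2, hz2.1, hz2.2]

lemma translate_subset_iff {P Q : Set (Tile β)} {t : ℝ} :
    translate P t ⊆ Q ↔ P ⊆ translate Q (-t) := by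
  constructor <;> intro h
  · simpa [translate_translate, translate_zero] using translate_mono h (-t)
  · simpa [translate_translate, translate_zero] using translate_mono h t

/-- The exponent in `exists_common_tile` is bounded when only finitely many relative positions
occur. -/
lemma exists_uniform_common_tile (hβ : IsPisot β) {F : Set ℝ} (hF : F.Finite)
    (hFR : F ⊆ betaRing β) {R : ℝ} (hR : ∀ T ∈ tilingSpace β, |tStar T| ≤ R) :
    ∃ K : ℕ, ∀ T ∈ tilingSpace β, ∀ T' ∈ tilingSpace β, tStar T - tStar T' ∈ F →
      ∃ S ∈ tilingSpace β, ∃ S' ∈ tilingSpace β, centralPatch R T ⊆ S ∧ centralPatch R T' ⊆ S' ∧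
        (subst^[K] S ∩ subst^[K] S').Nonempty := by
  obtain ⟨C₀, -, hC₀⟩ := exists_tStar_spec hβ
  let Ps := {P : Set (Tile β) | ∃ T ∈ tilingSpace β, P = translate (centralPatch R T) (tStar T)}
  have hfin : (Ps ×ˢ (Ps ×ˢ F)).Finite := (finite_patches hβ R).prod ((finite_patches hβ R).prod hF)
  let G : Set (Tile β) × Set (Tile β) × ℝ → ℕ → Prop := fun p K =>
    ∃ S ∈ tilingSpace β, ∃ S' ∈ tilingSpace β, p.1 ⊆ S ∧ translate p.2.1 p.2.2 ⊆ S' ∧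
        (subst^[K] S ∩ subst^[K] S').Nonempty
  have hmem : ∀ T ∈ tilingSpace β, firstTile hβ (tStar T) ∈ centralPatch R T := fun T hT =>
    mem_centralPatch_of_mem_ico (hC₀ T hT).1 (y := tStar T)
      (by simpa [firstTile_min] using (firstTile hβ (tStar T)).min_mem_ico hβ) (hR T hT)
  have hG : ∀ p : Set (Tile β) × Set (Tile β) × ℝ, ∃ K : ℕ,
      (∃ K', G p K') → G p K := fun p => by
    by_cases h : ∃ K', G p K'
    · exact ⟨h.choose, fun _ => h.choose_spec⟩
    · exact ⟨0, fun h' => absurd h' h⟩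
  choose f hf using hG
  obtain ⟨K, hK⟩ := (hfin.image f).bddAbove
  refine ⟨K, fun T hT T' hT' htt' => ?_⟩
  set p : Set (Tile β) × Set (Tile β) × ℝ := (translate (centralPatch R T) (tStar T),
    translate (centralPatch R T') (tStar T'), tStar T - tStar T') with hp
  have e : translate p.2.1 p.2.2 = translate (centralPatch R T') (tStar T) := by
    simp only [hp, translate_translate, sub_add_cancel]
  have hGp : G p (f p) := by
    refine hf p ?_
    obtain ⟨K', S, hS, S', hS', h1, h2, h3⟩ := exists_common_tile hβ hT hT'
      (finite_centralPatch hβ hT.1.packed R) (finite_centralPatch hβ hT'.1.packed R)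
      (centralPatch_subset _ _) (centralPatch_subset _ _) (hmem T hT) (hmem T' hT') (hFR htt')
    refine ⟨K', _, translate_mem_tilingSpace hβ hS (tStar T), _,
      translate_mem_tilingSpace hβ hS' (tStar T), translate_mono h1 _, ?_, ?_⟩
    · rw [e]
      exact translate_mono h2 _
    · obtain ⟨σ, hσ, hσ'⟩ := h3
      rw [iterate_subst_translate, iterate_subst_translate]
      exact ⟨_, ⟨σ, hσ, rfl⟩, ⟨σ, hσ', rfl⟩⟩
  obtain ⟨S, hS, S', hS', h1, h2, h3⟩ := hGp
  rw [e] at h2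
  have hle : f p ≤ K := hK ⟨p, ⟨⟨T, hT, rfl⟩, ⟨T', hT', rfl⟩, htt'⟩, rfl⟩
  refine ⟨_, translate_mem_tilingSpace hβ hS (-tStar T), _,
    translate_mem_tilingSpace hβ hS' (-tStar T), translate_subset_iff.1 h1,
    translate_subset_iff.1 h2, iterate_subst_inter_nonempty hβ hle ?_⟩
  obtain ⟨σ, hσ, hσ'⟩ := h3
  rw [iterate_subst_translate, iterate_subst_translate]
  exact ⟨_, ⟨σ, hσ, rfl⟩, ⟨σ, hσ', rfl⟩⟩

lemma IsOrbit.iterate {U : ℤ → Set (Tile β)} (h : IsOrbit β U) (i : ℤ) (n : ℕ) :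
    subst^[n] (U i) = U (i + n) := by
  induction n with
  | zero => simp
  | succ n ih =>
    rw [Function.iterate_succ_apply', ih, (h _).2]
    congr 1
    push_cast
    ring

/-- If the relative positions of the tiles at `t_*` in two orbits take finitely many values, all
of them in `ℤ[β]`, then the tilings are strongly regionally proximal. -/
lemma stronglyRegionallyProximal_of_finite (hβ : IsPisot β) {U U' : ℤ → Set (Tile β)}
    (hU : IsOrbit β U) (hU' : IsOrbit β U') {F : Set ℝ} (hF : F.Finite) (hFR : F ⊆ betaRing β)
    (h : ∀ i, tStar (U i) - tStar (U' i) ∈ F) : StronglyRegionallyProximal β (U 0) (U' 0) := by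
  intro R hR
  obtain ⟨C₀, hC1, hC₀⟩ := exists_tStar_spec hβ
  obtain ⟨δ, hδ0, -, hδ⟩ := exists_len_bound hβ
  obtain ⟨K, hK⟩ := exists_uniform_common_tile hβ hF hFR (R := C₀) fun T hT => by
    have := hC₀ T hT
    rw [abs_le]
    constructor <;> linarith
  obtain ⟨n₁, hn₁⟩ := exists_pow_gt hβ R
  obtain ⟨n₂, hn₂⟩ := exists_pow_gt hβ (2 * R / δ)
  set n := max n₁ n₂ + K
  have hpow : ∀ k : ℕ, 0 < β ^ k := fun k => pow_pos hβ.pos k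
  obtain ⟨S, hS, S', hS', h1, h2, σ, hσ, hσ'⟩ := hK _ (hU (-n)).1 _ (hU' (-n)).1 (h (-n))
  have hn : ∀ {V : ℤ → Set (Tile β)}, IsOrbit β V → subst^[n] (V (-n)) = V 0 := fun hV => by
    rw [hV.iterate, neg_add_cancel]
  have agree : ∀ {V : ℤ → Set (Tile β)} {Z : Set (Tile β)}, IsOrbit β V → Z ∈ tilingSpace β →
      centralPatch C₀ (V (-n)) ⊆ Z → centralPatch R (V 0) = centralPatch R (subst^[n] Z) := by
    intro V Z hV hZ hsub
    rw [← hn hV]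
    refine centralPatch_eq_of_covers hβ ((hV _).1.1.packed.iterate_subst hβ n)
      (hZ.1.packed.iterate_subst hβ n) (iterate_subst_mono n (centralPatch_subset C₀ _))
      (iterate_subst_mono n hsub) (R' := β ^ n * C₀) ?_ ?_
    · have h3 := hn₁ n (by have := le_max_left n₁ n₂; omega)
      have h4 := le_mul_of_one_le_right (hpow n).le hC1
      linarith
    · have := ((hV (-n)).1.1.centralPatch_covers hβ C₀).iterate_subst hβ n
      rwa [mul_neg] at this
  set m := max n₁ n₂
  set a := β ^ m * σ.min
  set b := β ^ m * σ.max
  have hab : 2 * R < b - a := by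
    have h3 := hn₂ m (le_max_right _ _)
    rw [div_lt_iff₀ hδ0] at h3
    have h4 := mul_le_mul_of_nonneg_left (hδ σ.type) (hpow m).le
    have e : b - a = β ^ m * len β σ.type := by
      simp only [a, b, σ.max_eq]
      ring
    linarith
  refine ⟨_, iterate_subst_mem_tilingSpace hβ hS n, _, iterate_subst_mem_tilingSpace hβ hS' n,
    (a + b) / 2, agree hU hS h1, agree hU' hS' h2, ?_⟩
  have hsub : ∀ {Z : Set (Tile β)}, σ ∈ subst^[K] Z → subst^[m] {σ} ⊆ subst^[n] Z := fun h => by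
    have : n = m + K := rfl
    rw [this, Function.iterate_add_apply]
    exact iterate_subst_mono m (Set.singleton_subset_iff.2 h)
  refine centralPatch_eq_of_covers hβ ((hS.1.packed.iterate_subst hβ n).translate _)
    ((hS'.1.packed.iterate_subst hβ n).translate _) (translate_mono (hsub hσ) _)
    (translate_mono (hsub hσ') _) (R' := (b - a) / 2) (by linarith) ?_
  have := (covers_iterate_subst_singleton hβ σ m).translate ((a + b) / 2)
  convert this using 1 <;> simp only [a, b] <;> ring

/-! ### Runs in tilings -/

/-- The positions of the tiles of the first type, that is, the initial points of the runs. -/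
def starts (hβ : IsPisot β) (T : Set (Tile β)) : Set ℝ := {z | firstTile hβ z ∈ T}

lemma shift_mem_starts (hβ : IsPisot β) {T : Set (Tile β)} (hT : T ∈ tilingSpace β) {σ : Tile β}
    (hσ : σ ∈ T) : σ.shift ∈ starts hβ T :=
  run_left hβ hT.1.packed (hasRuns_of_mem_tilingSpace hβ hT) hσ le_rfl (hT.1.covers hβ _ _) _
    (Nat.zero_le _)

lemma starts_not_between (hβ : IsPisot β) {T : Set (Tile β)} (hT : T ∈ tilingSpace β) {σ : Tile β}
    (hσ : σ ∈ T) {z : ℝ} (hz : z ∈ starts hβ T) (h1 : σ.shift < z) : σ.max ≤ z := by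
  by_contra h2
  obtain ⟨i, h3, h4⟩ := exists_vtx_interval hβ (x := z - σ.shift) (by linarith) (by
    have := σ.max_le_shift_add_one hβ
    linarith)
  have hi : (i : ℕ) ≤ σ.type := by
    have h5 : vtx β i < vtx β (σ.type + 1) := by
      unfold Tile.max at h2
      linarith
    rw [vtx_lt_vtx_iff hβ i.2.le σ.type.2] at h5
    omega
  have hmem : (⟨i, σ.shift⟩ : Tile β) ∈ T :=
    run_left hβ hT.1.packed (hasRuns_of_mem_tilingSpace hβ hT) hσ le_rfl (hT.1.covers hβ _ _) i hi
  have e := hT.1.packed _ hmem _ hz z ⟨by simp only [Tile.min]; linarith, by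
    simp only [Tile.max]; linarith⟩ (by
      simpa [firstTile_min] using (firstTile hβ z).min_mem_ico hβ)
  have := congrArg Tile.shift e
  simp only [firstTile] at this
  linarith

lemma mem_of_starts (hβ : IsPisot β) {T : Set (Tile β)} (hT : T ∈ tilingSpace β) {σ : Tile β}
    (h1 : σ.shift ∈ starts hβ T) (h2 : ∀ z ∈ starts hβ T, σ.shift < z → σ.max ≤ z) : σ ∈ T := by
  obtain ⟨ρ, hρ, hy⟩ := hT.1.exists_mem hβ σ.min
  have h3 := shift_mem_starts hβ hT hρ
  have h4 := σ.min_lt_max hβ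
  have h5 := σ.shift_le_min hβ
  have h6 := ρ.shift_le_min hβ
  have e : ρ.shift = σ.shift := by
    rcases lt_trichotomy ρ.shift σ.shift with h | h | h
    · have := starts_not_between hβ hT hρ h1 h
      linarith [hy.2]
    · exact h
    · have := h2 _ h3 h
      linarith [hy.1]
  rwa [← eq_of_mem_ico_of_int hβ (k := 0) (by simp [e]) hy (σ.min_mem_ico hβ)]

/-- The runs of the image of a tiling begin at the points `β z + k`, where `z` is the initial point
of a run, `k ∈ ℕ`, and `β z + k` lies in the inflated run. -/
lemma mem_starts_subst (hβ : IsPisot β) {T : Set (Tile β)} (hT : T ∈ tilingSpace β) {e : ℝ} :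
    e ∈ starts hβ (subst T) ↔ ∃ z ∈ starts hβ T, ∃ k : ℕ, e = β * z + k ∧
      ∀ w ∈ starts hβ T, z < w → e < β * w := by
  have hpos := hβ.pos
  constructor
  · intro h
    obtain ⟨τ, hτ, hσ⟩ := mem_subst.1 h
    have hb := substTile_bounds hσ
    have hlt := (firstTile hβ e).min_lt_max hβ
    obtain ⟨k, -, hk⟩ := hσ
    rw [firstTile_min] at hb hlt
    have h1 : β * τ.shift ≤ β * τ.min := mul_le_mul_of_nonneg_left (τ.shift_le_min hβ) hpos.le
    have hk0 : 0 ≤ k := by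
      have : (0 : ℝ) ≤ k := by
        have : e = β * τ.shift + k := hk
        linarith
      exact_mod_cast this
    obtain ⟨n, rfl⟩ := Int.eq_ofNat_of_zero_le hk0
    refine ⟨_, shift_mem_starts hβ hT hτ, n, by simpa [firstTile] using hk, fun w hw hzw => ?_⟩
    have := mul_le_mul_of_nonneg_left (starts_not_between hβ hT hτ hw hzw) hpos.le
    linarith
  · rintro ⟨z, hz, k, rfl, hw⟩
    obtain ⟨σ, hσ, hy⟩ := (subst_mem_tilingSpace hβ hT).1.exists_mem hβ (β * z + k)
    obtain ⟨τ, hτ, hστ⟩ := mem_subst.1 hσ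
    have hb := substTile_bounds hστ
    have h1 := τ.shift_le_min hβ
    have h2 := shift_mem_starts hβ hT hτ
    have e : τ.shift = z := by
      rcases lt_trichotomy τ.shift z with h | h | h
      · have h3 := mul_le_mul_of_nonneg_left (starts_not_between hβ hT hτ hz h) hpos.le
        have h4 : (0 : ℝ) ≤ k := Nat.cast_nonneg k
        linarith [hy.2]
      · exact h
      · have h3 := hw _ h2 h
        have h4 := mul_le_mul_of_nonneg_left h1 hpos.le
        linarith [hy.1]
    obtain ⟨k', -, hk'⟩ := hστ
    have := eq_of_mem_ico_of_int hβ (σ' := firstTile hβ (β * z + k)) (k := k - k') (by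
      rw [hk', e]
      simp [firstTile]) hy (by simpa [firstTile_min] using
        (firstTile hβ (β * z + k)).min_mem_ico hβ)
    rwa [this] at hσ

lemma mul_mem_starts_subst (hβ : IsPisot β) {T : Set (Tile β)} (hT : T ∈ tilingSpace β) {z : ℝ}
    (hz : z ∈ starts hβ T) : β * z ∈ starts hβ (subst T) :=
  (mem_starts_subst hβ hT).2 ⟨z, hz, 0, by simp, fun _ _ h => mul_lt_mul_of_pos_left h hβ.pos⟩

/-- A run that begins at a distance less than `1` from the beginning of another run, is the first
one in an inflated run. -/
lemma div_mem_starts (hβ : IsPisot β) {T : Set (Tile β)} (hT : T ∈ tilingSpace β) {e u : ℝ}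
    (he : e ∈ starts hβ (subst T)) (hu : u ∈ starts hβ (subst T)) (h1 : e - 1 < u) (h2 : u < e) :
    ∃ z ∈ starts hβ T, e = β * z := by
  have hpos := hβ.pos
  obtain ⟨z, hz, k, hk, hw⟩ := (mem_starts_subst hβ hT).1 he
  obtain ⟨z₂, hz₂, k₂, hk₂, hw₂⟩ := (mem_starts_subst hβ hT).1 hu
  rcases Nat.eq_zero_or_pos k with h0 | h0
  · exact ⟨z, hz, by simp [hk, h0]⟩
  · exfalso
    have h3 : (1 : ℝ) ≤ k := by exact_mod_cast h0
    have h4 : (0 : ℝ) ≤ k₂ := Nat.cast_nonneg _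
    rcases lt_trichotomy z₂ z with h | h | h
    · have := hw₂ z hz h
      linarith
    · subst h
      have h5 : (k : ℝ) < k₂ + 1 := by linarith
      have h6 : (k₂ : ℝ) < k := by linarith
      have h5' : k < k₂ + 1 := by exact_mod_cast h5
      have h6' : k₂ < k := by exact_mod_cast h6
      omega
    · have := hw z₂ hz₂ h
      linarith

lemma exists_pred_starts (hβ : IsPisot β) {T : Set (Tile β)} (hT : T ∈ tilingSpace β) {v : ℝ}
    (hv : v ∈ starts hβ T) : ∃ x ∈ starts hβ T, x < v ∧ v - x ∈ vertexSet β ∧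
      ∀ w ∈ starts hβ T, x < w → v ≤ w := by
  obtain ⟨ρ, hρ, hmax⟩ := exists_pred hβ hT.1.packed hv (a := v - 1)
    (by rw [firstTile_min]; linarith) (hT.1.covers hβ _ _)
  rw [firstTile_min] at hmax
  refine ⟨ρ.shift, shift_mem_starts hβ hT hρ, ?_, ?_, fun w hw h => ?_⟩
  · have h1 := ρ.shift_le_min hβ
    have h2 := ρ.min_lt_max hβ
    linarith
  · rw [← hmax, Tile.max, add_sub_cancel_right]
    exact vtx_mem hβ ρ.type.2
  · rw [← hmax]
    exact starts_not_between hβ hT hρ hw h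

/-- The length of the last run in the image of a run of length `r`. -/
def lastLen (β r : ℝ) : ℝ := β * r - ⌈β * r⌉ + 1

lemma lastLen_pos (r : ℝ) : 0 < lastLen β r := by
  have := Int.ceil_lt_add_one (β * r)
  unfold lastLen
  linarith

lemma lastLen_le_one (r : ℝ) : lastLen β r ≤ 1 := by
  have := Int.le_ceil (β * r)
  unfold lastLen
  linarith

/-- If `x < v` are successive starts of runs in `T`, then the last run in the image of the run
from `x` to `v` starts at distance `lastLen β (v - x)` from its end `β * v`. -/
lemma sub_lastLen_spec (hβ : IsPisot β) {T : Set (Tile β)} (hT : T ∈ tilingSpace β) {v x : ℝ}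
    (hx : x ∈ starts hβ T) (hxv : x < v)
    (hpred : ∀ w ∈ starts hβ T, x < w → v ≤ w) :
    β * v - lastLen β (v - x) ∈ starts hβ (subst T) ∧
      ∀ u ∈ starts hβ (subst T), β * v - lastLen β (v - x) < u → β * v ≤ u := by
  have hpos := hβ.pos
  have hc : 0 < β * (v - x) := mul_pos hpos (by linarith)
  have hceil : 0 < ⌈β * (v - x)⌉ := Int.ceil_pos.2 hc
  obtain ⟨k, hk⟩ := Int.eq_ofNat_of_zero_le (show 0 ≤ ⌈β * (v - x)⌉ - 1 by omega)
  have hk' : lastLen β (v - x) = β * (v - x) - k := by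
    have : ((⌈β * (v - x)⌉ - 1 : ℤ) : ℝ) = ((k : ℤ) : ℝ) := by rw [hk]
    push_cast at this
    unfold lastLen
    linarith
  have h0 := lastLen_pos (β := β) (v - x)
  have h1 := lastLen_le_one (β := β) (v - x)
  rw [hk'] at h0 h1 ⊢
  constructor
  · refine (mem_starts_subst hβ hT).2 ⟨x, hx, k, by ring, fun w hw hxw => ?_⟩
    have := mul_le_mul_of_nonneg_left (hpred w hw hxw) hpos.le
    linarith
  · intro u hu hlt
    by_contra hcon
    obtain ⟨z, hz, k₂, hk₂, hw⟩ := (mem_starts_subst hβ hT).1 hu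
    have h2 : (0 : ℝ) ≤ k₂ := Nat.cast_nonneg _
    have h3 : (0 : ℝ) ≤ k := Nat.cast_nonneg _
    rcases lt_trichotomy z x with h | h | h
    · have := hw x hx h
      linarith
    · subst h
      have h5 : (k : ℝ) < k₂ := by linarith
      have h6 : (k₂ : ℝ) < k + 1 := by linarith
      have h5' : k < k₂ := by exact_mod_cast h5
      have h6' : k₂ < k + 1 := by exact_mod_cast h6
      omega
    · have := mul_le_mul_of_nonneg_left (hpred z hz h) hpos.le
      linarith

lemma lastLen_eq_of_betaMap_ne_zero {r : ℝ} (h : betaMap β r ≠ 0) :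
    lastLen β r = betaMap β r := by
  have h1 : ⌈β * r⌉ = ⌊β * r⌋ + 1 := by
    rw [Int.ceil_eq_iff]
    have h2 := Int.lt_floor_add_one (β * r)
    have h3 := lt_of_le_of_ne (betaMap_nonneg (β := β) r) (Ne.symm h)
    unfold betaMap at h3
    push_cast
    constructor <;> linarith
  unfold lastLen betaMap
  rw [h1]
  push_cast
  ring

lemma betaMap_eq_of_lastLen_eq {r r' : ℝ} (h : lastLen β r = lastLen β r') :
    betaMap β r = betaMap β r' := by
  have e : β * r' = β * r + ((⌈β * r'⌉ - ⌈β * r⌉ : ℤ) : ℝ) := by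
    unfold lastLen at h
    push_cast
    linarith
  change Int.fract (β * r) = Int.fract (β * r')
  rw [e, Int.fract_add_intCast]

/-- If the orbit of `1` reaches `0`, then the `β`-transformation is injective on the orbit before
that. -/
lemma betaMap_injOn (hm : ∃ m, (betaMap β)^[m] 1 = 0) {r r' : ℝ} (hr : r ∈ vertexSet β)
    (hr0 : 0 < r) (hr' : r' ∈ vertexSet β) (hr0' : 0 < r') (h : betaMap β r = betaMap β r') :
    r = r' := by
  classical
  rcases hr with hr | ⟨i, rfl⟩
  · exact absurd (Set.mem_singleton_iff.1 hr) hr0.ne'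
  rcases hr' with hr' | ⟨j, rfl⟩
  · exact absurd (Set.mem_singleton_iff.1 hr') hr0'.ne'
  have hspec := Nat.find_spec hm
  have hmin := fun n => Nat.find_min hm (m := n)
  set m := Nat.find hm
  have hzero : ∀ n, (betaMap β)^[n] 0 = 0 := fun n => Function.iterate_fixed betaMap_zero n
  have hlt : ∀ n, 0 < (betaMap β)^[n] 1 → n < m := fun n hn => by
    by_contra hc
    obtain ⟨d, rfl⟩ := Nat.exists_eq_add_of_le (not_lt.1 hc)
    rw [add_comm, Function.iterate_add_apply, hspec, hzero] at hn
    exact lt_irrefl _ hn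
  have key : ∀ i j, i < j → j < m →
      betaMap β ((betaMap β)^[i] 1) ≠ betaMap β ((betaMap β)^[j] 1) := by
    intro i j hij hj he
    rw [← Function.iterate_succ_apply' (betaMap β),
      ← Function.iterate_succ_apply' (betaMap β)] at he
    have := congrArg (betaMap β)^[m - 1 - j] he
    rw [← Function.iterate_add_apply, ← Function.iterate_add_apply,
      show m - 1 - j + j.succ = m by omega, hspec] at this
    exact hmin _ (by omega) this
  rcases lt_trichotomy i j with hij | rfl | hij
  · exact absurd h (key i j hij (hlt j hr0'))
  · rfl
  · exact absurd h.symm (key j i hij (hlt i hr0))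

/-! ### Recognizability -/

lemma finite_starts (hβ : IsPisot β) {T : Set (Tile β)} (hT : T ∈ tilingSpace β) (a b : ℝ) :
    (starts hβ T ∩ Set.Icc a b).Finite := by
  refine Set.Finite.of_finite_image (f := firstTile hβ) ((hT.1.packed.finite hβ a b).subset ?_)
    fun x _ y _ h => congrArg Tile.shift h
  rintro _ ⟨z, ⟨hz, h1, h2⟩, rfl⟩
  have := (firstTile hβ z).min_lt_max hβ
  rw [firstTile_min] at this
  exact ⟨hz, h1.trans this.le, by rwa [firstTile_min]⟩

/-- Runs of length `1` are relatively dense. -/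
lemma exists_full_run (hβ : IsPisot β) : ∃ C, 1 ≤ C ∧ ∀ T ∈ tilingSpace β, ∀ x : ℝ,
    ∃ v ∈ starts hβ T, v - 1 ∈ starts hβ T ∧ x ≤ v ∧ v ≤ x + C ∧
      ∀ w ∈ starts hβ T, v - 1 < w → v ≤ w := by
  obtain ⟨C, hC1, hC⟩ := exists_relatively_dense hβ
  refine ⟨2 * C, by linarith, fun T hT x => ?_⟩
  have hN := numTiles_pos hβ
  obtain ⟨l, hl, hj, h1, h2⟩ := hC T hT (x + C) ⟨numTiles β - 1, by omega⟩
  have hlt := l.min_lt_max hβ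
  have hlmax : l.max = l.shift + 1 := by
    simp only [Tile.max, hj]
    rw [Nat.sub_add_cancel hN, vtx_numTiles hβ]
    ring
  have hs := shift_mem_starts hβ hT hl
  have e : l.max - 1 = l.shift := by rw [hlmax]; ring
  have hmem : l.max ∈ starts hβ T := by
    obtain ⟨σ, hσ, hy⟩ := hT.1.exists_mem hβ l.max
    have h3 : σ.min = l.max := by
      refine le_antisymm hy.1 ?_
      rcases lt_trichotomy σ.min l.min with h | h | h
      · have := hT.1.packed.max_le_min hβ hσ hl h
        linarith [hy.2]
      · have := hT.1.packed σ hσ l hl σ.min (σ.min_mem_ico hβ)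
          (by rw [h]; exact l.min_mem_ico hβ)
        rw [this] at hy
        exact absurd hy.2 (lt_irrefl _)
      · exact hT.1.packed.max_le_min hβ hl hσ h
    have h0 : (σ.type : ℕ) = 0 := by
      by_contra h0
      have h4 := (hasRuns_of_mem_tilingSpace hβ hT l hl σ hσ h3.symm h0).2
      rw [hj] at h4
      have := σ.type.2
      simp only at h4
      omega
    rw [eq_firstTile hβ h0, firstTile_min] at h3
    rw [eq_firstTile hβ h0, h3] at hσ
    exact hσ
  refine ⟨l.max, hmem, by rwa [e], by linarith, by linarith, fun w hw h => ?_⟩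
  rw [e] at h
  exact starts_not_between hβ hT hl hw h

/-- The initial points of the runs of `X` in a window are determined by those of `Ψ(X)`: if the
orbit of `1` does not reach `0`, then they correspond to the ends of the runs of length less than
`1`; otherwise the length of a run of `X` is determined by the length of the last run of its image,
so that `X` can be decoded from the right to the left. -/
lemma exists_starts_subset (hβ : IsPisot β) (hN : β ∉ Set.range ((↑) : ℕ → ℝ)) :
    ∃ c, 0 < c ∧ ∀ X ∈ tilingSpace β, ∀ Y ∈ tilingSpace β, ∀ R : ℝ, 0 < R →
      (∀ e, |e| ≤ β * R + c → (e ∈ starts hβ (subst X) ↔ e ∈ starts hβ (subst Y))) →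
      ∀ z, |z| ≤ R → z ∈ starts hβ X → z ∈ starts hβ Y := by
  have hpos := hβ.pos
  obtain ⟨C, hC1, hC⟩ := exists_full_run hβ
  refine ⟨β * C + 1, by positivity, fun X hX Y hY R hR hXY z hz hzX => ?_⟩
  have hwin : ∀ v s, -R ≤ v → v ≤ R + C → 0 ≤ s → s ≤ 1 → |β * v - s| ≤ β * R + (β * C + 1) := by
    intro v s h1 h2 h3 h4
    have h5 := mul_le_mul_of_nonneg_left h1 hpos.le
    have h6 := mul_le_mul_of_nonneg_left h2 hpos.le
    rw [abs_le]
    constructor <;> nlinarith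
  have hz' := abs_le.1 hz
  -- the initial point of a run, preceded by a run the image of which ends with a shorter one
  have marker : ∀ v ∈ starts hβ X, -R ≤ v → v ≤ R + C → ∀ x ∈ starts hβ X, x < v →
      (∀ w ∈ starts hβ X, x < w → v ≤ w) → betaMap β (v - x) ≠ 0 → v ∈ starts hβ Y := by
    intro v hv h1 h2 x hx hxv hpred hne
    have h3 := (sub_lastLen_spec hβ hX hx hxv hpred).1
    have h4 := lastLen_pos (β := β) (v - x)
    have h5 : lastLen β (v - x) < 1 := by
      rw [lastLen_eq_of_betaMap_ne_zero hne]
      exact betaMap_lt_one _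
    have h6 := (hXY _ (hwin v _ h1 h2 h4.le h5.le)).1 h3
    have h7 : β * v ∈ starts hβ (subst Y) := by
      refine (hXY _ ?_).1 (mul_mem_starts_subst hβ hX hv)
      simpa using hwin v 0 h1 h2 le_rfl zero_le_one
    obtain ⟨w, hw, he⟩ := div_mem_starts hβ hY h7 h6 (by linarith) (by linarith)
    rwa [mul_left_cancel₀ hpos.ne' he]
  by_cases hm : ∃ m, (betaMap β)^[m] 1 = 0
  swap
  · obtain ⟨x, hx, hxz, hvert, hpred⟩ := exists_pred_starts hβ hX hzX
    refine marker z hzX hz'.1 (by linarith [hz'.2]) x hx hxz hpred fun h0 => hm ?_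
    rcases hvert with h | ⟨n, hn⟩
    · exact absurd (Set.mem_singleton_iff.1 h) (by linarith : (0 : ℝ) < z - x).ne'
    · exact ⟨n + 1, by rw [Function.iterate_succ_apply', ← hn, h0]⟩
  · obtain ⟨v, hv, hv1, hRv, hvC, hvpred⟩ := hC X hX R
    have hvY : v ∈ starts hβ Y := by
      refine marker v hv (by linarith) hvC (v - 1) hv1 (by linarith) hvpred fun h0 => hN ?_
      rw [sub_sub_cancel] at h0
      have h1 : (0 : ℤ) ≤ ⌊β⌋ := Int.floor_nonneg.2 hpos.le
      obtain ⟨n, hn⟩ := Int.eq_ofNat_of_zero_le h1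
      refine ⟨n, ?_⟩
      simp only [betaMap, mul_one, hn] at h0
      have : β - (n : ℝ) = 0 := by simpa using h0
      linarith
    -- the rightmost initial point of a run in only one of the two tilings
    by_contra hzY
    have key : ∀ X Y : Set (Tile β), X ∈ tilingSpace β → Y ∈ tilingSpace β →
        (∀ e, |e| ≤ β * R + (β * C + 1) →
          (e ∈ starts hβ (subst X) ↔ e ∈ starts hβ (subst Y))) →
        v ∈ starts hβ X → v ∈ starts hβ Y → ∀ w, -R ≤ w → w ≤ v → w ∈ starts hβ X →
        w ∉ starts hβ Y → (∀ u, w < u → u ≤ v → u ∈ starts hβ X → u ∈ starts hβ Y) → False := by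
      intro X Y hX hY hXY hv hvY w hRw hwv hwX hwY hmax
      have hwv' : w < v := lt_of_le_of_ne hwv fun h => hwY (h ▸ hvY)
      obtain ⟨u, ⟨⟨huX, -, huv⟩, hwu⟩, humin⟩ := Set.exists_min_image
        {u | u ∈ starts hβ X ∩ Set.Icc w v ∧ w < u} id
        ((finite_starts hβ hX w v).subset fun u h => h.1) ⟨v, ⟨hv, hwv, le_rfl⟩, hwv'⟩
      have hpredX : ∀ s ∈ starts hβ X, w < s → u ≤ s := fun s hs h => by
        by_contra hc
        exact hc (humin s ⟨⟨hs, h.le, by linarith⟩, h⟩)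
      have huY := hmax u hwu huv huX
      obtain ⟨x, hx, hxu, hxvert, hxpred⟩ := exists_pred_starts hβ hX huX
      have hxw : x = w := by
        rcases lt_trichotomy x w with h | h | h
        · exact absurd (hxpred w hwX h) (not_le.2 hwu)
        · exact h
        · exact absurd (hpredX x hx h) (not_le.2 hxu)
      subst hxw
      obtain ⟨y, hy, hyu, hyvert, hypred⟩ := exists_pred_starts hβ hY huY
      obtain ⟨a1, a2⟩ := sub_lastLen_spec hβ hX hx hxu hxpred
      obtain ⟨b1, b2⟩ := sub_lastLen_spec hβ hY hy hyu hypred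
      have p1 := lastLen_pos (β := β) (u - x)
      have p2 := lastLen_pos (β := β) (u - y)
      have w1 := hwin u _ (by linarith) (by linarith) p1.le (lastLen_le_one (u - x))
      have w2 := hwin u _ (by linarith) (by linarith) p2.le (lastLen_le_one (u - y))
      have e : lastLen β (u - x) = lastLen β (u - y) := by
        rcases lt_trichotomy (lastLen β (u - x)) (lastLen β (u - y)) with h | h | h
        · have := b2 _ ((hXY _ w1).1 a1) (by linarith)
          linarith
        · exact h
        · have := a2 _ ((hXY _ w2).2 b1) (by linarith)
          linarith
      have e2 := betaMap_injOn hm hxvert (by linarith) hyvert (by linarith)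
        (betaMap_eq_of_lastLen_eq e)
      have e3 : x = y := by linarith
      exact hwY (e3 ▸ hy)
    obtain ⟨w, hw, hwmax⟩ := Set.exists_max_image
      {w | w ∈ (starts hβ X ∪ starts hβ Y) ∩ Set.Icc (-R) v ∧
        ¬(w ∈ starts hβ X ∧ w ∈ starts hβ Y)} id
      (((finite_starts hβ hX (-R) v).union (finite_starts hβ hY (-R) v)).subset fun w h => by
        rw [← Set.union_inter_distrib_right]
        exact h.1)
      ⟨z, ⟨Or.inl hzX, hz'.1, by linarith [hz'.2]⟩, fun h => hzY h.2⟩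
    have hmax : ∀ u, w < u → u ≤ v → u ∈ starts hβ X ∪ starts hβ Y →
        u ∈ starts hβ X ∧ u ∈ starts hβ Y := by
      intro u h1 h2 h3
      by_contra hc
      exact absurd (hwmax u ⟨⟨h3, by linarith [hw.1.2.1], h2⟩, hc⟩) (not_le.2 h1)
    by_cases hwX : w ∈ starts hβ X
    · exact key X Y hX hY hXY hv hvY w hw.1.2.1 hw.1.2.2 hwX (fun h => hw.2 ⟨hwX, h⟩)
        fun u h1 h2 h3 => (hmax u h1 h2 (Or.inl h3)).2
    · have hwY : w ∈ starts hβ Y := hw.1.1.resolve_left hwX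
      exact key Y X hY hX (fun e he => (hXY e he).symm) hvY hv w hw.1.2.1 hw.1.2.2 hwY hwX
        fun u h1 h2 h3 => (hmax u h1 h2 (Or.inr h3)).1

lemma mem_starts_iff_of_centralPatch_eq (hβ : IsPisot β) {T T' : Set (Tile β)} {R : ℝ}
    (h : centralPatch R T = centralPatch R T') {e : ℝ} (he : |e| ≤ R) :
    e ∈ starts hβ T ↔ e ∈ starts hβ T' := by
  have hy : e ∈ (firstTile hβ e).ico := by
    simpa [firstTile_min] using (firstTile hβ e).min_mem_ico hβ
  constructor
  · intro h1
    have := mem_centralPatch_of_mem_ico (T := T) h1 hy he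
    rw [h] at this
    exact this.1
  · intro h1
    have := mem_centralPatch_of_mem_ico (T := T') h1 hy he
    rw [← h] at this
    exact this.1

/-- Recognizability: if `β ∉ ℕ`, then the tiles of `X` in a window are determined by those of
`Ψ(X)` in a somewhat larger window. -/
lemma exists_recognizability (hβ : IsPisot β) (hN : β ∉ Set.range ((↑) : ℕ → ℝ)) :
    ∃ c, 0 < c ∧ ∀ X ∈ tilingSpace β, ∀ Y ∈ tilingSpace β, ∀ R : ℝ, 0 < R →
      centralPatch (β * R + c) (subst X) = centralPatch (β * R + c) (subst Y) →
      centralPatch R X = centralPatch R Y := by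
  obtain ⟨c, hc0, hc⟩ := exists_starts_subset hβ hN
  have hpos := hβ.pos
  refine ⟨2 * β + c, by positivity, fun X hX Y hY R hR h => ?_⟩
  rw [show β * R + (2 * β + c) = β * (R + 2) + c by ring] at h
  have hXY : ∀ z, |z| ≤ R + 2 → (z ∈ starts hβ X ↔ z ∈ starts hβ Y) := fun z hz =>
    ⟨hc X hX Y hY (R + 2) (by linarith) (fun e he => mem_starts_iff_of_centralPatch_eq hβ h he)
      z hz, hc Y hY X hX (R + 2) (by linarith)
        (fun e he => mem_starts_iff_of_centralPatch_eq hβ h.symm he) z hz⟩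
  have key : ∀ X Y : Set (Tile β), X ∈ tilingSpace β → Y ∈ tilingSpace β →
      (∀ z, |z| ≤ R + 2 → (z ∈ starts hβ X ↔ z ∈ starts hβ Y)) →
      centralPatch R X ⊆ centralPatch R Y := by
    rintro X Y hX hY hXY σ ⟨hσ, y, h1, h2⟩
    have h3 := σ.shift_le_min hβ
    have h4 := σ.max_le_shift_add_one hβ
    have h5 := σ.max_le_min_add_one hβ
    refine ⟨mem_of_starts hβ hY ?_ fun z hz hlt => ?_, y, h1, h2⟩
    · refine (hXY _ ?_).1 (shift_mem_starts hβ hX hσ)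
      rw [abs_le]
      constructor <;> linarith [h1.1, h1.2, h2.1, h2.2]
    · by_contra hc
      refine hc (starts_not_between hβ hX hσ ((hXY z ?_).2 hz) hlt)
      rw [abs_le]
      constructor <;> linarith [h1.1, h1.2, h2.1, h2.2]
  exact (key X Y hX hY hXY).antisymm (key Y X hY hX fun z hz => (hXY z hz).symm)

/-- The substitution is surjective on the tiling space. -/
lemma exists_subst_eq (hβ : IsPisot β) (hN : β ∉ Set.range ((↑) : ℕ → ℝ)) {S : Set (Tile β)}
    (hS : S ∈ tilingSpace β) : ∃ Y ∈ tilingSpace β, subst Y = S := by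
  obtain ⟨c, hc0, hc⟩ := exists_recognizability hβ hN
  obtain ⟨X, hX, hXn, Y₀, hY₀, rfl⟩ := exists_universal_tiling hβ
  have hpos := hβ.pos
  have happrox : ∀ n : ℕ, ∃ Y ∈ tilingSpace β,
      centralPatch n (subst Y) = centralPatch n S := by
    intro n
    obtain ⟨m, -, y, hm⟩ := exists_subset_iterate hβ hS
      (finite_centralPatch hβ hS.1.packed (n + 1 : ℕ)) (centralPatch_subset _ _) 0
    obtain ⟨g, hg⟩ := hXn m
    set t := β ^ m * (g - y)
    have hmem := translate_mem_tilingSpace hβ hY₀ (t / β)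
    have e : subst (translate Y₀ (t / β)) = translate (subst Y₀) t := by
      rw [subst_translate, mul_div_cancel₀ _ hpos.ne']
    refine ⟨_, hmem, ?_⟩
    refine centralPatch_eq_of_covers hβ (hmem.1.packed.subst hβ) hS.1.packed ?_
      (centralPatch_subset _ _) (by push_cast; linarith)
      (hS.1.centralPatch_covers hβ (n + 1 : ℕ))
    rw [e]
    refine hm.trans ?_
    have := translate_mono hg t
    rwa [translate_iterate_firstTile, mul_div_cancel_left₀ _ (pow_pos hpos m).ne',
      sub_sub_cancel] at this
  choose Yn hYn hYnS using happrox
  have hcons : ∀ (k n m : ℕ), 0 < k → β * k + c ≤ n → n ≤ m →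
      centralPatch k (Yn n) = centralPatch k (Yn m) := by
    intro k n m hk hn hnm
    refine hc _ (hYn n) _ (hYn m) k (by exact_mod_cast hk) ?_
    have hm : β * k + c ≤ m := hn.trans (by exact_mod_cast hnm)
    rw [centralPatch_eq_mono hn (hYnS n), centralPatch_eq_mono hm (hYnS m)]
  let N : ℕ → ℕ := fun k => ⌈β * (k + 1 : ℕ) + c⌉₊
  have hNmono : Monotone N := fun k l h => Nat.ceil_mono (by
    have : ((k + 1 : ℕ) : ℝ) ≤ (l + 1 : ℕ) := by exact_mod_cast Nat.succ_le_succ h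
    have := mul_le_mul_of_nonneg_left this hpos.le
    linarith)
  let Q : ℕ → Set (Tile β) := fun k => centralPatch (k + 1 : ℕ) (Yn (N k))
  have hQ : ∀ k m, N k ≤ m → Q k ⊆ Yn m := fun k m h => by
    have : Q k = centralPatch (k + 1 : ℕ) (Yn m) :=
      hcons (k + 1) (N k) m k.succ_pos (Nat.le_ceil _) h
    rw [this]
    exact centralPatch_subset _ _
  have hQmono : Monotone Q := fun k l h => by
    have : Q k = centralPatch (k + 1 : ℕ) (Yn (N l)) :=
      hcons (k + 1) (N k) (N l) k.succ_pos (Nat.le_ceil _) (hNmono h)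
    rw [this]
    exact centralPatch_mono (by exact_mod_cast Nat.succ_le_succ h) subset_rfl
  let Y : Set (Tile β) := ⋃ k, Q k
  have hY : Y ∈ tilingSpace β := by
    refine mem_tilingSpace_of hβ ?_ (fun y => ?_) fun P hP hfin => ?_
    · intro σ hσ σ' hσ' z hz hz'
      obtain ⟨k, hk⟩ := Set.mem_iUnion.1 hσ
      obtain ⟨k', hk'⟩ := Set.mem_iUnion.1 hσ'
      exact (hYn (N (max k k'))).1.packed σ (hQ _ _ (hNmono (le_max_left _ _)) hk) σ'
        (hQ _ _ (hNmono (le_max_right _ _)) hk') z hz hz'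
    · obtain ⟨k, hk⟩ := exists_nat_gt |y|
      obtain ⟨ρ, hρ, hyρ⟩ := (hYn (N k)).1.exists_mem hβ y
      refine ⟨ρ, Set.mem_iUnion.2 ⟨k, mem_centralPatch_of_mem_ico hρ hyρ ?_⟩, hyρ⟩
      push_cast
      linarith
    · choose! f hf using fun σ (hσ : σ ∈ P) => Set.mem_iUnion.1 (hP hσ)
      obtain ⟨k, hk⟩ := (hfin.image f).bddAbove
      obtain ⟨m, -, y, hm⟩ := exists_subset_iterate hβ (hYn (N k)) hfin
        (fun σ hσ => hQ k _ le_rfl (hQmono (hk ⟨σ, hσ, rfl⟩) (hf σ hσ))) 0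
      exact ⟨m, _, hm⟩
  refine ⟨Y, hY, (subst_mem_tilingSpace hβ hY).1.eq_of_subset hβ hS.1 fun σ hσ => ?_⟩
  obtain ⟨τ, hτ, hστ⟩ := mem_subst.1 hσ
  obtain ⟨k, hk⟩ := Set.mem_iUnion.1 hτ
  obtain ⟨n, hn⟩ := exists_nat_ge |σ.min|
  have h1 := hQ k (max (N k) n) (le_max_left _ _) hk
  have h2 := mem_centralPatch_of_mem_ico (R := (max (N k) n : ℕ)) (mem_subst.2 ⟨τ, h1, hστ⟩)
    (σ.min_mem_ico hβ) (hn.trans (by exact_mod_cast le_max_right _ _))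
  rw [hYnS] at h2
  exact h2.1

lemma exists_orbit (hβ : IsPisot β) (hN : β ∉ Set.range ((↑) : ℕ → ℝ)) {T : Set (Tile β)}
    (hT : T ∈ tilingSpace β) : ∃ U, IsOrbit β U ∧ U 0 = T := by
  choose! f hf hfs using fun S (hS : S ∈ tilingSpace β) => exists_subst_eq hβ hN hS
  have hmem : ∀ n : ℕ, f^[n] T ∈ tilingSpace β := fun n => by
    induction n with
    | zero => exact hT
    | succ n ih =>
      rw [Function.iterate_succ_apply']
      exact hf _ ih
  refine ⟨fun i => if 0 ≤ i then subst^[i.toNat] T else f^[(-i).toNat] T, fun i => ?_, by simp⟩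
  rcases lt_or_ge i 0 with hi | hi
  · obtain ⟨n, rfl⟩ : ∃ n : ℕ, i = -(n + 1 : ℕ) := ⟨(-i - 1).toNat, by omega⟩
    have e1 : (-(-((n + 1 : ℕ) : ℤ))).toNat = n + 1 := by omega
    simp only [not_le.2 hi, if_false, e1]
    refine ⟨hmem _, ?_⟩
    rw [Function.iterate_succ_apply', hfs _ (hmem n)]
    rcases Nat.eq_zero_or_pos n with rfl | hn
    · simp
    · have h2 : ¬ (0 : ℤ) ≤ -((n + 1 : ℕ) : ℤ) + 1 := by omega
      have e2 : (-(-((n + 1 : ℕ) : ℤ) + 1)).toNat = n := by omega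
      rw [if_neg h2, e2]
  · obtain ⟨n, rfl⟩ := Int.eq_ofNat_of_zero_le hi
    have h2 : (0 : ℤ) ≤ n + 1 := by omega
    have e2 : ((n : ℤ) + 1).toNat = n + 1 := by omega
    simp only [hi, if_true, h2, Int.toNat_natCast, e2]
    refine ⟨iterate_subst_mem_tilingSpace hβ hT n, ?_⟩
    rw [Function.iterate_succ_apply']

/-! ### Invariance of strong regional proximality -/

lemma StronglyRegionallyProximal.subst (hβ : IsPisot β) {X X' : Set (Tile β)}
    (hX : X ∈ tilingSpace β) (hX' : X' ∈ tilingSpace β)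
    (h : StronglyRegionallyProximal β X X') :
    StronglyRegionallyProximal β (subst X) (BetaTiling.subst X') := by
  intro R hR
  have hpos := hβ.pos
  have hR1 : 0 < R / β + 1 := by positivity
  have hlt : R < β * (R / β + 1) := by
    rw [mul_add, mul_div_cancel₀ _ hpos.ne']
    linarith
  obtain ⟨S, hS, S', hS', t, h1, h2, h3⟩ := h _ hR1
  have key : ∀ {Z Z' : Set (Tile β)}, Z ∈ tilingSpace β → Z' ∈ tilingSpace β →
      centralPatch (R / β + 1) Z = centralPatch (R / β + 1) Z' →
      centralPatch R (BetaTiling.subst Z) = centralPatch R (BetaTiling.subst Z') := by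
    intro Z Z' hZ hZ' he
    have hc := (hZ.1.centralPatch_covers hβ (R / β + 1)).subst hβ
    rw [mul_neg] at hc
    exact centralPatch_eq_of_covers hβ (hZ.1.packed.subst hβ) (hZ'.1.packed.subst hβ)
      (subst_mono (centralPatch_subset _ _)) (subst_mono (he ▸ centralPatch_subset _ _)) hlt hc
  refine ⟨_, subst_mem_tilingSpace hβ hS, _, subst_mem_tilingSpace hβ hS', β * t, key hX hS h1,
    key hX' hS' h2, ?_⟩
  rw [← subst_translate, ← subst_translate]
  exact key (translate_mem_tilingSpace hβ hS t) (translate_mem_tilingSpace hβ hS' t) h3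

lemma StronglyRegionallyProximal.of_subst (hβ : IsPisot β) (hN : β ∉ Set.range ((↑) : ℕ → ℝ))
    {X X' : Set (Tile β)} (hX : X ∈ tilingSpace β) (hX' : X' ∈ tilingSpace β)
    (h : StronglyRegionallyProximal β (BetaTiling.subst X) (BetaTiling.subst X')) :
    StronglyRegionallyProximal β X X' := by
  intro R hR
  have hpos := hβ.pos
  obtain ⟨c, hc0, hc⟩ := exists_recognizability hβ hN
  obtain ⟨S, hS, S', hS', t, h1, h2, h3⟩ := h (β * R + c) (by positivity)
  obtain ⟨Z, hZ, rfl⟩ := exists_subst_eq hβ hN hS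
  obtain ⟨Z', hZ', rfl⟩ := exists_subst_eq hβ hN hS'
  refine ⟨Z, hZ, Z', hZ', t / β, hc _ hX _ hZ R hR h1, hc _ hX' _ hZ' R hR h2, ?_⟩
  refine hc _ (translate_mem_tilingSpace hβ hZ _) _ (translate_mem_tilingSpace hβ hZ' _) R hR ?_
  rwa [subst_translate, subst_translate, mul_div_cancel₀ _ hpos.ne']

lemma stronglyRegionallyProximal_orbit (hβ : IsPisot β) (hN : β ∉ Set.range ((↑) : ℕ → ℝ))
    {U U' : ℤ → Set (Tile β)} (hU : IsOrbit β U) (hU' : IsOrbit β U')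
    (h : StronglyRegionallyProximal β (U 0) (U' 0)) (i : ℤ) :
    StronglyRegionallyProximal β (U i) (U' i) := by
  induction i using Int.induction_on with
  | zero => exact h
  | succ i ih =>
    rw [← (hU i).2, ← (hU' i).2]
    exact ih.subst hβ (hU i).1 (hU' i).1
  | pred i ih =>
    refine StronglyRegionallyProximal.of_subst hβ hN (hU _).1 (hU' _).1 ?_
    rwa [(hU _).2, (hU' _).2, sub_add_cancel]

/-- The relative positions of the tiles at `t_*` of strongly regionally proximal tilings take only
finitely many values. -/
lemma exists_finite_of_stronglyRegionallyProximal (hβ : IsPisot β) :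
    ∃ F : Set ℝ, F.Finite ∧ F ⊆ betaRing β ∧ ∀ T ∈ tilingSpace β, ∀ T' ∈ tilingSpace β,
      StronglyRegionallyProximal β T T' → tStar T - tStar T' ∈ F := by
  obtain ⟨C, -, hC⟩ := exists_bddConj_shift_sub hβ
  obtain ⟨C₀, hC1, hC₀⟩ := exists_tStar_spec hβ
  refine ⟨_, finite_bddConj hβ C₀ (C + C), fun x hx => hx.2.mem, fun T hT T' hT' h => ?_⟩
  have a := hC₀ T hT
  have a' := hC₀ T' hT'
  obtain ⟨S, hS, S', hS', t, h1, h2, h3⟩ := h C₀ (by linarith)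
  have hmem : ∀ {Z Z' : Set (Tile β)}, Z ∈ tilingSpace β → centralPatch C₀ Z = centralPatch C₀ Z' →
      firstTile hβ (tStar Z) ∈ Z' := by
    intro Z Z' hZ he
    have b := hC₀ Z hZ
    have := mem_centralPatch_of_mem_ico b.1 (y := tStar Z) (R := C₀)
      (by simpa [firstTile_min] using (firstTile hβ (tStar Z)).min_mem_ico hβ)
      (by rw [abs_le]; constructor <;> linarith)
    rw [he] at this
    exact this.1
  obtain ⟨σ, hσ, hy⟩ := (translate_mem_tilingSpace hβ hS t).1.exists_mem hβ 0
  have hσ' : σ ∈ translate S' t := by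
    have := mem_centralPatch_of_mem_ico hσ hy (R := C₀) (by simp; linarith)
    rw [h3] at this
    exact this.1
  rw [mem_translate] at hσ hσ'
  have b := hC S hS _ (hmem hT h1) _ hσ
  have b' := hC S' hS' _ (hmem hT' h2) _ hσ'
  refine ⟨?_, ?_⟩
  · rw [abs_le]
    constructor <;> linarith
  · have := b.sub b'
    simpa [firstTile] using this

/-! ### The substitution matrix and its Perron eigenvector -/

/-- The row vector of the lengths of the prototiles. -/
def lenVec (β : ℝ) : Fin (numTiles β) → ℝ := fun j => len β j

lemma finite_offsets (i j : Fin (numTiles β)) : (offsets β i j).Finite := by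
  refine (Set.finite_Icc ⌈β * vtx β i - vtx β j⌉ ⌊β * vtx β (i + 1) - vtx β (j + 1)⌋).subset ?_
  rintro k ⟨h1, h2⟩
  exact ⟨Int.ceil_le.2 (by linarith), Int.le_floor.2 (by linarith)⟩

/-- The lengths of the prototiles form a left eigenvector of the substitution matrix: the tiles of
the image of a prototile partition the inflated prototile. -/
lemma lenVec_vecMul (hβ : IsPisot β) :
    Matrix.vecMul (lenVec β) (substMatrix β) = β • lenVec β := by
  funext i
  set s : Finset (Fin (numTiles β) × ℤ) :=
    Finset.univ.sigma (fun j => (finite_offsets i j).toFinset) |>.map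
      (Equiv.sigmaEquivProd _ _).toEmbedding with hs
  have hmem : ∀ x : Fin (numTiles β) × ℤ, x ∈ s ↔
      (⟨x.1, (x.2 : ℝ)⟩ : Tile β) ∈ substTile (⟨i, 0⟩ : Tile β) := by
    rintro ⟨j, k⟩
    simp only [hs, Finset.mem_map_equiv, Finset.mem_sigma, Finset.mem_univ, true_and,
      Set.Finite.mem_toFinset, Equiv.sigmaEquivProd_symm_apply, substTile, Set.mem_ofPred_eq,
      mul_zero, zero_add, Int.cast_inj]
    simp
  have hcov : Set.Ico (β * vtx β i) (β * vtx β (i + 1)) =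
      ⋃ x ∈ s, (⟨x.1, (x.2 : ℝ)⟩ : Tile β).ico := by
    ext y
    simp only [Set.mem_iUnion, exists_prop]
    constructor
    · rintro ⟨h1, h2⟩
      obtain ⟨σ, hσ, hy⟩ := exists_mem_substTile hβ (τ := (⟨i, 0⟩ : Tile β)) (y := y)
        (by simpa [Tile.min] using h1) (by simpa [Tile.max] using h2)
      obtain ⟨k, hk, hk'⟩ := id hσ
      simp only [mul_zero, zero_add] at hk'
      have e : (⟨σ.type, (k : ℝ)⟩ : Tile β) = σ := by ext <;> simp [hk']
      exact ⟨(σ.type, k), (hmem _).2 (by simpa only [e] using hσ), by simpa only [e] using hy⟩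
    · rintro ⟨x, hx, hy⟩
      have := substTile_bounds ((hmem x).1 hx)
      rw [Tile.mem_ico] at hy
      simp only [Tile.min, Tile.max, add_zero] at this hy
      exact ⟨by linarith, by linarith⟩
  have hvol := congrArg MeasureTheory.volume hcov
  rw [MeasureTheory.measure_biUnion_finset, Real.volume_Ico] at hvol
  · have hsum : ∑ x ∈ s, MeasureTheory.volume (⟨x.1, (x.2 : ℝ)⟩ : Tile β).ico =
        ENNReal.ofReal (∑ x ∈ s, len β x.1) := by
      rw [ENNReal.ofReal_sum_of_nonneg (fun x _ => (len_pos hβ x.1).le)]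
      refine Finset.sum_congr rfl fun x _ => ?_
      rw [Tile.ico, Real.volume_Ico, Tile.max_eq]
      congr 1
      ring
    rw [hsum, ENNReal.ofReal_eq_ofReal_iff] at hvol
    · have h2 : ∑ x ∈ s, len β x.1 = ∑ j, ∑ k ∈ (finite_offsets i j).toFinset, len β j := by
        rw [hs, Finset.sum_map, Finset.sum_sigma]
        rfl
      simp only [Matrix.vecMul, dotProduct, lenVec, substMatrix, Matrix.of_apply, Pi.smul_apply,
        smul_eq_mul]
      rw [len, mul_sub, hvol, h2]
      refine Finset.sum_congr rfl fun j _ => ?_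
      rw [Finset.sum_const, nsmul_eq_mul, mul_comm, Set.ncard_eq_toFinset_card _
        (finite_offsets i j)]
    · have := len_pos hβ i
      rw [len] at this
      nlinarith [hβ.pos]
    · exact Finset.sum_nonneg fun x _ => (len_pos hβ x.1).le
  · intro x hx y hy hxy
    rw [Function.onFun, Set.disjoint_left]
    intro z hz hz'
    have hP : Packed (substTile (⟨i, 0⟩ : Tile β)) := by
      rw [← subst_singleton]
      exact (packed_singleton _).subst hβ
    have := hP _ ((hmem x).1 hx) _ ((hmem y).1 hy) z hz hz'
    rw [Tile.ext_iff] at this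
    exact hxy (Prod.ext this.1 (Int.cast_injective (α := ℝ) this.2))
  · intro x _
    exact measurableSet_Ico

lemma substMatrix_nonneg (j i : Fin (numTiles β)) : 0 ≤ substMatrix β j i := by
  simp [substMatrix]

/-- The substitution matrix is primitive: its entries count the tiles of each type. -/
lemma exists_pow_substMatrix_pos (hβ : IsPisot β) :
    ∃ n, ∀ j i, 0 < (substMatrix β ^ n) j i := by
  obtain ⟨n, hn⟩ := exists_primitive hβ
  have key : ∀ n : ℕ, ∀ (j i : Fin (numTiles β)), 0 ≤ (substMatrix β ^ n) j i ∧
      ∀ x y : ℝ, (⟨j, y⟩ : Tile β) ∈ subst^[n] {(⟨i, x⟩ : Tile β)} →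
        0 < (substMatrix β ^ n) j i := by
    intro n
    induction n with
    | zero =>
      intro j i
      refine ⟨?_, ?_⟩
      · rw [pow_zero, Matrix.one_apply]
        split_ifs <;> norm_num
      · intro x y h
        simp only [Function.iterate_zero, id, Set.mem_singleton_iff, Tile.mk.injEq] at h
        simp [h.1]
    | succ n ih =>
      intro j i
      have h0 : ∀ k, 0 ≤ substMatrix β j k * (substMatrix β ^ n) k i := fun k =>
        mul_nonneg (substMatrix_nonneg _ _) (ih k i).1
      rw [pow_succ', Matrix.mul_apply]
      refine ⟨Finset.sum_nonneg fun k _ => h0 k, ?_⟩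
      intro x y h
      rw [Function.iterate_succ_apply', mem_subst] at h
      obtain ⟨⟨k, z⟩, hτ, o, ho, -⟩ := h
      refine Finset.sum_pos' (fun k _ => h0 k) ⟨k, Finset.mem_univ _, ?_⟩
      refine mul_pos ?_ ((ih k i).2 x z hτ)
      simp only [substMatrix, Matrix.of_apply, Nat.cast_pos]
      exact (Set.ncard_pos (finite_offsets k j)).2 ⟨o, ho⟩
  refine ⟨n, fun j i => ?_⟩
  obtain ⟨y, hy⟩ := hn n le_rfl ⟨i, 0⟩ j
  exact (key n j i).2 0 y hy

/-- A left eigenvector for `β` is a multiple of the length vector: subtracting the largest possible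
multiple leaves a nonnegative eigenvector with a zero entry, which vanishes by primitivity. -/
lemma eq_smul_lenVec (hβ : IsPisot β) {v : Fin (numTiles β) → ℝ}
    (hv : Matrix.vecMul v (substMatrix β) = β • v) : ∃ c : ℝ, v = c • lenVec β := by
  obtain ⟨n, hn⟩ := exists_pow_substMatrix_pos hβ
  have : Nonempty (Fin (numTiles β)) := ⟨⟨0, numTiles_pos hβ⟩⟩
  obtain ⟨j₀, hj₀⟩ := Finite.exists_min (fun j => v j / lenVec β j)
  set c := v j₀ / lenVec β j₀ with hc
  have hpos : ∀ j, 0 < lenVec β j := fun j => len_pos hβ j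
  set m := v - c • lenVec β with hm
  have hm0 : ∀ j, 0 ≤ m j := fun j => by
    have := hj₀ j
    rw [le_div_iff₀ (hpos j)] at this
    simpa [hm] using this
  have hmj : m j₀ = 0 := by
    simp [hm, hc, div_mul_cancel₀ _ (hpos j₀).ne']
  have hmA : Matrix.vecMul m (substMatrix β) = β • m := by
    rw [hm, Matrix.sub_vecMul, Matrix.smul_vecMul, hv, lenVec_vecMul hβ, smul_sub, smul_comm]
  have hmn : ∀ k : ℕ, Matrix.vecMul m (substMatrix β ^ k) = β ^ k • m := by
    intro k
    induction k with
    | zero => simp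
    | succ k ih => rw [pow_succ, ← Matrix.vecMul_vecMul, ih, Matrix.smul_vecMul, hmA, smul_smul,
        pow_succ]
  have h0 : ∑ k, m k * (substMatrix β ^ n) k j₀ = 0 := by
    have := congrFun (hmn n) j₀
    simpa [Matrix.vecMul, dotProduct, hmj] using this
  rw [Finset.sum_eq_zero_iff_of_nonneg fun k _ => mul_nonneg (hm0 k) (hn k j₀).le] at h0
  refine ⟨c, ?_⟩
  rw [← sub_eq_zero]
  funext k
  have := h0 k (Finset.mem_univ _)
  exact (mul_eq_zero.1 this).resolve_right (hn k j₀).ne'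

/-- There is no generalized left eigenvector of rank two for `β`. -/
lemma vecMul_substMatrix_sub_ne (hβ : IsPisot β) (v : Fin (numTiles β) → ℝ) :
    Matrix.vecMul v (substMatrix β) ≠ β • v + lenVec β := by
  intro hv
  have : Nonempty (Fin (numTiles β)) := ⟨⟨0, numTiles_pos hβ⟩⟩
  obtain ⟨j₀, hj₀⟩ := Finite.exists_max (fun j => v j / lenVec β j)
  set c := v j₀ / lenVec β j₀ with hc
  have hpos : ∀ j, 0 < lenVec β j := fun j => len_pos hβ j
  set m := c • lenVec β - v with hm
  have hm0 : ∀ j, 0 ≤ m j := fun j => by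
    have := hj₀ j
    rw [div_le_iff₀ (hpos j)] at this
    simpa [hm] using this
  have hmj : m j₀ = 0 := by
    simp [hm, hc, div_mul_cancel₀ _ (hpos j₀).ne']
  have hmA : Matrix.vecMul m (substMatrix β) = β • m - lenVec β := by
    rw [hm, Matrix.sub_vecMul, Matrix.smul_vecMul, hv, lenVec_vecMul hβ, smul_sub, smul_comm]
    abel
  have h1 : 0 ≤ Matrix.vecMul m (substMatrix β) j₀ := by
    rw [Matrix.vecMul, dotProduct]
    exact Finset.sum_nonneg fun k _ => mul_nonneg (hm0 k) (substMatrix_nonneg k j₀)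
  rw [hmA] at h1
  simp only [Pi.sub_apply, Pi.smul_apply, hmj, smul_zero, zero_sub] at h1
  linarith [hpos j₀]

/-- The dominant eigenvalue is a simple root of the characteristic polynomial. -/
lemma rootMultiplicity_charpoly (hβ : IsPisot β) :
    (substMatrix β).charpoly.rootMultiplicity β = 1 := by
  set φ : Module.End ℝ (Fin (numTiles β) → ℝ) := (substMatrix β).transpose.mulVecLin with hφ
  have hφa : ∀ v, φ v = Matrix.vecMul v (substMatrix β) := fun v => by
    rw [hφ, Matrix.mulVecLin_apply, Matrix.mulVec_transpose]
  have h := LinearMap.finrank_maxGenEigenspace_eq φ β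
  rw [hφ, Matrix.charpoly_mulVecLin, Matrix.charpoly_transpose, ← hφ] at h
  rw [← h]
  have hspan : φ.maxGenEigenspace β = Submodule.span ℝ {lenVec β} := by
    apply le_antisymm
    · intro v hv
      rw [Module.End.mem_maxGenEigenspace] at hv
      obtain ⟨k, hk⟩ := hv
      induction k generalizing v with
      | zero =>
        have : v = 0 := by simpa using hk
        rw [this]
        exact zero_mem _
      | succ k ih =>
        rw [pow_succ] at hk
        obtain ⟨c, hc⟩ := Submodule.mem_span_singleton.1 (ih hk)
        have hc' : Matrix.vecMul v (substMatrix β) = β • v + c • lenVec β := by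
          rw [hc, ← hφa]
          simp
        by_cases h0 : c = 0
        · rw [h0, zero_smul, add_zero] at hc'
          obtain ⟨d, rfl⟩ := eq_smul_lenVec hβ hc'
          exact Submodule.smul_mem _ _ (Submodule.mem_span_singleton_self _)
        · refine (vecMul_substMatrix_sub_ne hβ (c⁻¹ • v) ?_).elim
          rw [Matrix.smul_vecMul, hc', smul_add, smul_smul, smul_smul, smul_smul,
            inv_mul_cancel₀ h0, one_smul, mul_comm]
    · rw [Submodule.span_singleton_le_iff_mem, Module.End.mem_maxGenEigenspace]
      refine ⟨1, ?_⟩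
      simp [hφa, lenVec_vecMul hβ]
  rw [hspan]
  refine finrank_span_singleton fun h0 => ?_
  exact (len_pos hβ ⟨0, numTiles_pos hβ⟩).ne' (congrFun h0 ⟨0, numTiles_pos hβ⟩)

/-! ### The Pisot subspace and the projection onto it -/

/-- The substitution matrix as an integer matrix. -/
def intMatrix (β : ℝ) : Matrix (Fin (numTiles β)) (Fin (numTiles β)) ℤ :=
  Matrix.of fun j i => ((offsets β i j).ncard : ℤ)

/-- The cofactor of the minimal polynomial of `β` in the characteristic polynomial of the
substitution matrix, with integer coefficients. -/
def intCoPoly (β : ℝ) : ℤ[X] := (intMatrix β).charpoly /ₘ minpoly ℤ β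

lemma map_intMatrix : (intMatrix β).map (Int.castRingHom ℝ) = substMatrix β := by
  ext j i
  simp [intMatrix, substMatrix]

lemma aeval_substMatrix (P : ℤ[X]) :
    aeval (substMatrix β) P = (aeval (intMatrix β) P).map (Int.castRingHom ℝ) := by
  have := Polynomial.aeval_algHom_apply
    ((Int.castRingHom ℝ).mapMatrix.toIntAlgHom :
      Matrix (Fin (numTiles β)) (Fin (numTiles β)) ℤ →ₐ[ℤ]
        Matrix (Fin (numTiles β)) (Fin (numTiles β)) ℝ) (intMatrix β) P
  rw [← map_intMatrix]
  exact this

lemma charpoly_intMatrix (hβ : IsPisot β) :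
    (intMatrix β).charpoly = minpoly ℤ β * intCoPoly β := by
  have h : aeval β (intMatrix β).charpoly = 0 := by
    have h1 : (substMatrix β).charpoly.IsRoot β := by
      rw [← Polynomial.rootMultiplicity_pos (Matrix.charpoly_monic _).ne_zero,
        rootMultiplicity_charpoly hβ]
      exact one_pos
    rwa [← map_intMatrix, Matrix.charpoly_map, IsRoot, eval_map, ← algebraMap_int_eq,
      ← aeval_def] at h1
  obtain ⟨q, hq⟩ := minpoly.isIntegrallyClosed_dvd hβ.2.1 h
  rw [intCoPoly, hq, Polynomial.mul_divByMonic_cancel_left _ (minpoly.monic hβ.2.1)]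

lemma coPoly_eq (hβ : IsPisot β) : coPoly β = (intCoPoly β).map (Int.castRingHom ℝ) := by
  rw [coPoly, ← map_intMatrix, Matrix.charpoly_map, charpoly_intMatrix hβ, Polynomial.map_mul,
    minPoly, Polynomial.mul_divByMonic_cancel_left _ ((minpoly.monic hβ.2.1).map _)]

lemma aeval_intCoPoly_ne (hβ : IsPisot β) : aeval β (intCoPoly β) ≠ 0 := by
  intro h
  have h1 : X - C β ∣ minPoly β := by
    rw [dvd_iff_isRoot, minPoly, IsRoot, eval_map, ← algebraMap_int_eq, ← aeval_def]
    exact minpoly.aeval _ _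
  have h2 : X - C β ∣ coPoly β := by
    rw [dvd_iff_isRoot, coPoly_eq hβ, IsRoot, eval_map, ← algebraMap_int_eq, ← aeval_def]
    exact h
  have h3 : (X - C β) ^ 2 ∣ (substMatrix β).charpoly := by
    rw [← map_intMatrix, Matrix.charpoly_map, charpoly_intMatrix hβ, Polynomial.map_mul, sq,
      ← coPoly_eq hβ]
    exact mul_dvd_mul h1 h2
  rw [← le_rootMultiplicity_iff (Matrix.charpoly_monic _).ne_zero,
    rootMultiplicity_charpoly hβ] at h3
  omega

/-- The minimal polynomial of `β` and its cofactor are coprime over `ℚ`, as `β` is a simple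
eigenvalue; here with the denominators cleared. -/
lemma exists_bezout (hβ : IsPisot β) : ∃ (s₁ s₂ : ℤ[X]) (m : ℤ), m ≠ 0 ∧
    s₁ * minpoly ℤ β + s₂ * intCoPoly β = C m := by
  set f := algebraMap ℤ ℚ
  have hp : minpoly ℚ β = (minpoly ℤ β).map f :=
    minpoly.isIntegrallyClosed_eq_field_fractions' ℚ hβ.2.1
  have hirr : Irreducible (minpoly ℚ β) := minpoly.irreducible hβ.2.1.tower_top
  have hcop : IsCoprime (minpoly ℚ β) ((intCoPoly β).map f) := by
    refine (hirr.isCoprime_or_dvd _).resolve_right fun hd => ?_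
    have h0 : aeval β ((intCoPoly β).map f) = 0 :=
      aeval_eq_zero_of_dvd_aeval_eq_zero hd (minpoly.aeval _ _)
    rw [aeval_map_algebraMap] at h0
    exact aeval_intCoPoly_ne hβ h0
  obtain ⟨u, v, huv⟩ := hcop
  obtain ⟨b, hb, hb'⟩ := IsLocalization.integerNormalization_spec (nonZeroDivisors ℤ) u
  obtain ⟨c, hc, hc'⟩ := IsLocalization.integerNormalization_spec (nonZeroDivisors ℤ) v
  set u' := IsLocalization.integerNormalization (nonZeroDivisors ℤ) u
  set v' := IsLocalization.integerNormalization (nonZeroDivisors ℤ) v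
  refine ⟨C c * u', C b * v', b * c, mul_ne_zero (nonZeroDivisors.ne_zero hb)
    (nonZeroDivisors.ne_zero hc), ?_⟩
  apply Polynomial.map_injective f (algebraMap ℤ ℚ).injective_int
  simp only [Polynomial.map_add, Polynomial.map_mul, map_C]
  rw [hb', hc', ← hp]
  simp only [zsmul_eq_mul]
  have e : ∀ k : ℤ, (C (f k) : ℚ[X]) = (k : ℚ[X]) := fun k => by simp [f]
  simp only [e, Int.cast_mul]
  linear_combination (b * c : ℚ[X]) * huv

lemma mem_pisotSubspace {v : Fin (numTiles β) → ℝ} : v ∈ pisotSubspace β ↔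
    (aeval (substMatrix β) (minpoly ℤ β)).mulVec v = 0 := by
  rw [pisotSubspace, LinearMap.mem_ker, Matrix.mulVecLin_apply, minPoly, ← algebraMap_int_eq,
    aeval_map_algebraMap]

lemma mem_complSubspace (hβ : IsPisot β) {v : Fin (numTiles β) → ℝ} : v ∈ complSubspace β ↔
    (aeval (substMatrix β) (intCoPoly β)).mulVec v = 0 := by
  rw [complSubspace, LinearMap.mem_ker, Matrix.mulVecLin_apply, coPoly_eq hβ, ← algebraMap_int_eq,
    aeval_map_algebraMap]

lemma aeval_mul_intCoPoly (hβ : IsPisot β) :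
    aeval (substMatrix β) (minpoly ℤ β * intCoPoly β) = 0 := by
  rw [← charpoly_intMatrix hβ, aeval_substMatrix, Matrix.aeval_self_charpoly]
  ext; simp

/-- The projection `pisotProj` is a polynomial in the substitution matrix, up to a rational
factor. -/
lemma exists_pisotProj_eq (hβ : IsPisot β) : ∃ (s₁ s₂ : ℤ[X]) (m : ℤ), m ≠ 0 ∧
    s₁ * minpoly ℤ β + s₂ * intCoPoly β = C m ∧
    IsCompl (pisotSubspace β) (complSubspace β) ∧
    ∀ v, (m : ℝ) • pisotProj β v =
      (aeval (substMatrix β) (s₂ * intCoPoly β)).mulVec v := by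
  obtain ⟨s₁, s₂, m, hm, h⟩ := exists_bezout hβ
  have hm' : (m : ℝ) ≠ 0 := by exact_mod_cast hm
  have hV : ∀ v, (aeval (substMatrix β) (s₂ * intCoPoly β)).mulVec v ∈ pisotSubspace β := by
    intro v
    rw [mem_pisotSubspace, Matrix.mulVec_mulVec, ← map_mul,
      show minpoly ℤ β * (s₂ * intCoPoly β) = s₂ * (minpoly ℤ β * intCoPoly β) by ring, map_mul,
      aeval_mul_intCoPoly hβ, mul_zero, Matrix.zero_mulVec]
  have hW : ∀ v, (aeval (substMatrix β) (s₁ * minpoly ℤ β)).mulVec v ∈ complSubspace β := by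
    intro v
    rw [mem_complSubspace hβ, Matrix.mulVec_mulVec, ← map_mul,
      show intCoPoly β * (s₁ * minpoly ℤ β) = s₁ * (minpoly ℤ β * intCoPoly β) by ring, map_mul,
      aeval_mul_intCoPoly hβ, mul_zero, Matrix.zero_mulVec]
  have hsum : ∀ v, (aeval (substMatrix β) (s₁ * minpoly ℤ β)).mulVec v +
      (aeval (substMatrix β) (s₂ * intCoPoly β)).mulVec v = (m : ℝ) • v := by
    intro v
    rw [← Matrix.add_mulVec, ← map_add, h]
    simp [← Matrix.diagonal_intCast]
  have hcompl : IsCompl (pisotSubspace β) (complSubspace β) := by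
    refine IsCompl.of_le ?_ ?_
    · rintro v ⟨h1, h2⟩
      rw [SetLike.mem_coe] at h1 h2
      rw [mem_pisotSubspace] at h1
      rw [mem_complSubspace hβ] at h2
      have := hsum v
      rw [map_mul, map_mul, ← Matrix.mulVec_mulVec, ← Matrix.mulVec_mulVec, h1, h2,
        Matrix.mulVec_zero, Matrix.mulVec_zero, add_zero] at this
      exact (smul_eq_zero.1 this.symm).resolve_left hm'
    · intro v _
      have : v = (m : ℝ)⁻¹ • ((aeval (substMatrix β) (s₁ * minpoly ℤ β)).mulVec v +
          (aeval (substMatrix β) (s₂ * intCoPoly β)).mulVec v) := by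
        rw [hsum, smul_smul, inv_mul_cancel₀ hm', one_smul]
      rw [this]
      exact Submodule.smul_mem _ _ (add_mem (Submodule.mem_sup_right (hW v))
        (Submodule.mem_sup_left (hV v)))
  refine ⟨s₁, s₂, m, hm, h, hcompl, fun v => ?_⟩
  rw [← map_smul, ← hsum v, map_add, pisotProj, dif_pos hcompl,
    Submodule.projection_apply_of_mem_left hcompl (hV v),
    (Submodule.projection_apply_eq_zero_iff hcompl).2 (hW v), zero_add]

lemma pisotProj_mem (hβ : IsPisot β) (v : Fin (numTiles β) → ℝ) :
    pisotProj β v ∈ pisotSubspace β := by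
  obtain ⟨-, -, -, -, -, h, -⟩ := exists_pisotProj_eq hβ
  rw [pisotProj, dif_pos h]
  exact Submodule.projection_apply_mem _ _

lemma aeval_substMatrix_comm (P : ℤ[X]) :
    aeval (substMatrix β) P * substMatrix β = substMatrix β * aeval (substMatrix β) P := by
  have := ((Commute.all P X).map (aeval (substMatrix β) : ℤ[X] →ₐ[ℤ] _)).eq
  rwa [aeval_X] at this

lemma pisotProj_mulVec (hβ : IsPisot β) (v : Fin (numTiles β) → ℝ) :
    pisotProj β ((substMatrix β).mulVec v) = (substMatrix β).mulVec (pisotProj β v) := by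
  obtain ⟨s₁, s₂, m, hm, -, -, h⟩ := exists_pisotProj_eq hβ
  have hm' : (m : ℝ) ≠ 0 := by exact_mod_cast hm
  apply smul_right_injective _ hm'
  simp only
  rw [h, ← Matrix.mulVec_smul, h, Matrix.mulVec_mulVec, Matrix.mulVec_mulVec,
    aeval_substMatrix_comm]

lemma mulVec_mem_pisotSubspace {v : Fin (numTiles β) → ℝ} (hv : v ∈ pisotSubspace β) :
    (substMatrix β).mulVec v ∈ pisotSubspace β := by
  rw [mem_pisotSubspace] at hv ⊢
  rw [Matrix.mulVec_mulVec, aeval_substMatrix_comm, ← Matrix.mulVec_mulVec, hv, Matrix.mulVec_zero]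

/-- The substitution matrix is injective on the Pisot subspace, as the minimal polynomial of `β`
has a non-zero constant term. -/
lemma eq_zero_of_mulVec_eq_zero (hβ : IsPisot β) {v : Fin (numTiles β) → ℝ}
    (hv : v ∈ pisotSubspace β) (h : (substMatrix β).mulVec v = 0) : v = 0 := by
  rw [mem_pisotSubspace, ← divX_mul_X_add (minpoly ℤ β), map_add, map_mul, aeval_X,
    Matrix.add_mulVec, ← Matrix.mulVec_mulVec, h, Matrix.mulVec_zero, zero_add] at hv
  have hint : IsIntegral ℤ β := hβ.2.1
  have h0 : (minpoly ℤ β).coeff 0 ≠ 0 := by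
    intro h0
    refine minpoly.coeff_zero_ne_zero (A := ℚ) hint.tower_top hβ.pos.ne' ?_
    rw [minpoly.isIntegrallyClosed_eq_field_fractions' ℚ hint, coeff_map, h0, map_zero]
  have h1 : (((minpoly ℤ β).coeff 0 : ℤ) : ℝ) • v = 0 := by
    simpa [← Matrix.diagonal_intCast] using hv
  exact (smul_eq_zero.1 h1).resolve_left (by exact_mod_cast h0)

lemma exists_mulVec_eq (hβ : IsPisot β) {v : Fin (numTiles β) → ℝ} (hv : v ∈ pisotSubspace β) :
    ∃ w ∈ pisotSubspace β, (substMatrix β).mulVec w = v := by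
  let g : pisotSubspace β →ₗ[ℝ] pisotSubspace β :=
    (substMatrix β).mulVecLin.restrict fun v hv => mulVec_mem_pisotSubspace hv
  have hg : Function.Injective g := by
    rw [injective_iff_map_eq_zero]
    intro w hw
    exact Subtype.ext (eq_zero_of_mulVec_eq_zero hβ w.2 (congrArg Subtype.val hw))
  obtain ⟨w, hw⟩ := LinearMap.surjective_of_injective hg ⟨v, hv⟩
  exact ⟨w, w.2, congrArg Subtype.val hw⟩

/-! ### The total length of an integer vector -/

/-- The functional `v ↦ ∑ j, len β j * v j`. -/
def totalLen (β : ℝ) : (Fin (numTiles β) → ℝ) →ₗ[ℝ] ℝ where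
  toFun v := lenVec β ⬝ᵥ v
  map_add' := dotProduct_add _
  map_smul' c v := dotProduct_smul c _ v

/-- An integer vector as a real vector. -/
def castVec (z : Fin (numTiles β) → ℤ) : Fin (numTiles β) → ℝ := fun j => (z j : ℝ)

lemma totalLen_mulVec (hβ : IsPisot β) (v : Fin (numTiles β) → ℝ) :
    totalLen β ((substMatrix β).mulVec v) = β * totalLen β v := by
  change lenVec β ⬝ᵥ _ = β * (lenVec β ⬝ᵥ v)
  rw [Matrix.dotProduct_mulVec, lenVec_vecMul hβ, smul_dotProduct, smul_eq_mul]

lemma totalLen_aeval_mulVec (hβ : IsPisot β) (P : ℤ[X]) (v : Fin (numTiles β) → ℝ) :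
    totalLen β ((aeval (substMatrix β) P).mulVec v) = aeval β P * totalLen β v := by
  induction P using Polynomial.induction_on' with
  | add P Q hP hQ => rw [map_add, Matrix.add_mulVec, map_add, hP, hQ, map_add, add_mul]
  | monomial n a =>
    have h : ∀ n : ℕ, totalLen β ((substMatrix β ^ n).mulVec v) = β ^ n * totalLen β v := by
      intro n
      induction n with
      | zero => simp
      | succ n ih => rw [pow_succ', ← Matrix.mulVec_mulVec, totalLen_mulVec hβ, ih]; ring
    rw [aeval_monomial, aeval_monomial, ← Matrix.mulVec_mulVec]
    have h2 : (algebraMap ℤ (Matrix (Fin (numTiles β)) (Fin (numTiles β)) ℝ) a).mulVec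
        ((substMatrix β ^ n).mulVec v) = (a : ℝ) • (substMatrix β ^ n).mulVec v := by
      generalize (substMatrix β ^ n).mulVec v = w
      simp [← Matrix.diagonal_intCast]
    rw [h2, map_smul, h, smul_eq_mul, algebraMap_int_eq, eq_intCast, mul_assoc]

lemma totalLen_pisotProj (hβ : IsPisot β) (v : Fin (numTiles β) → ℝ) :
    totalLen β (pisotProj β v) = totalLen β v := by
  obtain ⟨s₁, s₂, m, hm, hb, -, h⟩ := exists_pisotProj_eq hβ
  have hm' : (m : ℝ) ≠ 0 := by exact_mod_cast hm
  apply mul_left_cancel₀ hm'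
  rw [← smul_eq_mul, ← map_smul, h, totalLen_aeval_mulVec hβ]
  have := congrArg (aeval β) hb
  rw [map_add, map_mul, minpoly.aeval, mul_zero, zero_add] at this
  rw [this]
  simp

lemma mulVec_castVec (M : Matrix (Fin (numTiles β)) (Fin (numTiles β)) ℤ)
    (z : Fin (numTiles β) → ℤ) :
    (M.map (Int.castRingHom ℝ)).mulVec (castVec z) = castVec (M.mulVec z) := by
  funext j
  simp [Matrix.mulVec, dotProduct, castVec]

lemma aeval_mulVec_castVec (P : ℤ[X]) (z : Fin (numTiles β) → ℤ) :
    (aeval (substMatrix β) P).mulVec (castVec z) =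
      castVec ((aeval (intMatrix β) P).mulVec z) := by
  rw [aeval_substMatrix, mulVec_castVec]

lemma substMatrix_mulVec_castVec (z : Fin (numTiles β) → ℤ) :
    (substMatrix β).mulVec (castVec z) = castVec ((intMatrix β).mulVec z) := by
  rw [← map_intMatrix, mulVec_castVec]

/-- The projection of the integer lattice to the Pisot subspace lies in a lattice. -/
lemma exists_smul_pisotProj_int (hβ : IsPisot β) : ∃ m : ℤ, m ≠ 0 ∧
    ∀ z : Fin (numTiles β) → ℤ, ∃ w : Fin (numTiles β) → ℤ,
      (m : ℝ) • pisotProj β (castVec z) = castVec w := by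
  obtain ⟨s₁, s₂, m, hm, -, -, h⟩ := exists_pisotProj_eq hβ
  refine ⟨m, hm, fun z => ⟨(aeval (intMatrix β) (s₂ * intCoPoly β)).mulVec z, ?_⟩⟩
  rw [h, aeval_mulVec_castVec]

/-- If `p = (X - β) r` is the minimal polynomial of `β`, and if `w` is an integer vector that is
annihilated by `r(A)` for an integer matrix `A`, then `w = 0`: the coefficients of `r` are linearly
independent over `ℚ`, being polynomials in `β` of the different degrees less than `deg p`. -/
lemma eq_zero_of_aeval_divByMonic_mulVec (hβ : IsPisot β) {w : Fin (numTiles β) → ℤ}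
    (h : (aeval (substMatrix β) (minPoly β /ₘ (X - C β))).mulVec (castVec w) = 0) : w = 0 := by
  have hint : IsIntegral ℤ β := hβ.2.1
  set p := minpoly ℤ β with hp
  have hmon : p.Monic := minpoly.monic hint
  set d := p.natDegree with hd
  have hdpos : 0 < d := minpoly.natDegree_pos hint
  have hdeg : (minPoly β).natDegree = d := hmon.natDegree_map _
  set r := minPoly β /ₘ (X - C β) with hr
  have hrd : r.natDegree < d := by
    rw [hr, natDegree_divByMonic _ (monic_X_sub_C β), hdeg, natDegree_X_sub_C]
    omega
  -- the coefficients of `r` as values of integer polynomials at `β`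
  set R : ℕ → ℤ[X] := fun n => ∑ i ∈ Finset.Icc (n + 1) d, C (p.coeff i) * X ^ (i - (n + 1)) with hR
  have hRr : ∀ n, aeval β (R n) = r.coeff n := by
    intro n
    rw [hr, coeff_divByMonic_X_sub_C, hdeg, hR]
    simp only [map_sum, map_mul, aeval_C, aeval_X_pow, minPoly, coeff_map, algebraMap_int_eq,
      mul_comm, ← hp]
  have hRdeg : ∀ n, (R n).natDegree ≤ d - 1 := by
    intro n
    refine natDegree_sum_le_of_forall_le _ _ fun i hi => ?_
    rw [Finset.mem_Icc] at hi
    exact (natDegree_C_mul_X_pow_le _ _).trans (by omega)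
  have hRtop : ∀ n, (R n).coeff (d - 1) = if n = 0 then 1 else 0 := by
    intro n
    simp only [hR, finsetSum_coeff, coeff_C_mul_X_pow]
    split_ifs with hn
    · rw [Finset.sum_eq_single d]
      · rw [if_pos (by omega)]
        exact hmon.coeff_natDegree
      · intro i hi hne
        rw [Finset.mem_Icc] at hi
        rw [if_neg (by omega)]
      · intro hi
        exact (hi (Finset.mem_Icc.2 ⟨by omega, le_rfl⟩)).elim
    · refine Finset.sum_eq_zero fun i hi => ?_
      rw [Finset.mem_Icc] at hi
      rw [if_neg (by omega)]
  funext j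
  set U : ℤ[X] := ∑ n ∈ Finset.range d, C (((intMatrix β ^ n).mulVec w) j) * R n with hU
  have hU0 : aeval β U = 0 := by
    have h1 := congrFun h j
    rw [aeval_eq_sum_range' hrd, Matrix.sum_mulVec, Finset.sum_apply] at h1
    rw [hU, map_sum, ← Pi.zero_apply (M := fun _ => ℝ) j, ← h1]
    refine Finset.sum_congr rfl fun n _ => ?_
    have h2 : (substMatrix β ^ n).mulVec (castVec w) = castVec ((intMatrix β ^ n).mulVec w) := by
      simpa using aeval_mulVec_castVec (β := β) (X ^ n) w
    rw [Matrix.smul_mulVec, h2, map_mul, aeval_C, hRr, Pi.smul_apply, smul_eq_mul, mul_comm]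
    rfl
  have hUdeg : U.natDegree ≤ d - 1 := by
    refine natDegree_sum_le_of_forall_le _ _ fun n _ => ?_
    exact (natDegree_C_mul_le _ _).trans (hRdeg n)
  have hUz : U = 0 := by
    by_contra hne
    have := natDegree_le_of_dvd (minpoly.isIntegrallyClosed_dvd hint hU0) hne
    rw [← hp, ← hd] at this
    omega
  have hc : U.coeff (d - 1) = w j := by
    simp only [hU, finsetSum_coeff, coeff_C_mul, hRtop]
    rw [Finset.sum_eq_single 0]
    · simp
    · intro n _ hn
      simp [hn]
    · intro h0
      exact (h0 (Finset.mem_range.2 hdpos)).elim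
  rw [← hc, hUz]
  rfl

/-- An integer vector of total length zero projects to zero: with `p = (X - β) r`, the rows of
`r(A) q(A)` are left eigenvectors for `β`, that is, multiples of the length vector. -/
lemma pisotProj_castVec_eq_zero (hβ : IsPisot β) {z : Fin (numTiles β) → ℤ}
    (hz : totalLen β (castVec z) = 0) : pisotProj β (castVec z) = 0 := by
  set r := minPoly β /ₘ (X - C β) with hr
  have hroot : (minPoly β).IsRoot β := by
    rw [minPoly, IsRoot, eval_map, ← algebraMap_int_eq, ← aeval_def]
    exact minpoly.aeval _ _
  have hpr : (X - C β) * r = minPoly β := mul_divByMonic_eq_iff_isRoot.2 hroot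
  set M := aeval (substMatrix β) (r * coPoly β) with hM
  have hMA : M * substMatrix β = β • M := by
    have h1 : aeval (substMatrix β) ((r * coPoly β) * (X - C β)) = 0 := by
      rw [show r * coPoly β * (X - C β) = ((X - C β) * r) * coPoly β by ring, hpr, coPoly_eq hβ,
        minPoly, ← Polynomial.map_mul, ← algebraMap_int_eq, aeval_map_algebraMap,
        aeval_mul_intCoPoly hβ]
    rw [map_mul, ← hM, map_sub, aeval_X, aeval_C, mul_sub, sub_eq_zero] at h1
    rw [h1, Algebra.algebraMap_eq_smul_one, mul_smul_comm, mul_one]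
  have hrow : ∀ i, ∃ c : ℝ, M i = c • lenVec β := by
    intro i
    refine eq_smul_lenVec hβ ?_
    have := congrFun hMA i
    rw [Matrix.mul_apply_eq_vecMul] at this
    exact this
  have hMz : M.mulVec (castVec z) = 0 := by
    funext i
    obtain ⟨c, hc⟩ := hrow i
    change M i ⬝ᵥ castVec z = 0
    rw [hc, smul_dotProduct]
    exact mul_eq_zero_of_right _ hz
  obtain ⟨s₁, s₂, m, hm, -, -, h⟩ := exists_pisotProj_eq hβ
  have hm' : (m : ℝ) ≠ 0 := by exact_mod_cast hm
  have hq : (aeval (intMatrix β) (intCoPoly β)).mulVec z = 0 := by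
    refine eq_zero_of_aeval_divByMonic_mulVec hβ ?_
    rw [← aeval_mulVec_castVec, Matrix.mulVec_mulVec]
    rw [hM, map_mul, coPoly_eq hβ, ← algebraMap_int_eq, aeval_map_algebraMap] at hMz
    exact hMz
  have := h (castVec z)
  rw [map_mul, ← Matrix.mulVec_mulVec, aeval_mulVec_castVec, hq] at this
  have h0 : castVec (0 : Fin (numTiles β) → ℤ) = 0 := by
    funext j
    simp [castVec]
  rw [h0, Matrix.mulVec_zero] at this
  exact (smul_eq_zero.1 this).resolve_left hm'

lemma castVec_add (z w : Fin (numTiles β) → ℤ) : castVec (z + w) = castVec z + castVec w := by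
  funext j
  simp [castVec]

lemma castVec_sub (z w : Fin (numTiles β) → ℤ) : castVec (z - w) = castVec z - castVec w := by
  funext j
  simp [castVec]

lemma pisotProj_castVec_eq (hβ : IsPisot β) {z w : Fin (numTiles β) → ℤ}
    (h : totalLen β (castVec z) = totalLen β (castVec w)) :
    pisotProj β (castVec z) = pisotProj β (castVec w) := by
  rw [← sub_eq_zero, ← map_sub, ← castVec_sub]
  apply pisotProj_castVec_eq_zero hβ
  rw [castVec_sub, map_sub, h, sub_self]

lemma totalLen_castVec_mem (hβ : IsPisot β) (z : Fin (numTiles β) → ℤ) :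
    totalLen β (castVec z) ∈ betaRing β := by
  obtain ⟨C, -, hC⟩ := exists_bddConj_vertexSet hβ
  have hv : ∀ j : ℕ, j ≤ numTiles β → vtx β j ∈ betaRing β := fun j hj =>
    (hC _ (vtx_mem hβ hj)).mem
  change ∑ j, lenVec β j * (z j : ℝ) ∈ betaRing β
  refine sum_mem fun j _ => ?_
  refine mul_mem (sub_mem (hv _ (by omega)) (hv _ (by omega))) ?_
  exact intCast_mem _ _

/-- Every element of `ℤ[β]` is the total length of an integer vector: the vector with all entries
`1` has total length `1`. -/
lemma exists_totalLen_eq (hβ : IsPisot β) {x : ℝ} (hx : x ∈ betaRing β) :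
    ∃ z : Fin (numTiles β) → ℤ, totalLen β (castVec z) = x := by
  obtain ⟨P, rfl⟩ := mem_betaRing_iff.1 hx
  refine ⟨(aeval (intMatrix β) P).mulVec (fun _ => 1), ?_⟩
  rw [← aeval_mulVec_castVec, totalLen_aeval_mulVec hβ]
  have : totalLen β (castVec fun _ => 1) = 1 := by
    change ∑ j, lenVec β j * _ = 1
    simp only [castVec, Int.cast_one, mul_one, lenVec, len]
    rw [Fin.sum_univ_eq_sum_range (fun j => vtx β (j + 1) - vtx β j), Finset.sum_range_sub,
      vtx_numTiles hβ, vtx_zero hβ, sub_zero]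
  rw [this, mul_one]

/-- Only finitely many integer vectors, up to vectors of total length zero, have a projection of
bounded norm. -/
lemma finite_totalLen_of_norm_le (hβ : IsPisot β) (B : ℝ) :
    {x | ∃ z : Fin (numTiles β) → ℤ, ‖pisotProj β (castVec z)‖ ≤ B ∧
      totalLen β (castVec z) = x}.Finite := by
  obtain ⟨m, hm, hw⟩ := exists_smul_pisotProj_int hβ
  have hm' : (m : ℝ) ≠ 0 := by exact_mod_cast hm
  have hfin : {w : Fin (numTiles β) → ℤ | ‖castVec w‖ ≤ |(m : ℝ)| * B}.Finite := by
    refine (Set.Finite.pi' (fun _ => Set.finite_Icc ⌈-(|(m : ℝ)| * B)⌉ ⌊|(m : ℝ)| * B⌋)).subset ?_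
    intro w hw j
    have h1 := (norm_le_pi_norm (castVec w) j).trans hw
    rw [castVec, Real.norm_eq_abs, abs_le] at h1
    exact ⟨Int.ceil_le.2 h1.1, Int.le_floor.2 h1.2⟩
  refine (hfin.image fun w => (m : ℝ)⁻¹ * totalLen β (castVec w)).subset ?_
  rintro x ⟨z, hz, rfl⟩
  obtain ⟨w, hw⟩ := hw z
  refine ⟨w, ?_, ?_⟩
  · change ‖castVec w‖ ≤ _
    rw [← hw, norm_smul, Real.norm_eq_abs]
    exact mul_le_mul_of_nonneg_left hz (abs_nonneg _)
  · simp only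
    rw [← hw, map_smul, totalLen_pisotProj hβ, smul_eq_mul, inv_mul_cancel_left₀ hm']

lemma exists_norm_pisotProj_le (hβ : IsPisot β) {F : Set ℝ} (hF : F.Finite) :
    ∃ B, ∀ z : Fin (numTiles β) → ℤ, totalLen β (castVec z) ∈ F →
      ‖pisotProj β (castVec z)‖ ≤ B := by
  have hfin : {v | ∃ z : Fin (numTiles β) → ℤ, totalLen β (castVec z) ∈ F ∧
      pisotProj β (castVec z) = v}.Finite := by
    refine Set.Finite.of_injOn (f := totalLen β) (t := F) ?_ ?_ hF
    · rintro _ ⟨z, hz, rfl⟩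
      rwa [totalLen_pisotProj hβ]
    · rintro _ ⟨z, hz, rfl⟩ _ ⟨w, hw, rfl⟩ h
      rw [totalLen_pisotProj hβ, totalLen_pisotProj hβ] at h
      exact pisotProj_castVec_eq hβ h
  obtain ⟨B, hB⟩ := (hfin.image fun v => ‖v‖).bddAbove
  exact ⟨B, fun z hz => hB ⟨_, ⟨z, hz, rfl⟩, rfl⟩⟩

/-! ### Functions on tilings -/

lemma Tile.min_mem_support (hβ : IsPisot β) (τ : Tile β) : τ.min ∈ τ.support :=
  Tile.mem_support.2 ⟨le_rfl, (Tile.min_lt_max hβ τ).le⟩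

lemma Tile.max_mem_support (hβ : IsPisot β) (τ : Tile β) : τ.max ∈ τ.support :=
  Tile.mem_support.2 ⟨(Tile.min_lt_max hβ τ).le, le_rfl⟩

lemma IsTiling.exists_min_eq_max (hβ : IsPisot β) {T : Set (Tile β)} (hT : IsTiling T)
    {τ : Tile β} (hτ : τ ∈ T) : ∃ σ ∈ T, σ.min = τ.max := by
  obtain ⟨σ, hσ, hy⟩ := hT.exists_mem hβ τ.max
  rw [Tile.mem_ico] at hy
  refine ⟨σ, hσ, hy.1.antisymm ?_⟩
  have hlt := Tile.min_lt_max hβ τ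
  by_contra! h
  rcases lt_trichotomy τ.min σ.min with h1 | h1 | h1
  · exact absurd (hT.packed.max_le_min hβ hτ hσ h1) h.not_ge
  · have : τ = σ := hT.packed τ hτ σ hσ τ.min (Tile.mem_ico.2 ⟨le_rfl, hlt⟩)
      (Tile.mem_ico.2 ⟨h1.ge, by linarith⟩)
    exact absurd hy.2 (by rw [this]; exact lt_irrefl _)
  · exact absurd (hT.packed.max_le_min hβ hσ hτ h1) (by linarith)

/-- A function that is constant on each tile of a tiling is constant. -/
lemma IsTiling.eq_of_constant (hβ : IsPisot β) {X : Type*} {T : Set (Tile β)} (hT : IsTiling T)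
    {g : ℝ → X} (hg : ∀ τ ∈ T, ∀ x ∈ τ.support, g x = g τ.min) (x y : ℝ) : g x = g y := by
  obtain ⟨δ, hδ, -, hlen⟩ := exists_len_bound hβ
  have key : ∀ n : ℕ, ∀ τ ∈ T, ∀ y, τ.min ≤ y → y ≤ τ.min + n * δ → g y = g τ.min := by
    intro n
    induction n with
    | zero =>
      intro τ _ y h1 h2
      rw [Nat.cast_zero, zero_mul, add_zero] at h2
      rw [le_antisymm h2 h1]
    | succ n ih =>
      intro τ hτ y h1 h2
      rcases le_or_gt y τ.max with h | h
      · exact hg τ hτ y (Tile.mem_support.2 ⟨h1, h⟩)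
      · obtain ⟨σ, hσ, hm⟩ := hT.exists_min_eq_max hβ hτ
        rw [ih σ hσ y (by rw [hm]; exact h.le), hm]
        · exact hg τ hτ _ (Tile.max_mem_support hβ τ)
        · rw [hm, Tile.max_eq]
          push_cast at h2
          linarith [hlen τ.type]
  wlog hxy : x ≤ y generalizing x y
  · exact (this y x (le_of_not_ge hxy)).symm
  obtain ⟨τ, hτ, hx⟩ := hT.exists_mem hβ x
  rw [Tile.mem_ico] at hx
  obtain ⟨n, hn⟩ := exists_nat_gt ((y - τ.min) / δ)
  rw [div_lt_iff₀ hδ] at hn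
  rw [key n τ hτ y (hx.1.trans hxy) (by linarith),
    key n τ hτ x hx.1 (by linarith)]

/-! ### Lifts of tilings -/

/-- Two lifts of a tiling differ by an integer vector. -/
lemma IsLift.exists_eq_add (hβ : IsPisot β) {T : Set (Tile β)} (hT : IsTiling T)
    {f f' : ℝ → Fin (numTiles β) → ℝ} (hf : IsLift T f) (hf' : IsLift T f') :
    ∃ z : Fin (numTiles β) → ℤ, ∀ x, f' x = f x + castVec z := by
  obtain ⟨τ, hτ, -⟩ := hT.exists_mem hβ 0
  obtain ⟨a, ha⟩ := hf τ hτ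
  obtain ⟨b, hb⟩ := hf' τ hτ
  refine ⟨b - a, fun x => ?_⟩
  have hc := hT.eq_of_constant hβ (g := fun x => f' x - f x) ?_ x τ.min
  · rw [← sub_eq_iff_eq_add', hc, ha _ (Tile.min_mem_support hβ τ),
      hb _ (Tile.min_mem_support hβ τ), castVec_sub]
    unfold castVec
    abel
  · intro σ hσ x hx
    obtain ⟨a, ha⟩ := hf σ hσ
    obtain ⟨b, hb⟩ := hf' σ hσ
    rw [ha x hx, hb x hx, ha _ (Tile.min_mem_support hβ σ), hb _ (Tile.min_mem_support hβ σ)]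
    simp

lemma IsLift.add_castVec {T : Set (Tile β)} {f : ℝ → Fin (numTiles β) → ℝ} (hf : IsLift T f)
    (z : Fin (numTiles β) → ℤ) : IsLift T fun x => f x + castVec z := by
  intro τ hτ
  obtain ⟨a, ha⟩ := hf τ hτ
  refine ⟨a + z, fun x hx => ?_⟩
  simp only
  rw [ha x hx, add_right_comm]
  congr 1
  exact (castVec_add a z).symm

lemma IsLift.exists_apply_min (hβ : IsPisot β) {T : Set (Tile β)}
    {f : ℝ → Fin (numTiles β) → ℝ} (hf : IsLift T f) {τ : Tile β} (hτ : τ ∈ T) :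
    ∃ z, f τ.min = castVec z := by
  obtain ⟨a, ha⟩ := hf τ hτ
  refine ⟨a, ?_⟩
  rw [ha _ (Tile.min_mem_support hβ τ)]
  simp only [sub_self, zero_div, Pi.single_zero, add_zero]
  rfl

/-- The total length along a lift is the position up to a constant. -/
lemma IsLift.totalLen_eq (hβ : IsPisot β) {T : Set (Tile β)} (hT : IsTiling T)
    {f : ℝ → Fin (numTiles β) → ℝ} (hf : IsLift T f) (x y : ℝ) :
    totalLen β (f x) - x = totalLen β (f y) - y := by
  refine hT.eq_of_constant hβ (g := fun x => totalLen β (f x) - x) ?_ x y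
  intro σ hσ x hx
  obtain ⟨a, ha⟩ := hf σ hσ
  have hs : ∀ r : ℝ, totalLen β (Pi.single σ.type r) = len β σ.type * r := fun r =>
    dotProduct_single (lenVec β) r σ.type
  rw [ha x hx, ha _ (Tile.min_mem_support hβ σ), map_add, map_add, hs, hs,
    mul_div_cancel₀ _ (len_pos hβ σ.type).ne', sub_self, zero_div, mul_zero]
  ring

/-- The fraction of the support of the tile that lies to the left of `x`. -/
def leftFrac (σ : Tile β) (x : ℝ) : ℝ := max 0 (min 1 ((x - σ.min) / len β σ.type))

lemma leftFrac_of_mem (hβ : IsPisot β) {σ : Tile β} {x : ℝ} (hx : x ∈ σ.support) :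
    leftFrac σ x = (x - σ.min) / len β σ.type := by
  have hl := len_pos hβ σ.type
  rw [Tile.mem_support, Tile.max_eq] at hx
  rw [leftFrac, min_eq_right, max_eq_right]
  · exact div_nonneg (by linarith) hl.le
  · rw [div_le_one hl]
    linarith

lemma leftFrac_of_le_min (hβ : IsPisot β) {σ : Tile β} {x : ℝ} (hx : x ≤ σ.min) :
    leftFrac σ x = 0 := by
  rw [leftFrac, max_eq_left]
  exact (min_le_right _ _).trans
    (div_nonpos_of_nonpos_of_nonneg (by linarith) (len_pos hβ σ.type).le)

lemma leftFrac_of_max_le (hβ : IsPisot β) {σ : Tile β} {x : ℝ} (hx : σ.max ≤ x) :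
    leftFrac σ x = 1 := by
  rw [Tile.max_eq] at hx
  rw [leftFrac, min_eq_left, max_eq_right zero_le_one]
  rw [one_le_div (len_pos hβ σ.type)]
  linarith

open Classical in
/-- On a tile of a packed collection, the fractions for the other tiles are constant, and equal to
`0` or `1`. -/
lemma Packed.frac_eq (hβ : IsPisot β) {P : Set (Tile β)} (hP : Packed P) {σ τ : Tile β}
    (hσ : σ ∈ P) (hτ : τ ∈ P) : ∃ k : ℤ, ∀ x ∈ τ.support,
      leftFrac σ x = k + if σ = τ then (x - τ.min) / len β τ.type else 0 := by
  rcases lt_trichotomy σ.min τ.min with h | h | h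
  · have h1 := hP.max_le_min hβ hσ hτ h
    refine ⟨1, fun x hx => ?_⟩
    rw [leftFrac_of_max_le hβ (h1.trans (Tile.mem_support.1 hx).1), if_neg]
    · simp
    · rintro rfl
      exact lt_irrefl _ h
  · have : σ = τ := hP σ hσ τ hτ σ.min (Tile.mem_ico.2 ⟨le_rfl, Tile.min_lt_max hβ σ⟩)
      (Tile.mem_ico.2 ⟨h.ge, h ▸ Tile.min_lt_max hβ τ⟩)
    subst this
    refine ⟨0, fun x hx => ?_⟩
    rw [leftFrac_of_mem hβ hx, if_pos rfl, Int.cast_zero, zero_add]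
  · have h1 := hP.max_le_min hβ hτ hσ h
    refine ⟨0, fun x hx => ?_⟩
    rw [leftFrac_of_le_min hβ ((Tile.mem_support.1 hx).2.trans h1), if_neg]
    · simp
    · rintro rfl
      exact lt_irrefl _ h

/-- Every tiling has a lift: its `j`-th coordinate at `x` is the number of tiles of type `j`
between a base point and `x`, where tiles on the boundary are counted by their fractions. -/
lemma IsTiling.exists_lift (hβ : IsPisot β) {T : Set (Tile β)} (hT : IsTiling T) :
    ∃ f, IsLift T f := by
  classical
  obtain ⟨τ₀, hτ₀, -⟩ := hT.exists_mem hβ 0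
  set p := τ₀.min with hp
  set g : Fin (numTiles β) → ℝ → Tile β → ℝ := fun j x σ =>
    if σ ∈ T ∧ σ.type = j then leftFrac σ x - leftFrac σ p else 0 with hg
  have hfin : ∀ x : ℝ, {σ : Tile β | σ ∈ T ∧ leftFrac σ x - leftFrac σ p ≠ 0}.Finite := by
    intro x
    refine (hT.packed.finite hβ (min x p) (max x p)).subset ?_
    rintro σ ⟨hσ, h⟩
    refine ⟨hσ, ?_, ?_⟩
    · by_contra! h1
      rw [leftFrac_of_max_le hβ (h1.le.trans (min_le_left _ _)),
        leftFrac_of_max_le hβ (h1.le.trans (min_le_right _ _)), sub_self] at h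
      exact h rfl
    · by_contra! h1
      rw [leftFrac_of_le_min hβ ((le_max_left _ _).trans h1.le),
        leftFrac_of_le_min hβ ((le_max_right _ _).trans h1.le), sub_self] at h
      exact h rfl
  have hg_fin : ∀ j x, (Function.support (g j x)).Finite := by
    intro j x
    refine (hfin x).subset fun σ hσ => ?_
    simp only [hg, Function.mem_support] at hσ
    split_ifs at hσ with h
    · exact ⟨h.1, hσ⟩
    · exact absurd rfl hσ
  refine ⟨fun x j => ∑ᶠ σ, g j x σ, fun τ hτ => ?_⟩
  have hint : ∀ j, ∃ k : ℤ, ∑ᶠ σ, g j τ.min σ = k := by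
    intro j
    have h : ∀ σ, ∃ k : ℤ, g j τ.min σ = k := by
      intro σ
      simp only [hg]
      split_ifs with h
      · obtain ⟨k, hk⟩ := hT.packed.frac_eq hβ h.1 hτ
        obtain ⟨l, hl⟩ := hT.packed.frac_eq hβ h.1 hτ₀
        refine ⟨k - l, ?_⟩
        rw [hk _ (Tile.min_mem_support hβ τ), hl _ (Tile.min_mem_support hβ τ₀)]
        simp
      · exact ⟨0, by simp⟩
    choose k hk using h
    rw [finsum_eq_sum _ (hg_fin j τ.min)]
    exact ⟨∑ σ ∈ (hg_fin j τ.min).toFinset, k σ, by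
      rw [Int.cast_sum]; exact Finset.sum_congr rfl fun σ _ => hk σ⟩
  choose a ha using hint
  refine ⟨a, fun x hx => ?_⟩
  funext j
  rw [Pi.add_apply, ← ha j, ← sub_eq_iff_eq_add', ← finsum_sub_distrib (hg_fin j x)
    (hg_fin j τ.min), finsum_eq_single _ τ]
  · simp only [hg, hτ, true_and]
    obtain ⟨k, hk⟩ := hT.packed.frac_eq hβ hτ hτ
    by_cases hj : τ.type = j
    · subst hj
      rw [if_pos rfl, if_pos rfl, hk x hx, hk _ (Tile.min_mem_support hβ τ), Pi.single_eq_same]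
      simp
    · rw [if_neg hj, if_neg hj, Pi.single_eq_of_ne (Ne.symm hj), sub_zero]
  · intro σ hσ
    simp only [hg]
    split_ifs with h
    · obtain ⟨k, hk⟩ := hT.packed.frac_eq hβ h.1 hτ
      rw [hk x hx, hk _ (Tile.min_mem_support hβ τ), if_neg hσ, if_neg hσ]
      simp
    · simp

/-! ### The action of the substitution on lifts -/

lemma wordPath_zero (hβ : IsPisot β) (i : Fin (numTiles β)) : wordPath β i 0 = 0 := by
  funext j
  refine finsum_mem_eq_zero_of_forall_eq_zero fun k hk => ?_
  rw [max_eq_left]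
  refine (min_le_right _ _).trans (div_nonpos_of_nonpos_of_nonneg ?_ (len_pos hβ j).le)
  rw [zero_mul, add_zero]
  linarith [hk.1]

lemma wordPath_one (hβ : IsPisot β) (i : Fin (numTiles β)) :
    wordPath β i 1 = (substMatrix β).mulVec (Pi.single i 1) := by
  funext j
  rw [Matrix.mulVec_single_one]
  change wordPath β i 1 j = ((offsets β i j).ncard : ℝ)
  rw [Set.ncard_eq_toFinset_card _ (finite_offsets i j), wordPath,
    finsum_mem_eq_finite_toFinset_sum _ (finite_offsets i j), ← nsmul_one, ← Finset.sum_const]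
  refine Finset.sum_congr rfl fun k hk => ?_
  rw [Set.Finite.mem_toFinset] at hk
  have h2 := hk.2
  have hl : len β j = vtx β (j + 1) - vtx β j := rfl
  have hl' : len β i = vtx β (i + 1) - vtx β i := rfl
  rw [min_eq_left, max_eq_right zero_le_one]
  rw [one_le_div (len_pos hβ j), one_mul, hl, hl']
  linarith

lemma liftMap_castVec_add_single (hβ : IsPisot β) (z : Fin (numTiles β) → ℤ)
    (i : Fin (numTiles β)) {u : ℝ} (h0 : 0 ≤ u) (h1 : u ≤ 1) :
    liftMap β (castVec z + Pi.single i u) =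
      (substMatrix β).mulVec (castVec z) + wordPath β i u := by
  rcases h1.eq_or_lt with rfl | h1
  · have e : castVec z + Pi.single i (1 : ℝ) = castVec (z + Pi.single i 1) := by
      rw [castVec_add]
      congr 1
      funext j
      rw [castVec, Pi.single_apply, Pi.single_apply]
      split_ifs <;> simp
    rw [e, liftMap]
    have hf : ∀ j, ⌊castVec (z + Pi.single i 1) j⌋ =
        (z + Pi.single i 1 : Fin (numTiles β) → ℤ) j := fun j =>
      Int.floor_intCast _
    have hr : ∀ j, Int.fract (castVec (z + Pi.single i 1) j) = 0 := fun j =>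
      Int.fract_intCast _
    simp only [hf, hr, wordPath_zero hβ, Finset.sum_const_zero, add_zero]
    rw [wordPath_one hβ, ← Matrix.mulVec_add, e]
    rfl
  · have hf : ∀ j, ⌊(castVec z + Pi.single i u : Fin (numTiles β) → ℝ) j⌋ = z j := by
      intro j
      rw [Pi.add_apply, castVec, Int.floor_intCast_add, Pi.single_apply]
      split_ifs
      · rw [Int.floor_eq_zero_iff.2 ⟨h0, h1⟩, add_zero]
      · simp
    have hr : ∀ j, Int.fract ((castVec z + Pi.single i u : Fin (numTiles β) → ℝ) j) =
        if j = i then u else 0 := by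
      intro j
      rw [Pi.add_apply, castVec, Int.fract_intCast_add, Pi.single_apply]
      split_ifs
      · exact Int.fract_eq_self.2 ⟨h0, h1⟩
      · simp
    rw [liftMap]
    simp only [hf, hr]
    congr 1
    rw [Finset.sum_eq_single i]
    · rw [if_pos rfl]
    · intro j _ hj
      rw [if_neg hj, wordPath_zero hβ]
    · exact fun h => (h (Finset.mem_univ _)).elim

lemma liftMap_castVec (hβ : IsPisot β) (z : Fin (numTiles β) → ℤ) :
    liftMap β (castVec z) = (substMatrix β).mulVec (castVec z) := by
  have := liftMap_castVec_add_single hβ z ⟨0, numTiles_pos hβ⟩ le_rfl zero_le_one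
  rwa [Pi.single_zero, add_zero, wordPath_zero hβ, add_zero] at this

lemma IsLift.liftSubst_isLift (hβ : IsPisot β) {T : Set (Tile β)} {f : ℝ → Fin (numTiles β) → ℝ}
    (hf : IsLift T f) : IsLift (subst T) (liftSubst β f) := by
  classical
  intro σ hσ
  obtain ⟨τ, hτ, hστ⟩ := mem_subst.1 hσ
  obtain ⟨a, ha⟩ := hf τ hτ
  have hP : Packed (substTile τ) := by
    rw [← subst_singleton]
    exact (packed_singleton _).subst hβ
  have hb := substTile_bounds hστ
  have hlτ := len_pos hβ τ.type
  -- the coordinates of the word path count the tiles of the image of `τ` by their fractions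
  have hpath : ∀ j, ∃ b : ℤ, ∀ x ∈ σ.support,
      wordPath β τ.type ((x / β - τ.min) / len β τ.type) j =
        b + Pi.single (M := fun _ => ℝ) σ.type ((x - σ.min) / len β σ.type) j := by
    intro j
    have hmem : ∀ k ∈ offsets β τ.type j,
        (⟨j, β * τ.shift + k⟩ : Tile β) ∈ substTile τ := fun k hk => ⟨k, hk, rfl⟩
    have hk : ∀ k, ∃ b : ℤ, k ∈ offsets β τ.type j → ∀ x ∈ σ.support,
        leftFrac (⟨j, β * τ.shift + k⟩ : Tile β) x =
          b + if (⟨j, β * τ.shift + k⟩ : Tile β) = σ then (x - σ.min) / len β σ.type else 0 := by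
      intro k
      by_cases hk : k ∈ offsets β τ.type j
      · obtain ⟨b, hb⟩ := hP.frac_eq hβ (hmem k hk) hστ
        exact ⟨b, fun _ => hb⟩
      · exact ⟨0, fun h => absurd h hk⟩
    choose b hb using hk
    refine ⟨∑ k ∈ (finite_offsets τ.type j).toFinset, b k, fun x hx => ?_⟩
    have h1 : wordPath β τ.type ((x / β - τ.min) / len β τ.type) j =
        ∑ k ∈ (finite_offsets τ.type j).toFinset,
          leftFrac (⟨j, β * τ.shift + k⟩ : Tile β) x := by
      rw [wordPath, finsum_mem_eq_finite_toFinset_sum _ (finite_offsets τ.type j)]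
      refine Finset.sum_congr rfl fun k _ => ?_
      rw [leftFrac, div_mul_cancel₀ _ hlτ.ne']
      congr 3
      simp only [Tile.min]
      rw [mul_add, mul_sub, mul_div_cancel₀ _ hβ.pos.ne']
      ring
    rw [h1, Int.cast_sum]
    have h2 : Pi.single (M := fun _ => ℝ) σ.type ((x - σ.min) / len β σ.type) j =
        ∑ k ∈ (finite_offsets τ.type j).toFinset,
          if (⟨j, β * τ.shift + k⟩ : Tile β) = σ then (x - σ.min) / len β σ.type else 0 := by
      obtain ⟨l, hl, hl'⟩ := id hστ
      by_cases hj : σ.type = j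
      · subst hj
        rw [Pi.single_eq_same, Finset.sum_eq_single l]
        · rw [if_pos]
          ext
          · rfl
          · exact hl'.symm
        · intro k _ hk
          rw [if_neg]
          intro h
          have := congrArg Tile.shift h
          rw [hl'] at this
          exact hk (by exact_mod_cast add_left_cancel this)
        · exact fun h => (h ((finite_offsets _ _).mem_toFinset.2 hl)).elim
      · rw [Pi.single_eq_of_ne (Ne.symm hj)]
        refine (Finset.sum_eq_zero fun k _ => if_neg fun h => hj ?_).symm
        exact (congrArg Tile.type h).symm
    rw [h2, ← Finset.sum_add_distrib]
    exact Finset.sum_congr rfl fun k hk => hb k ((finite_offsets _ _).mem_toFinset.1 hk) x hx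
  choose b hb' using hpath
  refine ⟨(intMatrix β).mulVec a + b, fun x hx => ?_⟩
  have hx' := Tile.mem_support.1 hx
  have hxτ : x / β ∈ τ.support := by
    rw [Tile.mem_support, le_div_iff₀ hβ.pos, div_le_iff₀ hβ.pos]
    constructor <;> linarith
  have hxτ' := Tile.mem_support.1 hxτ
  rw [Tile.max_eq] at hxτ'
  rw [liftSubst, ha _ hxτ]
  change liftMap β (castVec a + _) = castVec ((intMatrix β).mulVec a + b) + _
  rw [liftMap_castVec_add_single hβ a _ (div_nonneg (by linarith) hlτ.le)
    ((div_le_one hlτ).2 (by linarith)), substMatrix_mulVec_castVec, castVec_add, add_assoc]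
  congr 1
  funext j
  rw [hb' j x hx]
  rfl

/-- The additive constant in the total length along a lift is multiplied by `β`. -/
lemma IsLift.totalLen_liftSubst (hβ : IsPisot β) {T : Set (Tile β)} (hT : IsTiling T)
    (hT' : IsTiling (subst T)) {f : ℝ → Fin (numTiles β) → ℝ} (hf : IsLift T f) {c : ℝ}
    (hc : ∀ x, totalLen β (f x) = x + c) (x : ℝ) :
    totalLen β (liftSubst β f x) = x + β * c := by
  obtain ⟨τ, hτ, -⟩ := hT.exists_mem hβ 0
  obtain ⟨z, hz⟩ := hf.exists_apply_min hβ hτ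
  have h := (hf.liftSubst_isLift hβ).totalLen_eq hβ hT' x (β * τ.min)
  have h2 : liftSubst β f (β * τ.min) = (substMatrix β).mulVec (castVec z) := by
    rw [liftSubst, mul_div_cancel_left₀ _ hβ.pos.ne', hz, liftMap_castVec hβ]
  rw [h2, totalLen_mulVec hβ, ← hz, hc] at h
  linarith

/-! ### Orbits of strands -/

lemma StrandStep.exists_totalLen (hβ : IsPisot β) {T : Set (Tile β)} (hT : IsTiling T)
    (hT' : IsTiling (subst T)) {γ γ' : ℝ → Fin (numTiles β) → ℝ} (h : StrandStep T γ γ') :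
    ∃ c, (∀ t, totalLen β (γ t) = t + c) ∧ ∀ t, totalLen β (γ' t) = t + β * c := by
  obtain ⟨x, hx, f, hf, h1, h2⟩ := h
  have hc : ∀ t, totalLen β (f t) = t + totalLen β (f 0) := fun t => by
    have := hf.totalLen_eq hβ hT t 0
    linarith
  refine ⟨totalLen β x + totalLen β (f 0), fun t => ?_, fun t => ?_⟩
  · rw [h1, map_add, totalLen_pisotProj hβ, hc]
    ring
  · rw [h2, map_add, totalLen_pisotProj hβ, hf.totalLen_liftSubst hβ hT hT' hc,
      totalLen_mulVec hβ]
    ring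

lemma IsLift.exists_apply_tStar (hβ : IsPisot β) {T : Set (Tile β)} (hT : T ∈ tilingSpace β)
    {f : ℝ → Fin (numTiles β) → ℝ} (hf : IsLift T f) : ∃ z, f (tStar T) = castVec z := by
  obtain ⟨C, -, hC⟩ := exists_tStar_spec hβ
  have := hf.exists_apply_min hβ (hC T hT).1
  rwa [firstTile_min] at this

lemma abs_totalLen_le (v : Fin (numTiles β) → ℝ) :
    |totalLen β v| ≤ (∑ j, |lenVec β j|) * ‖v‖ := by
  change |∑ j, lenVec β j * v j| ≤ _
  rw [Finset.sum_mul]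
  refine (Finset.abs_sum_le_sum_abs _ _).trans (Finset.sum_le_sum fun j _ => ?_)
  rw [abs_mul]
  exact mul_le_mul_of_nonneg_left (norm_le_pi_norm v j) (abs_nonneg _)

/-- If two strand orbits remain at bounded distance, and if their initial vertices differ by
projections of integer vectors, then the initial vertices of the tilings differ by elements of a
finite subset of `ℤ[β]`: the total lengths along the two strands differ from the positions by the
same constant, since the substitution multiplies the difference of the constants by `β`. -/
lemma exists_finite_of_boundedDistance (hβ : IsPisot β) {U U' : ℤ → Set (Tile β)}
    (hU : IsOrbit β U) (hU' : IsOrbit β U') {γ γ' : ℤ → ℝ → Fin (numTiles β) → ℝ}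
    (hγ : IsStrandOrbit U γ) (hγ' : IsStrandOrbit U' γ') (hB : BoundedDistance U U' γ γ')
    (hz : ∀ i, ∃ z : Fin (numTiles β) → ℤ,
      γ i (tStar (U i)) - γ' i (tStar (U' i)) = pisotProj β (castVec z)) :
    ∃ F : Set ℝ, F.Finite ∧ F ⊆ betaRing β ∧ ∀ i, tStar (U i) - tStar (U' i) ∈ F := by
  obtain ⟨B, hB⟩ := hB
  obtain ⟨C, hC1, hC⟩ := exists_tStar_spec hβ
  have h1 : ∀ i, ∃ c, (∀ t, totalLen β (γ i t) = t + c) ∧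
      ∀ t, totalLen β (γ (i + 1) t) = t + β * c := fun i =>
    (hγ i).exists_totalLen hβ (hU i).1.1 ((hU i).2 ▸ (hU (i + 1)).1.1)
  have h2 : ∀ i, ∃ c, (∀ t, totalLen β (γ' i t) = t + c) ∧
      ∀ t, totalLen β (γ' (i + 1) t) = t + β * c := fun i =>
    (hγ' i).exists_totalLen hβ (hU' i).1.1 ((hU' i).2 ▸ (hU' (i + 1)).1.1)
  choose c hc hc' using h1
  choose c' hc₂ hc₂' using h2
  have hrec : ∀ i, c (i + 1) - c' (i + 1) = β * (c i - c' i) := by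
    intro i
    have e1 := (hc (i + 1) 0).symm.trans (hc' i 0)
    have e2 := (hc₂ (i + 1) 0).symm.trans (hc₂' i 0)
    linarith
  set K := ∑ j, |lenVec β j| with hK
  have hbd : ∀ i, |c i - c' i| ≤ K * B + C := by
    intro i
    have e := abs_totalLen_le (γ i (tStar (U i)) - γ' i (tStar (U' i)))
    rw [map_sub, hc, hc₂] at e
    have e2 := mul_le_mul_of_nonneg_left (hB i)
      (Finset.sum_nonneg fun j _ => abs_nonneg (lenVec β j) : 0 ≤ K)
    obtain ⟨-, h3, h4⟩ := hC _ (hU i).1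
    obtain ⟨-, h5, h6⟩ := hC _ (hU' i).1
    have e3 := abs_le.1 (e.trans e2)
    rw [abs_le]
    constructor <;> linarith [e3.1, e3.2]
  have hzero : ∀ i, c i = c' i := by
    intro i
    have hp : ∀ n : ℕ, c (i + n) - c' (i + n) = β ^ n * (c i - c' i) := by
      intro n
      induction n with
      | zero => simp
      | succ n ih =>
        rw [Nat.cast_succ, ← add_assoc, hrec, ih]
        ring
    by_contra hne
    have hd : 0 < |c i - c' i| := abs_pos.2 (sub_ne_zero.2 hne)
    obtain ⟨n, hn⟩ := pow_unbounded_of_one_lt ((K * B + C) / |c i - c' i|) hβ.one_lt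
    have := hbd (i + n)
    rw [hp, abs_mul, abs_of_pos (pow_pos hβ.pos n)] at this
    rw [div_lt_iff₀ hd] at hn
    linarith
  refine ⟨_, finite_totalLen_of_norm_le hβ B, ?_, fun i => ?_⟩
  · rintro _ ⟨z, -, rfl⟩
    exact totalLen_castVec_mem hβ z
  · obtain ⟨z, hz⟩ := hz i
    refine ⟨z, hz ▸ hB i, ?_⟩
    rw [← totalLen_pisotProj hβ, ← hz, map_sub, hc, hc₂, hzero]
    ring

/-- A relation that can be continued in both directions has two-sided orbits. -/
lemma exists_int_sequence {α : Type*} (R : ℤ → α → α → Prop) (a : α)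
    (hf : ∀ i a, ∃ b, R i a b) (hb : ∀ i b, ∃ a, R i a b) :
    ∃ x : ℤ → α, x 0 = a ∧ ∀ i, R i (x i) (x (i + 1)) := by
  choose f hf using hf
  choose g hg using hb
  let fw : ℕ → α := fun n => Nat.rec a (fun n b => f n b) n
  let bw : ℕ → α := fun n => Nat.rec a (fun n b => g (Int.negSucc n) b) n
  refine ⟨fun i => match i with
    | Int.ofNat n => fw n
    | Int.negSucc n => bw (n + 1), rfl, ?_⟩
  rintro (n | n)
  · exact hf _ _
  · cases n with
    | zero => exact hg _ _
    | succ n => exact hg _ _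

/-- If the differences of the initial vertices of the tilings of two orbits lie in a finite subset
of `ℤ[β]`, then there are strand orbits that shadow each other. The lifts of the two tilings are
chosen with the same additive constant in the total length; the corrections that make the strands
orbits of the substitution then agree, as they are projections of integer vectors with the same
total length. -/
lemma exists_strandOrbits (hβ : IsPisot β) {U U' : ℤ → Set (Tile β)}
    (hU : IsOrbit β U) (hU' : IsOrbit β U') {F : Set ℝ} (hF : F.Finite) (hFR : F ⊆ betaRing β)
    (h : ∀ i, tStar (U i) - tStar (U' i) ∈ F) :
    ∃ γ γ' : ℤ → ℝ → Fin (numTiles β) → ℝ, IsStrandOrbit U γ ∧ IsStrandOrbit U' γ' ∧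
      (∃ f f', IsLift (U 0) f ∧ IsLift (U' 0) f' ∧
        IsStrandOf β 0 f (γ 0) ∧ IsStrandOf β 0 f' (γ' 0)) ∧
      (∀ i, ∃ x ∈ pisotSubspace β, ∃ f f', IsLift (U i) f ∧ IsLift (U' i) f' ∧
        IsStrandOf β x f (γ i) ∧ IsStrandOf β x f' (γ' i)) ∧
      BoundedDistance U U' γ γ' := by
  have hlift : ∀ i, ∃ f f' : ℝ → Fin (numTiles β) → ℝ, ∃ z : Fin (numTiles β) → ℤ, ∃ c : ℝ,
      IsLift (U i) f ∧ IsLift (U' i) f' ∧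
      (∀ t, totalLen β (f t) = t + c) ∧ (∀ t, totalLen β (f' t) = t + c) ∧
      f (tStar (U i)) - f' (tStar (U' i)) = castVec z ∧
      totalLen β (castVec z) = tStar (U i) - tStar (U' i) := by
    intro i
    obtain ⟨f, hf⟩ := (hU i).1.1.exists_lift hβ
    obtain ⟨f', hf'⟩ := (hU' i).1.1.exists_lift hβ
    obtain ⟨a, ha⟩ := hf.exists_apply_tStar hβ (hU i).1
    obtain ⟨b, hb⟩ := hf'.exists_apply_tStar hβ (hU' i).1
    obtain ⟨w, hw⟩ := exists_totalLen_eq hβ (hFR (h i))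
    have e1 : f (tStar (U i)) + castVec (w - a + b) - f' (tStar (U' i)) = castVec w := by
      rw [ha, hb, castVec_add, castVec_sub]
      abel
    have hg := hf.add_castVec (w - a + b)
    refine ⟨_, f', w, totalLen β (f' 0), hg, hf', fun t => ?_, fun t => ?_, e1, hw⟩
    · have e2 := congrArg (totalLen β) e1
      rw [map_sub, hw] at e2
      have e3 := hg.totalLen_eq hβ (hU i).1.1 t (tStar (U i))
      have e4 := hf'.totalLen_eq hβ (hU' i).1.1 (tStar (U' i)) 0
      linarith
    · have := hf'.totalLen_eq hβ (hU' i).1.1 t 0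
      linarith
  choose f f' z c hf hf' hc hc' hz hzL using hlift
  have hcorr : ∀ i, ∃ y ∈ pisotSubspace β,
      (∀ t, pisotProj β (liftSubst β (f i) t) = y + pisotProj β (f (i + 1) t)) ∧
      ∀ t, pisotProj β (liftSubst β (f' i) t) = y + pisotProj β (f' (i + 1) t) := by
    intro i
    have h1 := (hf i).liftSubst_isLift hβ
    have h2 := (hf' i).liftSubst_isLift hβ
    have hT : IsTiling (subst (U i)) := (hU i).2 ▸ (hU (i + 1)).1.1
    have hT' : IsTiling (subst (U' i)) := (hU' i).2 ▸ (hU' (i + 1)).1.1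
    obtain ⟨w, hw⟩ := IsLift.exists_eq_add hβ hT ((hU i).2 ▸ hf (i + 1)) h1
    obtain ⟨w', hw'⟩ := IsLift.exists_eq_add hβ hT' ((hU' i).2 ▸ hf' (i + 1)) h2
    have e : totalLen β (castVec w) = totalLen β (castVec w') := by
      have e1 := congrArg (totalLen β) (hw 0)
      have e2 := congrArg (totalLen β) (hw' 0)
      rw [map_add, (hf i).totalLen_liftSubst hβ (hU i).1.1 hT (hc i), hc] at e1
      rw [map_add, (hf' i).totalLen_liftSubst hβ (hU' i).1.1 hT' (hc' i), hc'] at e2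
      linarith
    refine ⟨pisotProj β (castVec w), pisotProj_mem hβ _, fun t => ?_, fun t => ?_⟩
    · rw [hw, map_add, add_comm]
    · rw [hw', map_add, pisotProj_castVec_eq hβ e, add_comm]
  choose y hyV hy hy' using hcorr
  obtain ⟨x, hx0, hx⟩ := exists_int_sequence
    (fun i (a b : pisotSubspace β) => (b : Fin (numTiles β) → ℝ) =
      (substMatrix β).mulVec (a : Fin (numTiles β) → ℝ) + y i) 0
    (fun i a => ⟨⟨_, add_mem (mulVec_mem_pisotSubspace a.2) (hyV i)⟩, rfl⟩)
    (fun i b => by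
      obtain ⟨a, ha, hab⟩ := exists_mulVec_eq hβ (sub_mem b.2 (hyV i))
      exact ⟨⟨a, ha⟩, by simp [hab]⟩)
  refine ⟨fun i t => x i + pisotProj β (f i t), fun i t => x i + pisotProj β (f' i t),
    fun i => ⟨x i, (x i).2, f i, hf i, fun t => rfl, fun t => ?_⟩,
    fun i => ⟨x i, (x i).2, f' i, hf' i, fun t => rfl, fun t => ?_⟩,
    ⟨f 0, f' 0, hf 0, hf' 0, fun t => ?_, fun t => ?_⟩,
    fun i => ⟨x i, (x i).2, f i, f' i, hf i, hf' i, fun t => rfl, fun t => rfl⟩, ?_⟩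
  · simp only
    rw [hx, hy, add_assoc]
  · simp only
    rw [hx, hy', add_assoc]
  · simp only [hx0]
    rfl
  · simp only [hx0]
    rfl
  · obtain ⟨B, hB⟩ := exists_norm_pisotProj_le hβ hF
    refine ⟨B, fun i => ?_⟩
    rw [add_sub_add_left_eq_sub, ← map_sub, hz]
    exact hB _ (hzL i ▸ h i)

/-- Global shadowing in terms of the positions of the initial vertices. -/
lemma orbitGloballyShadows_iff (hβ : IsPisot β) {U U' : ℤ → Set (Tile β)}
    (hU : IsOrbit β U) (hU' : IsOrbit β U') : OrbitGloballyShadows U U' ↔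
      ∃ F : Set ℝ, F.Finite ∧ F ⊆ betaRing β ∧ ∀ i, tStar (U i) - tStar (U' i) ∈ F := by
  constructor
  · rintro ⟨γ, γ', hγ, hγ', hx, hB⟩
    refine exists_finite_of_boundedDistance hβ hU hU' hγ hγ' hB fun i => ?_
    obtain ⟨x, -, f, f', hf, hf', h1, h2⟩ := hx i
    obtain ⟨a, ha⟩ := hf.exists_apply_tStar hβ (hU i).1
    obtain ⟨b, hb⟩ := hf'.exists_apply_tStar hβ (hU' i).1
    refine ⟨a - b, ?_⟩
    rw [h1, h2, ha, hb, castVec_sub, map_sub]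
    abel
  · rintro ⟨F, hF, hFR, h⟩
    obtain ⟨γ, γ', hγ, hγ', -, hx, hB⟩ := exists_strandOrbits hβ hU hU' hF hFR h
    exact ⟨γ, γ', hγ, hγ', hx, hB⟩

/-! ### Units -/

lemma inv_mem_betaRing (hβ : IsPisot β) (h : IsIntegral ℤ β⁻¹) : β⁻¹ ∈ betaRing β := by
  obtain ⟨P, hmon, hP⟩ := h
  let _ : Invertible β⁻¹ := invertibleOfNonzero (inv_ne_zero hβ.pos.ne')
  have h1 := (eval₂_reverse_eq_zero_iff (algebraMap ℤ ℝ) β⁻¹ P).2 hP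
  rw [invOf_eq_inv, inv_inv, ← aeval_def, ← divX_mul_X_add P.reverse, map_add, map_mul, aeval_X,
    aeval_C, coeff_zero_reverse, hmon.leadingCoeff, map_one] at h1
  refine mem_betaRing_iff.2 ⟨-divX P.reverse, ?_⟩
  rw [map_neg]
  apply mul_right_cancel₀ hβ.pos.ne'
  rw [inv_mul_cancel₀ hβ.pos.ne']
  linarith

/-- If `β` is a unit and the image of a vector of the Pisot subspace is the projection of an
integer vector, then so is the vector. -/
lemma exists_pisotProj_eq_of_mulVec (hβ : IsPisot β) (hu : IsIntegral ℤ β⁻¹)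
    {v : Fin (numTiles β) → ℝ} (hv : v ∈ pisotSubspace β) {z : Fin (numTiles β) → ℤ}
    (h : (substMatrix β).mulVec v = pisotProj β (castVec z)) :
    ∃ w : Fin (numTiles β) → ℤ, v = pisotProj β (castVec w) := by
  obtain ⟨w, hw⟩ := exists_totalLen_eq hβ
    (mul_mem (inv_mem_betaRing hβ hu) (totalLen_castVec_mem hβ z))
  refine ⟨w, ?_⟩
  rw [← sub_eq_zero]
  refine eq_zero_of_mulVec_eq_zero hβ (sub_mem hv (pisotProj_mem hβ _)) ?_
  rw [Matrix.mulVec_sub, h, ← pisotProj_mulVec hβ, substMatrix_mulVec_castVec, sub_eq_zero]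
  apply pisotProj_castVec_eq hβ
  rw [← substMatrix_mulVec_castVec, totalLen_mulVec hβ, hw, mul_inv_cancel_left₀ hβ.pos.ne']

/-- If `β` is a unit, it suffices that the strands of the tilings themselves are projections of
lifts: the initial vertices then differ by projections of integer vectors along the whole orbit. -/
lemma exists_finite_of_weak (hβ : IsPisot β) (hu : IsIntegral ℤ β⁻¹) {U U' : ℤ → Set (Tile β)}
    (hU : IsOrbit β U) (hU' : IsOrbit β U') {γ γ' : ℤ → ℝ → Fin (numTiles β) → ℝ}
    (hγ : IsStrandOrbit U γ) (hγ' : IsStrandOrbit U' γ') (hB : BoundedDistance U U' γ γ')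
    (h0 : ∃ f f', IsLift (U 0) f ∧ IsLift (U' 0) f' ∧
      IsStrandOf β 0 f (γ 0) ∧ IsStrandOf β 0 f' (γ' 0)) :
    ∃ F : Set ℝ, F.Finite ∧ F ⊆ betaRing β ∧ ∀ i, tStar (U i) - tStar (U' i) ∈ F := by
  refine exists_finite_of_boundedDistance hβ hU hU' hγ hγ' hB ?_
  -- the difference of the translation vectors of the strands at the times `i` and `i + 1`
  have hstep : ∀ i, ∃ v ∈ pisotSubspace β, ∃ a b : Fin (numTiles β) → ℤ,
      γ i (tStar (U i)) - γ' i (tStar (U' i)) = v + pisotProj β (castVec a) ∧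
      γ (i + 1) (tStar (U (i + 1))) - γ' (i + 1) (tStar (U' (i + 1))) =
        (substMatrix β).mulVec v + pisotProj β (castVec b) := by
    intro i
    obtain ⟨x, hx, f, hf, h1, h2⟩ := hγ i
    obtain ⟨x', hx', f', hf', h1', h2'⟩ := hγ' i
    obtain ⟨a, ha⟩ := hf.exists_apply_tStar hβ (hU i).1
    obtain ⟨a', ha'⟩ := hf'.exists_apply_tStar hβ (hU' i).1
    obtain ⟨b, hb⟩ := IsLift.exists_apply_tStar hβ (hU (i + 1)).1
      ((hU i).2 ▸ hf.liftSubst_isLift hβ)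
    obtain ⟨b', hb'⟩ := IsLift.exists_apply_tStar hβ (hU' (i + 1)).1
      ((hU' i).2 ▸ hf'.liftSubst_isLift hβ)
    refine ⟨x - x', sub_mem hx hx', a - a', b - b', ?_, ?_⟩
    · rw [h1, h1', ha, ha', castVec_sub, map_sub]
      abel
    · rw [h2, h2', hb, hb', castVec_sub, map_sub, Matrix.mulVec_sub]
      abel
  intro i
  induction i using Int.induction_on with
  | zero =>
    obtain ⟨f, f', hf, hf', h1, h2⟩ := h0
    obtain ⟨a, ha⟩ := hf.exists_apply_tStar hβ (hU 0).1
    obtain ⟨b, hb⟩ := hf'.exists_apply_tStar hβ (hU' 0).1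
    refine ⟨a - b, ?_⟩
    rw [h1, h2, ha, hb, castVec_sub, map_sub]
    abel
  | succ i ih =>
    obtain ⟨v, hv, a, b, h1, h2⟩ := hstep i
    obtain ⟨z, hz⟩ := ih
    have hv' : v = pisotProj β (castVec (z - a)) := by
      rw [castVec_sub, map_sub, ← hz, h1, add_sub_cancel_right]
    refine ⟨(intMatrix β).mulVec (z - a) + b, ?_⟩
    rw [h2, hv', ← pisotProj_mulVec hβ, substMatrix_mulVec_castVec, castVec_add, map_add]
  | pred i ih =>
    obtain ⟨v, hv, a, b, h1, h2⟩ := hstep (-i - 1)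
    rw [sub_add_cancel] at h2
    obtain ⟨z, hz⟩ := ih
    obtain ⟨w, hw⟩ := exists_pisotProj_eq_of_mulVec hβ hu hv (z := z - b) (by
      rw [castVec_sub, map_sub, ← hz, h2, add_sub_cancel_right])
    exact ⟨w + a, by rw [h1, hw, castVec_add, map_add]⟩

/-! ### The case of an integer `β` -/

lemma exists_int_of_mem_betaRing (hN : β ∈ Set.range ((↑) : ℕ → ℝ)) {x : ℝ}
    (hx : x ∈ betaRing β) : ∃ k : ℤ, x = k := by
  obtain ⟨n, rfl⟩ := hN
  obtain ⟨P, rfl⟩ := mem_betaRing_iff.1 hx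
  refine ⟨P.eval (n : ℤ), ?_⟩
  have := aeval_algebraMap_apply_eq_algebraMap_eval (A := ℝ) (n : ℤ) P
  simpa using this

lemma subsingleton_type_of_nat (hN : β ∈ Set.range ((↑) : ℕ → ℝ)) :
    Subsingleton (Fin (numTiles β)) := by
  obtain ⟨n, hn⟩ := hN
  have h0 : betaMap β 0 = 0 := betaMap_zero
  have h1 : betaMap β 1 = 0 := by
    rw [betaMap, mul_one, ← hn, Int.floor_natCast]
    simp
  have hs : vertexSet β ⊆ {0, 1} := by
    rintro x (rfl | ⟨k, rfl⟩)
    · exact Or.inl rfl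
    · cases k with
      | zero => exact Or.inr rfl
      | succ k =>
        left
        rw [Function.iterate_succ_apply, h1]
        exact Function.iterate_fixed h0 k
  have hcard : (vertexSet β).ncard ≤ 2 :=
    (Set.ncard_le_ncard hs (Set.toFinite _)).trans (Set.ncard_pair zero_ne_one).le
  have hle : numTiles β ≤ 1 := by
    rw [numTiles]
    omega
  exact Fin.subsingleton_iff_le_one.2 hle

/-- For an integer `β`, all tilings are tilings by translates of the unit interval, and two of them
agree if some of their tiles differ by an integer translation. -/
lemma eq_of_nat (hβ : IsPisot β) (hN : β ∈ Set.range ((↑) : ℕ → ℝ)) {T T' : Set (Tile β)}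
    (hT : IsTiling T) (hT' : IsTiling T') {τ τ' : Tile β} (hτ : τ ∈ T) (hτ' : τ' ∈ T') {k : ℤ}
    (h : τ'.shift = τ.shift + k) : T = T' := by
  have hsub := subsingleton_type_of_nat hN
  have key : ∀ {T : Set (Tile β)}, IsTiling T → ∀ {σ τ : Tile β}, σ ∈ T → τ ∈ T →
      ∃ k : ℤ, σ.shift = τ.shift + k := by
    intro T hT σ τ hσ hτ
    obtain ⟨f, hf⟩ := hT.exists_lift hβ
    obtain ⟨a, ha⟩ := hf.exists_apply_min hβ hσ
    obtain ⟨b, hb⟩ := hf.exists_apply_min hβ hτ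
    obtain ⟨k, hk⟩ := exists_int_of_mem_betaRing hN (totalLen_castVec_mem hβ (a - b))
    refine ⟨k, ?_⟩
    have e := hf.totalLen_eq hβ hT σ.min τ.min
    rw [castVec_sub, map_sub, ← ha, ← hb] at hk
    have ht : σ.type = τ.type := Subsingleton.elim _ _
    simp only [Tile.min, ht] at e hk
    linarith
  refine hT.eq_of_subset hβ hT' fun σ hσ => ?_
  obtain ⟨σ', hσ', hy⟩ := hT'.exists_mem hβ σ.min
  obtain ⟨l, hl⟩ := key hT hσ hτ
  obtain ⟨l', hl'⟩ := key hT' hσ' hτ'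
  rwa [eq_of_mem_ico_of_int hβ (k := l' + k - l) (by push_cast; linarith)
    (Tile.min_mem_ico hβ σ) hy]

/-- On the solenoid, both relations are equality. -/
lemma solenoid_iff (hβ : IsPisot β) (hN : β ∈ Set.range ((↑) : ℕ → ℝ)) {U U' : ℤ → Set (Tile β)}
    (hU : IsOrbit β U) (hU' : IsOrbit β U') :
    SolenoidStronglyRegionallyProximal β U U' ↔ OrbitGloballyShadows U U' := by
  obtain ⟨C, -, hC⟩ := exists_tStar_spec hβ
  -- tilings with a common non-empty central patch are equal
  have hpatch : ∀ {T T' : Set (Tile β)}, IsTiling T → IsTiling T' →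
      centralPatch 1 T = centralPatch 1 T' → T = T' := by
    intro T T' hT hT' h
    obtain ⟨τ, hτ, hy⟩ := hT.exists_mem hβ 0
    have hm := mem_centralPatch_of_mem_ico hτ hy (R := 1) (by norm_num)
    rw [h] at hm
    exact eq_of_nat hβ hN hT hT' hτ hm.1 (k := 0) (by simp)
  rw [orbitGloballyShadows_iff hβ hU hU']
  constructor
  · intro h
    have hneg : ∀ j : ℕ, U (-j) = U' (-j) := by
      intro j
      obtain ⟨S, S', hS, hS', t, hSS⟩ := h 1 j one_pos
      obtain ⟨h1, h2, h3⟩ := hSS j le_rfl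
      have e := hpatch (translate_mem_tilingSpace hβ (hS _).1 _).1
        (translate_mem_tilingSpace hβ (hS' _).1 _).1 h3
      have e' := congrArg (fun T => translate T (-(t / β ^ j))) e
      simp only [translate_translate, neg_add_cancel, translate_zero] at e'
      rw [hpatch (hU _).1.1 (hS _).1.1 h1, hpatch (hU' _).1.1 (hS' _).1.1 h2, e']
    have hall : ∀ i, U i = U' i := by
      intro i
      rcases Int.le_total 0 i with hi | hi
      · obtain ⟨n, rfl⟩ := Int.eq_ofNat_of_zero_le hi
        have h1 := hU.iterate 0 n
        have h2 := hU'.iterate 0 n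
        have h0 : U 0 = U' 0 := by simpa using hneg 0
        rw [zero_add] at h1 h2
        rw [← h1, ← h2, h0]
      · obtain ⟨n, hn⟩ := Int.eq_ofNat_of_zero_le (neg_nonneg.2 hi)
        have := hneg n
        rwa [← hn, neg_neg] at this
    refine ⟨{0}, Set.finite_singleton 0, ?_, fun i => ?_⟩
    · rintro _ rfl
      exact zero_mem _
    · rw [hall, sub_self]
      rfl
  · rintro ⟨F, -, hFR, h⟩
    have hall : U = U' := by
      funext i
      obtain ⟨k, hk⟩ := exists_int_of_mem_betaRing hN (hFR (h i))
      refine eq_of_nat hβ hN (hU i).1.1 (hU' i).1.1 (hC _ (hU i).1).1 (hC _ (hU' i).1).1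
        (k := -k) ?_
      have e1 := firstTile_min hβ (tStar (U i))
      have e2 := firstTile_min hβ (tStar (U' i))
      have ht : (firstTile hβ (tStar (U i))).type = (firstTile hβ (tStar (U' i))).type := rfl
      simp only [Tile.min, ht] at e1 e2
      push_cast
      linarith
    subst hall
    exact fun R n _ => ⟨U, U, hU, hU, 0, fun j _ => ⟨rfl, rfl, rfl⟩⟩

end BetaTiling

end

theorem theorem5 (β : ℝ) (hβ : BetaTiling.IsPisot β) :
    (β ∉ Set.range ((↑) : ℕ → ℝ) →
      ∀ T ∈ BetaTiling.tilingSpace β, ∀ T' ∈ BetaTiling.tilingSpace β,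
        (BetaTiling.StronglyRegionallyProximal β T T' ↔ BetaTiling.GloballyShadows β T T') ∧
        (IsIntegral ℤ β⁻¹ →
          (BetaTiling.StronglyRegionallyProximal β T T' ↔
            BetaTiling.WeaklyGloballyShadows β T T'))) ∧
    (β ∈ Set.range ((↑) : ℕ → ℝ) →
      ∀ U U' : ℤ → Set (BetaTiling.Tile β), BetaTiling.IsOrbit β U → BetaTiling.IsOrbit β U' →
        (BetaTiling.SolenoidStronglyRegionallyProximal β U U' ↔
          BetaTiling.OrbitGloballyShadows U U')) := by
  refine ⟨fun hN T hT T' hT' => ?_, fun hN U U' hU hU' => ?_⟩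
  · have hfin : BetaTiling.StronglyRegionallyProximal β T T' →
        ∃ U U' : ℤ → Set (BetaTiling.Tile β), BetaTiling.IsOrbit β U ∧ BetaTiling.IsOrbit β U' ∧
          U 0 = T ∧ U' 0 = T' ∧ ∃ F : Set ℝ, F.Finite ∧ F ⊆ BetaTiling.betaRing β ∧
            ∀ i, BetaTiling.tStar (U i) - BetaTiling.tStar (U' i) ∈ F := by
      intro h
      obtain ⟨U, hU, rfl⟩ := BetaTiling.exists_orbit hβ hN hT
      obtain ⟨U', hU', rfl⟩ := BetaTiling.exists_orbit hβ hN hT'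
      obtain ⟨F, hF, hFR, hFs⟩ := BetaTiling.exists_finite_of_stronglyRegionallyProximal hβ
      exact ⟨U, U', hU, hU', rfl, rfl, F, hF, hFR, fun i => hFs _ (hU i).1 _ (hU' i).1
        (BetaTiling.stronglyRegionallyProximal_orbit hβ hN hU hU' h i)⟩
    refine ⟨⟨fun h => ?_, ?_⟩, fun hu => ⟨fun h => ?_, ?_⟩⟩
    · obtain ⟨U, U', hU, hU', h0, h0', hF⟩ := hfin h
      exact ⟨U, U', hU, hU', h0, h0', (BetaTiling.orbitGloballyShadows_iff hβ hU hU').2 hF⟩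
    · rintro ⟨U, U', hU, hU', rfl, rfl, h⟩
      obtain ⟨F, hF, hFR, hFs⟩ := (BetaTiling.orbitGloballyShadows_iff hβ hU hU').1 h
      exact BetaTiling.stronglyRegionallyProximal_of_finite hβ hU hU' hF hFR hFs
    · obtain ⟨U, U', hU, hU', rfl, rfl, F, hF, hFR, hFs⟩ := hfin h
      obtain ⟨γ, γ', hγ, hγ', h0, -, hB⟩ :=
        BetaTiling.exists_strandOrbits hβ hU hU' hF hFR hFs
      exact ⟨U, U', hU, hU', rfl, rfl, γ, γ', hγ, hγ', h0, hB⟩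
    · rintro ⟨U, U', hU, hU', rfl, rfl, γ, γ', hγ, hγ', h0, hB⟩
      obtain ⟨F, hF, hFR, hFs⟩ := BetaTiling.exists_finite_of_weak hβ hu hU hU' hγ hγ' hB h0
      exact BetaTiling.stronglyRegionallyProximal_of_finite hβ hU hU' hF hFR hFs
  · exact BetaTiling.solenoid_iff hβ hN hU hU'
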